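/- Let $k$ be a field, let $X$ be a smooth connected quasi-projective (for instance projective) curve over $k$, and let $d\ge 0$ be an integer. Let the symmetric group $S_d$ act on the $d$-fold fibre power $X^d=X\times_k\cdots\times_k X$ by permuting the factors, and let $X^{(d)}=X^d/S_d$ be the quotient, i.e. the locally ringed space whose underlying space is the orbit space with the quotient topology and whose functions on an open set $U$ are the $S_d$-invariant functions on the preimage of $U$ in $X^d$. Then the symmetric power $X^{(d)}$ is nonsingular: it is a scheme, it is smooth over $k$, and all its local rings are regular. -/

import Mathlib

open CategoryTheory Limits AlgebraicGeometry

universe u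

noncomputable section

namespace SymPow

attribute [local instance] MvPolynomial.gradedAlgebra

/-- Projective `n`-space over the field `k`: `Proj` of the standard graded polynomial ring
`k[x₀, …, xₙ]`. -/
abbrev projectiveSpace (k : Type u) [Field k] (n : ℕ) : Scheme.{u} :=
  Proj (MvPolynomial.homogeneousSubmodule (Fin (n + 1)) k)

/-- The structure morphism of projective `n`-space over `k`. -/
def projectiveSpaceHom (k : Type u) [Field k] (n : ℕ) :
    projectiveSpace k n ⟶ Spec (.of k) :=
  Proj.toSpecZero (MvPolynomial.homogeneousSubmodule (Fin (n + 1)) k) ≫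
    Spec.map (CommRingCat.ofHom
      (algebraMap k (MvPolynomial.homogeneousSubmodule (Fin (n + 1)) k 0)))

/-- A `k`-scheme `f : X ⟶ Spec k` is quasi-projective if it admits an immersion over `k` (that is,
a locally closed immersion) into some projective space over `k`. Projective schemes (those which
admit a closed immersion) are included. -/
def IsQuasiProjective {k : Type u} [Field k] {X : Scheme.{u}} (f : X ⟶ Spec (.of k)) : Prop :=
  ∃ (n : ℕ) (i : X ⟶ projectiveSpace k n), IsImmersion i ∧ i ≫ projectiveSpaceHom k n = f

variable {S X : Scheme.{u}}

/-- The `d`-fold fibre power `X ×_S ⋯ ×_S X` of an `S`-scheme `f : X ⟶ S`, as an `S`-scheme. -/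
def power (f : X ⟶ S) (d : ℕ) : Over S :=
  ∏ᶜ fun _ : Fin d => Over.mk f

/-- The `i`-th projection `X ×_S ⋯ ×_S X ⟶ X`. -/
def proj (f : X ⟶ S) (d : ℕ) (i : Fin d) : power f d ⟶ Over.mk f :=
  Pi.π (fun _ : Fin d => Over.mk f) i

/-- A permutation `σ` acts on the fibre power by permuting the factors,
`(x₁, …, x_d) ↦ (x_{σ⁻¹ 1}, …, x_{σ⁻¹ d})`. -/
def permHom (f : X ⟶ S) (d : ℕ) (σ : Equiv.Perm (Fin d)) : power f d ⟶ power f d :=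
  Pi.lift fun i => proj f d (σ⁻¹ i)

theorem permHom_proj (f : X ⟶ S) (d : ℕ) (σ : Equiv.Perm (Fin d)) (i : Fin d) :
    permHom f d σ ≫ proj f d i = proj f d (σ⁻¹ i) :=
  Pi.lift_π _ _

theorem power_hom_ext (f : X ⟶ S) (d : ℕ) {T : Over S} (a b : T ⟶ power f d)
    (h : ∀ i, a ≫ proj f d i = b ≫ proj f d i) : a = b :=
  Pi.hom_ext _ _ h

/-- The action of the symmetric group `S_d` on the `d`-fold fibre power, as a functor from the
one-object category attached to `S_d`. -/
def permAction (f : X ⟶ S) (d : ℕ) : SingleObj (Equiv.Perm (Fin d)) ⥤ Over S where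
  obj _ := power f d
  map σ := permHom f d σ
  map_id _ := power_hom_ext f d _ _ fun i => by
    rw [permHom_proj, Category.id_comp, SingleObj.id_as_one, inv_one, Equiv.Perm.one_apply]
  map_comp σ τ := power_hom_ext f d _ _ fun i => by
    rw [permHom_proj, Category.assoc, permHom_proj, permHom_proj, SingleObj.comp_as_mul,
      mul_inv_rev, Equiv.Perm.mul_apply]

/-- The action of `S_d` on the `d`-fold fibre power, seen as a locally ringed space. -/
def permActionLRS (f : X ⟶ S) (d : ℕ) :
    SingleObj (Equiv.Perm (Fin d)) ⥤ LocallyRingedSpace.{u} :=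
  permAction f d ⋙ Over.forget S ⋙ Scheme.forgetToLocallyRingedSpace

/-- The symmetric power `X^(d) = (X ×_S ⋯ ×_S X) / S_d`: the quotient of the fibre power by the
action of the symmetric group, formed in locally ringed spaces. Its underlying space is the
orbit space with the quotient topology, and its functions on an open set `U` are the
`S_d`-invariant functions on the preimage of `U`. -/
def symPower (f : X ⟶ S) (d : ℕ) : LocallyRingedSpace.{u} :=
  colimit (permActionLRS f d)

/-- The structure morphism `X^(d) ⟶ S`, induced by that of the fibre power. -/
def symPowerHom (f : X ⟶ S) (d : ℕ) : symPower f d ⟶ S.toLocallyRingedSpace :=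
  colimit.desc (permActionLRS f d)
    { pt := S.toLocallyRingedSpace
      ι :=
        { app := fun _ => Scheme.Hom.toLRSHom (power f d).hom
          naturality := fun _ _ σ =>
            (congrArg Scheme.Hom.toLRSHom (Over.w (permHom f d σ))).trans
              (Category.comp_id _).symm } }

end SymPow

end

/-!
# Symmetric powers of smooth curves are nonsingular

Let `X` be a smooth quasi-projective curve over `k`.

*Reduction to affine curves.* Any finite set of points of `X` lies in an affine open subset
(`exists_isAffineOpen_of_isImmersion`, by homogeneous prime avoidance). So every point of the fibre
power lies in a stable affine open subset `Spec (A ⊗ ⋯ ⊗ A)`, with `Spec A` open in `X`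
(`specToPower_isOpenImmersion`). The quotient in locally ringed spaces is the orbit space with the
invariant functions (`isOrbitSpace_colimit`); its formation is local
(`IsOrbitSpace.of_isOpenImmersion`), and for a finite group acting on an affine scheme it is the
spectrum of the ring of invariants (`IsOrbitSpace.isIso_toΓSpec`). Hence the symmetric power is
covered by spectra of rings `R` of symmetric tensors (`exists_chart`), and it remains to show that
these are smooth over `k` (`smooth_invariants`); they are then regular (`isRegularRing_of_smooth`).

*Smoothness of symmetric tensors.* The formation of invariants commutes with flat base change
(`isInvariant_of_flat`), so that `k` may be assumed to be algebraically closed. A closed point of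
`B = A ⊗ ⋯ ⊗ A` is then a tuple of rational points of the curve. There is a function `t` which is an
étale coordinate at all of them and takes different values at different points
(`IsSmoothCurve.exists_isEtaleCoordinate`). The copies `t₁, …, t_d` of `t` make `B` étale over the
polynomial ring `P = k[T₁, …, T_d]` near that point. Near the fixed locus of the transposition
`(i j)`, this transposition is trivial modulo `tⱼ - tᵢ`, because an étale coordinate leaves no room
for two different lifts (`Separates.sub_swap_smul_mem`). So every antisymmetrisation
`∑ σ, sign σ • σ c` is divisible by each `tⱼ - tᵢ`, and therefore by the Vandermonde product `Δ`,
on a neighbourhood of the image of the point in the quotient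
(`Separates.exists_dvd_mul_alternation`).

The operator `D c = Δ⁻¹ ∑ σ, sign σ • σ c` with invariant values then exists on `B` as it does on
`P`. Expanding `∏_{i < j} (xⱼ - yᵢ)` gives elements `aₛ, bₛ` of `P` such that `c = ∑ D (bₛ c) aₛ`
for all `c` (`HasDividedDifferences.eq_sum`). The same formula over `P` and over `B` shows that `B`
is the base change of `P` from the symmetric polynomials to `R`, locally on `R`, and that `P` is
faithfully flat over the symmetric polynomials (`HasDividedDifferences.isPushout`,
`HasDividedDifferences.faithfullyFlat`). As `B` is étale over `P`, it follows by descent that `R` is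
étale over the ring of symmetric polynomials, which is a polynomial ring
(`smooth_invariants_of_etale`).
-/

/-! ### Divided differences for the symmetric group -/

namespace SymPow

open Equiv.Perm in
/-- The antisymmetrisation `∑ σ, sign σ • σ c` of an element of a ring acted upon by `S_d`. -/
def alternation (d : ℕ) {C : Type*} [CommRing C] [MulSemiringAction (Equiv.Perm (Fin d)) C]
    (c : C) : C :=
  ∑ σ : Equiv.Perm (Fin d), (sign σ : ℤ) • (σ • c)

/-- The Vandermonde product `∏_{i < j} (t j - t i)`. -/
def vandermondeDet {d : ℕ} {C : Type*} [CommRing C] (t : Fin d → C) : C :=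
  (Matrix.vandermonde t).det

/-- The family `t` of elements of `C` is permuted by `S_d`, its Vandermonde product is a
nonzerodivisor, and it divides every antisymmetrisation: the divided difference
`alternation d c / vandermondeDet t` is defined on all of `C`. -/
structure HasDividedDifferences {d : ℕ} {C : Type*} [CommRing C]
    [MulSemiringAction (Equiv.Perm (Fin d)) C] (t : Fin d → C) : Prop where
  smul_eq : ∀ (σ : Equiv.Perm (Fin d)) i, σ • t i = t (σ i)
  nonZeroDivisor : vandermondeDet t ∈ nonZeroDivisors C
  dvd_alternation : ∀ c, vandermondeDet t ∣ alternation d c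

section Alternation

variable {d : ℕ} {C : Type*} [CommRing C]

lemma map_vandermondeDet {D F : Type*} [CommRing D] [FunLike F C D] [RingHomClass F C D]
    (φ : F) (t : Fin d → C) : φ (vandermondeDet t) = vandermondeDet (fun i => φ (t i)) := by
  simp [vandermondeDet, Matrix.det_vandermonde]

lemma vandermondeDet_comp_perm (t : Fin d → C) (σ : Equiv.Perm (Fin d)) :
    vandermondeDet (fun i => t (σ i)) = (Equiv.Perm.sign σ : ℤ) • vandermondeDet t := by
  have := Matrix.det_permute σ (Matrix.vandermonde t)
  rw [zsmul_eq_mul]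
  exact this

variable [MulSemiringAction (Equiv.Perm (Fin d)) C]

lemma smul_vandermondeDet {t : Fin d → C} (ht : ∀ (σ : Equiv.Perm (Fin d)) i, σ • t i = t (σ i))
    (σ : Equiv.Perm (Fin d)) :
    σ • vandermondeDet t = (Equiv.Perm.sign σ : ℤ) • vandermondeDet t := by
  rw [← vandermondeDet_comp_perm]
  have := map_vandermondeDet (MulSemiringAction.toRingHom (Equiv.Perm (Fin d)) C σ) t
  simpa [ht] using this

lemma smul_zsmul' (σ : Equiv.Perm (Fin d)) (n : ℤ) (c : C) : σ • (n • c) = n • (σ • c) :=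
  map_zsmul (MulSemiringAction.toRingHom (Equiv.Perm (Fin d)) C σ) n c

lemma smul_alternation (σ : Equiv.Perm (Fin d)) (c : C) :
    σ • alternation d c = (Equiv.Perm.sign σ : ℤ) • alternation d c := by
  rw [alternation, Finset.smul_sum, Finset.smul_sum,
    ← (Equiv.mulLeft σ⁻¹).sum_comp _ _ (fun _ _ => Finset.mem_coe.mpr (Finset.mem_univ _))]
  refine Finset.sum_congr rfl fun τ _ => ?_
  rw [smul_zsmul', smul_smul, smul_smul]
  simp

lemma alternation_add (a b : C) : alternation d (a + b) = alternation d a + alternation d b := by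
  simp [alternation, Finset.sum_add_distrib]

lemma alternation_mul_of_invariant {r : C} (hr : ∀ σ : Equiv.Perm (Fin d), σ • r = r) (c : C) :
    alternation d (r * c) = r * alternation d c := by
  simp only [alternation, Finset.mul_sum, MulSemiringAction.smul_mul, hr, zsmul_eq_mul]
  exact Finset.sum_congr rfl fun σ _ => mul_left_comm _ _ _

lemma map_alternation {D : Type*} [CommRing D] [MulSemiringAction (Equiv.Perm (Fin d)) D]
    (φ : C →+* D) (hφ : ∀ (σ : Equiv.Perm (Fin d)) c, φ (σ • c) = σ • φ c) (c : C) :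
    φ (alternation d c) = alternation d (φ c) := by
  simp [alternation, hφ]

/-- If a transposition acts trivially modulo an ideal, every antisymmetrisation lies in that
ideal: its terms cancel in pairs. -/
lemma alternation_mem_of_swap {I : Ideal C} {i j : Fin d} (hij : i ≠ j)
    (h : ∀ c : C, c - Equiv.swap i j • c ∈ I) (c : C) : alternation d c ∈ I := by
  rw [← Ideal.Quotient.eq_zero_iff_mem, alternation, map_sum]
  refine Finset.sum_involution (fun σ _ => Equiv.swap i j * σ) (fun σ _ => ?_) (fun σ _ _ => ?_)
    (fun _ _ => Finset.mem_univ _) (fun σ _ => by simp)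
  · rw [← map_add, Ideal.Quotient.eq_zero_iff_mem]
    have := zsmul_mem (h (σ • c)) (Equiv.Perm.sign σ : ℤ)
    rw [smul_sub] at this
    rw [mul_smul, Equiv.Perm.sign_mul, Equiv.Perm.sign_swap hij]
    simpa [sub_eq_add_neg] using this
  · intro hσ
    apply hij
    have := congrArg (fun τ => τ (σ⁻¹ i)) hσ
    simpa using this.symm

end Alternation

section Expansion

variable {d : ℕ}

/-- The pairs `(i, j)` with `i < j`. -/
def ltPairs (d : ℕ) : Finset (Fin d × Fin d) :=
  Finset.univ.filter fun p => p.1 < p.2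

/-- The monomials in the first family of variables in the expansion of
`∏_{i < j} (x j - y i)`. -/
def leftMonomial {C : Type*} [CommRing C] (x : Fin d → C) (S : Finset (Fin d × Fin d)) : C :=
  ∏ p ∈ S, x p.2

/-- The monomials, up to sign, in the second family of variables in the expansion of
`∏_{i < j} (x j - y i)`. -/
def rightMonomial {C : Type*} [CommRing C] (y : Fin d → C) (S : Finset (Fin d × Fin d)) : C :=
  ∏ p ∈ ltPairs d \ S, (-y p.1)

variable {C : Type*} [CommRing C]

lemma sum_leftMonomial_mul_rightMonomial (x y : Fin d → C) :
    ∑ S ∈ (ltPairs d).powerset, leftMonomial x S * rightMonomial y S =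
      ∏ p ∈ ltPairs d, (x p.2 - y p.1) := by
  simp only [sub_eq_add_neg]
  rw [Finset.prod_add]
  rfl

lemma vandermondeDet_eq_prod (t : Fin d → C) :
    vandermondeDet t = ∏ p ∈ ltPairs d, (t p.2 - t p.1) := by
  rw [vandermondeDet, Matrix.det_vandermonde, Finset.prod_sigma', ltPairs]
  refine Finset.prod_bij' (fun p _ => (p.1, p.2)) (fun p _ => ⟨p.1, p.2⟩) ?_ ?_ ?_ ?_ ?_ <;> simp

lemma perm_eq_one_of_le (σ : Equiv.Perm (Fin d)) (h : ∀ i, σ i ≤ i) : σ = 1 := by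
  ext1 i
  induction i using WellFoundedLT.induction with
  | _ i ih =>
    by_contra hne
    have hlt : σ i < i := lt_of_le_of_ne (h i) hne
    exact hlt.ne (σ.injective (ih _ hlt))

/-- Among the products `∏_{i < j} (t j - t (σ i))` only the one for `σ = 1` is nonzero: a
permutation other than the identity moves some `i` to some `j > i`. -/
lemma prod_sub_perm_eq_zero (t : Fin d → C) {σ : Equiv.Perm (Fin d)} (hσ : σ ≠ 1) :
    ∏ p ∈ ltPairs d, (t p.2 - t (σ p.1)) = 0 := by
  obtain ⟨i, hi⟩ : ∃ i, i < σ i := by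
    by_contra! h
    exact hσ (perm_eq_one_of_le σ h)
  exact Finset.prod_eq_zero (i := (i, σ i)) (by simpa [ltPairs] using hi) (by simp)

variable [MulSemiringAction (Equiv.Perm (Fin d)) C]

lemma smul_rightMonomial {t : Fin d → C}
    (ht : ∀ (σ : Equiv.Perm (Fin d)) i, σ • t i = t (σ i)) (σ : Equiv.Perm (Fin d))
    (S : Finset (Fin d × Fin d)) :
    σ • rightMonomial t S = rightMonomial (fun i => t (σ i)) S := by
  simp [rightMonomial, Finset.smul_prod', ht]

/-- Every element is recovered from the antisymmetrisations of its multiples: this is the dual basis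
property of the monomials for the pairing given by divided differences. -/
lemma sum_leftMonomial_mul_alternation {t : Fin d → C}
    (ht : ∀ (σ : Equiv.Perm (Fin d)) i, σ • t i = t (σ i)) (c : C) :
    ∑ S ∈ (ltPairs d).powerset, leftMonomial t S * alternation d (rightMonomial t S * c) =
      vandermondeDet t * c := by
  simp only [alternation, Finset.mul_sum]
  rw [Finset.sum_comm, Finset.sum_eq_single_of_mem 1 (Finset.mem_univ _)]
  · simp only [Equiv.Perm.sign_one, Units.val_one, one_smul, ← mul_assoc, ← Finset.sum_mul]
    rw [sum_leftMonomial_mul_rightMonomial, vandermondeDet_eq_prod]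
  · intro σ _ hσ
    simp only [smul_mul', smul_rightMonomial ht, mul_smul_comm, ← mul_assoc, ← Finset.smul_sum,
      ← Finset.sum_mul]
    rw [sum_leftMonomial_mul_rightMonomial, prod_sub_perm_eq_zero t hσ, zero_mul, smul_zero]

end Expansion

namespace HasDividedDifferences

lemma eq_sum {d : ℕ} {C R : Type*} [CommRing C] [MulSemiringAction (Equiv.Perm (Fin d)) C]
    [CommRing R] [Algebra R C] {t : Fin d → C} (h : HasDividedDifferences t) {D : C →ₗ[R] R}
    (hD : ∀ c, vandermondeDet t * algebraMap R C (D c) = alternation d c) (c : C) :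
    c = ∑ S ∈ (ltPairs d).powerset, D (rightMonomial t S * c) • leftMonomial t S := by
  refine mul_cancel_left_mem_nonZeroDivisors h.nonZeroDivisor |>.mp ?_
  rw [← sum_leftMonomial_mul_alternation h.smul_eq, Finset.mul_sum]
  refine Finset.sum_congr rfl fun S _ => ?_
  rw [← hD, Algebra.smul_def]
  ring

variable {d : ℕ} {C R : Type*} [CommRing C] [MulSemiringAction (Equiv.Perm (Fin d)) C]
  [CommRing R] [Algebra R C] [SMulCommClass (Equiv.Perm (Fin d)) R C]
  [Algebra.IsInvariant R C (Equiv.Perm (Fin d))] {t : Fin d → C}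

variable (R) in
/-- The divided difference operator for the longest element of `S_d`, with values in the ring of
invariants. -/
lemma exists_dividedDifference (h : HasDividedDifferences t)
    (hR : Function.Injective (algebraMap R C)) :
    ∃ D : C →ₗ[R] R, ∀ c, vandermondeDet t * algebraMap R C (D c) = alternation d c := by
  have key : ∀ c, ∃ r : R, vandermondeDet t * algebraMap R C r = alternation d c := by
    intro c
    obtain ⟨e, he⟩ := h.dvd_alternation c
    obtain ⟨r, hr⟩ := Algebra.IsInvariant.isInvariant (A := R) (G := Equiv.Perm (Fin d)) e (by
      intro σ
      have h1 := smul_alternation σ c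
      rw [he, smul_mul', smul_vandermondeDet h.smul_eq, smul_mul_assoc] at h1
      have h2 : vandermondeDet t * (σ • e) = vandermondeDet t * e := by
        rcases Int.units_eq_one_or (Equiv.Perm.sign σ) with hs | hs <;> simpa [hs] using h1
      exact mul_cancel_left_mem_nonZeroDivisors h.nonZeroDivisor |>.mp h2)
    exact ⟨r, by rw [hr, he]⟩
  choose D hD using key
  have inj : ∀ r s : R, vandermondeDet t * algebraMap R C r = vandermondeDet t * algebraMap R C s →
      r = s := fun r s hrs =>
    hR (mul_cancel_left_mem_nonZeroDivisors h.nonZeroDivisor |>.mp hrs)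
  refine ⟨⟨⟨D, fun a b => inj _ _ ?_⟩, fun r a => inj _ _ ?_⟩, hD⟩
  · rw [hD, map_add, mul_add, hD, hD, alternation_add]
  · simp only [RingHom.id_apply]
    rw [hD, Algebra.smul_def, alternation_mul_of_invariant (fun σ => smul_algebraMap σ r),
      smul_eq_mul, map_mul, mul_left_comm, hD]

/-- The divided differences of the multiples of an element are its coordinates with respect to a
dual basis. -/
lemma finite_projective (h : HasDividedDifferences t) (hR : Function.Injective (algebraMap R C)) :
    Module.Finite R C ∧ Module.Projective R C := by
  obtain ⟨D, hD⟩ := h.exists_dividedDifference R hR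
  let a : C →ₗ[R] ((ltPairs d).powerset → R) :=
    LinearMap.pi fun S => D ∘ₗ LinearMap.mulLeft R (rightMonomial t S.1)
  let b : ((ltPairs d).powerset → R) →ₗ[R] C :=
    Fintype.linearCombination R (fun S : (ltPairs d).powerset => leftMonomial t S.1)
  have hab : b ∘ₗ a = LinearMap.id := by
    ext c
    conv_rhs => rw [LinearMap.id_apply, h.eq_sum hD c]
    rw [← Finset.sum_coe_sort]
    simp [a, b, Fintype.linearCombination_apply]
  exact ⟨Module.Finite.of_surjective b fun c => ⟨a c, LinearMap.congr_fun hab c⟩,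
    Module.Projective.of_split a b hab⟩

lemma faithfullyFlat (h : HasDividedDifferences t) (hR : Function.Injective (algebraMap R C)) :
    Module.FaithfullyFlat R C := by
  have := (h.finite_projective hR).2
  have := Algebra.IsInvariant.isIntegral R C (Equiv.Perm (Fin d))
  have : FaithfulSMul R C := (faithfulSMul_iff_algebraMap_injective R C).mpr hR
  exact Module.FaithfullyFlat.of_comap_surjective (Algebra.IsIntegral.comap_surjective R C)

/-- If divided differences exist on both `P` and `C`, compatibly, then `C` is the base change of
`P` from the invariants of `P` to those of `C`: both have the same dual basis. -/
lemma isPushout {L P : Type*} [CommRing L] [CommRing P] [Algebra L P]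
    [MulSemiringAction (Equiv.Perm (Fin d)) P] [SMulCommClass (Equiv.Perm (Fin d)) L P]
    [Algebra.IsInvariant L P (Equiv.Perm (Fin d))] [Algebra P C] [Algebra L R] [Algebra L C]
    [IsScalarTower L P C] [IsScalarTower L R C] {s : Fin d → P}
    (hL : Function.Injective (algebraMap L P)) (hR : Function.Injective (algebraMap R C))
    (hφ : ∀ (σ : Equiv.Perm (Fin d)) p, algebraMap P C (σ • p) = σ • algebraMap P C p)
    (hs : HasDividedDifferences s)
    (ht : HasDividedDifferences (fun i => algebraMap P C (s i))) :
    Algebra.IsPushout L R P C := by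
  obtain ⟨E, hE⟩ := hs.exists_dividedDifference L hL
  obtain ⟨D, hD⟩ := ht.exists_dividedDifference R hR
  have hDE : ∀ p, D (algebraMap P C p) = algebraMap L R (E p) := by
    intro p
    refine hR (mul_cancel_left_mem_nonZeroDivisors ht.nonZeroDivisor |>.mp ?_)
    rw [hD, ← map_alternation _ hφ, ← hE, map_mul, map_vandermondeDet,
      ← IsScalarTower.algebraMap_apply, ← IsScalarTower.algebraMap_apply]
  have hl : ∀ S, leftMonomial (fun i => algebraMap P C (s i)) S =
      algebraMap P C (leftMonomial s S) := fun S => by simp [leftMonomial]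
  have hr : ∀ S, rightMonomial (fun i => algebraMap P C (s i)) S =
      algebraMap P C (rightMonomial s S) := fun S => by simp [rightMonomial]
  let μ : TensorProduct L R P →ₗ[R] C :=
    (IsScalarTower.toAlgHom L P C).toLinearMap.liftBaseChange R
  have hμ : ∀ r p, μ (r ⊗ₜ p) = r • algebraMap P C p := fun r p => by
    simp [μ, LinearMap.liftBaseChange_tmul]
  -- The inverse of the multiplication map `R ⊗ P → C` is the expansion in the dual basis.
  let ψ : C → TensorProduct L R P := fun c =>
    ∑ S ∈ (ltPairs d).powerset,
      D (rightMonomial (fun i => algebraMap P C (s i)) S * c) ⊗ₜ leftMonomial s S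
  have hψ_add : ∀ a b, ψ (a + b) = ψ a + ψ b := fun a b => by
    simp only [ψ, mul_add, map_add, TensorProduct.add_tmul, Finset.sum_add_distrib]
  have hψμ : ∀ x, ψ (μ x) = x := by
    intro x
    induction x with
    | zero => simp [ψ]
    | add x y hx hy => rw [map_add, hψ_add, hx, hy]
    | tmul r p =>
      conv_rhs => rw [hs.eq_sum hE p, TensorProduct.tmul_sum]
      refine Finset.sum_congr rfl fun S _ => ?_
      rw [hμ, mul_smul_comm, map_smul, hr, ← map_mul, hDE, TensorProduct.tmul_smul,
        ← TensorProduct.smul_tmul', Algebra.smul_def (E _), TensorProduct.smul_tmul', mul_comm]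
      simp [mul_comm]
  have hμψ : ∀ c, μ (ψ c) = c := by
    intro c
    conv_rhs => rw [ht.eq_sum hD c]
    simp only [ψ, map_sum, hμ, hl]
  exact ⟨.of_equiv (LinearEquiv.ofBijective μ ⟨Function.LeftInverse.injective hψμ,
    Function.RightInverse.surjective hμψ⟩) fun p =>
    (hμ 1 p).trans (by simp)⟩

end HasDividedDifferences

end SymPow

/-! ### Divided differences over flat extensions of a polynomial ring -/

namespace SymPow

/-- Divisibility by a prime `a` cancels coprime factors even after a flat base change, because
`a, b` stays a weakly regular sequence. -/
lemma dvd_of_dvd_mul_of_flat {P C : Type*} [CommRing P] [IsDomain P] [CommRing C] [Algebra P C]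
    [Module.Flat P C] {a b : P} (ha : Prime a) (hab : ¬ a ∣ b) {c : C}
    (h : algebraMap P C a ∣ algebraMap P C b * c) : algebraMap P C a ∣ c := by
  have key : RingTheory.Sequence.IsWeaklyRegular P [a, b] := by
    rw [RingTheory.Sequence.isWeaklyRegular_cons_iff,
      RingTheory.Sequence.isWeaklyRegular_singleton_iff]
    refine ⟨fun x y hxy => mul_left_cancel₀ ha.ne_zero hxy, ?_⟩
    rw [isSMulRegular_quotient_iff_mem_of_smul_mem]
    intro x hx
    obtain ⟨y, -, hy⟩ := (Submodule.mem_smul_pointwise_iff_exists _ _ _).mp hx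
    obtain ⟨z, hz⟩ := (ha.dvd_or_dvd ⟨y, hy.symm⟩).resolve_left hab
    exact (Submodule.mem_smul_pointwise_iff_exists _ _ _).mpr ⟨z, trivial, hz.symm⟩
  have key' := key.of_flat (S := C)
  simp only [List.map_cons, List.map_nil] at key'
  rw [RingTheory.Sequence.isWeaklyRegular_cons_iff,
      RingTheory.Sequence.isWeaklyRegular_singleton_iff,
      isSMulRegular_quotient_iff_mem_of_smul_mem] at key'
  obtain ⟨y, hy⟩ := h
  obtain ⟨z, -, hz⟩ := (Submodule.mem_smul_pointwise_iff_exists _ _ _).mp (key'.2 c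
    ((Submodule.mem_smul_pointwise_iff_exists _ _ _).mpr ⟨y, trivial, hy.symm⟩))
  exact ⟨z, hz.symm⟩

lemma prod_dvd_of_flat {P C ι : Type*} [CommRing P] [IsDomain P] [CommRing C] [Algebra P C]
    [Module.Flat P C] (s : Finset ι) (f : ι → P) (hf : ∀ i ∈ s, Prime (f i))
    (hff : ∀ i ∈ s, ∀ j ∈ s, f i ∣ f j → i = j) {c : C}
    (hc : ∀ i ∈ s, algebraMap P C (f i) ∣ c) : algebraMap P C (∏ i ∈ s, f i) ∣ c := by
  classical
  induction s using Finset.induction_on with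
  | empty => simp
  | insert a s has ih =>
    obtain ⟨e, rfl⟩ := ih (fun i hi => hf i (Finset.mem_insert_of_mem hi))
      (fun i hi j hj => hff i (Finset.mem_insert_of_mem hi) j (Finset.mem_insert_of_mem hj))
      (fun i hi => hc i (Finset.mem_insert_of_mem hi))
    have ha : Prime (f a) := hf a (Finset.mem_insert_self _ _)
    have hna : ¬ f a ∣ ∏ i ∈ s, f i := by
      intro h
      obtain ⟨j, hj, hj'⟩ := (ha.dvd_finsetProd_iff _).mp h
      have := hff a (Finset.mem_insert_self _ _) j (Finset.mem_insert_of_mem hj) hj'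
      exact has (this ▸ hj)
    obtain ⟨z, rfl⟩ := dvd_of_dvd_mul_of_flat ha hna (hc a (Finset.mem_insert_self _ _))
    rw [Finset.prod_insert has]
    exact ⟨z, by rw [map_mul]; ring⟩

open MvPolynomial

section Polynomial

variable (k : Type*) [CommRing k] {d : ℕ}

lemma sub_rename_update_mem (i j : Fin d) (p : MvPolynomial (Fin d) k) :
    p - rename (Function.update id j i) p ∈
      Ideal.span {(X j - X i : MvPolynomial (Fin d) k)} := by
  have : Ideal.Quotient.mkₐ k (Ideal.span {(X j - X i : MvPolynomial (Fin d) k)}) =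
      (Ideal.Quotient.mkₐ k _).comp (rename (Function.update id j i)) := by
    ext l
    by_cases hl : l = j
    · subst hl
      simpa using Ideal.Quotient.eq.mpr (Ideal.mem_span_singleton_self _)
    · simp [Function.update_of_ne hl]
  exact Ideal.Quotient.eq.mp (DFunLike.congr_fun this p)

lemma X_sub_X_dvd_iff (i j : Fin d) (p : MvPolynomial (Fin d) k) :
    (X j - X i) ∣ p ↔ rename (Function.update id j i) p = 0 := by
  constructor
  · rintro ⟨q, rfl⟩
    by_cases hij : i = j
    · simp [hij]
    · simp [Function.update_of_ne hij]
  · intro h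
    have := sub_rename_update_mem k i j p
    rwa [h, sub_zero, Ideal.mem_span_singleton] at this

variable [IsDomain k]

lemma prime_X_sub_X {i j : Fin d} (hij : i ≠ j) :
    Prime (X j - X i : MvPolynomial (Fin d) k) := by
  refine ⟨sub_ne_zero.mpr fun h => hij (X_injective h).symm, fun h => ?_, fun a b h => ?_⟩
  · have := (X_sub_X_dvd_iff k i j 1).mp h.dvd
    simp at this
  · simp only [X_sub_X_dvd_iff, map_mul, mul_eq_zero] at h ⊢
    exact h

lemma eq_of_X_sub_X_dvd {i j i' j' : Fin d} (h : i < j) (h' : i' < j')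
    (hd : (X j - X i : MvPolynomial (Fin d) k) ∣ X j' - X i') : i = i' ∧ j = j' := by
  rw [X_sub_X_dvd_iff, map_sub, rename_X, rename_X, sub_eq_zero] at hd
  have := X_injective hd
  simp only [Function.update_apply, id] at this
  split_ifs at this <;> grind

/-- `S_d` permutes the variables of the polynomial ring. -/
noncomputable instance permActionMvPolynomial (k : Type*) [CommRing k] (d : ℕ) :
    MulSemiringAction (Equiv.Perm (Fin d)) (MvPolynomial (Fin d) k) where
  smul σ p := rename σ p
  one_smul p := by
    change rename (⇑(1 : Equiv.Perm (Fin d))) p = p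
    simp
  mul_smul σ τ p := by
    change rename (⇑(σ * τ)) p = rename σ (rename τ p)
    simp [rename_rename]
  smul_zero σ := map_zero (rename σ)
  smul_add σ := map_add (rename σ)
  smul_one σ := map_one (rename σ)
  smul_mul σ := map_mul (rename σ)

lemma perm_smul_def (k : Type*) [CommRing k] {d : ℕ} (σ : Equiv.Perm (Fin d))
    (p : MvPolynomial (Fin d) k) : σ • p = rename σ p := rfl

instance (k : Type*) [CommRing k] (d : ℕ) :
    SMulCommClass (Equiv.Perm (Fin d)) (symmetricSubalgebra (Fin d) k)
      (MvPolynomial (Fin d) k) where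
  smul_comm σ a p := by
    rw [Algebra.smul_def, Algebra.smul_def, MulSemiringAction.smul_mul]
    congr 1
    exact a.2 σ

instance (k : Type*) [CommRing k] (d : ℕ) :
    Algebra.IsInvariant (symmetricSubalgebra (Fin d) k) (MvPolynomial (Fin d) k)
      (Equiv.Perm (Fin d)) where
  isInvariant p hp := ⟨⟨p, hp⟩, rfl⟩

lemma vandermondeDet_mem_nonZeroDivisors (C : Type*) [CommRing C]
    [Algebra (MvPolynomial (Fin d) k) C] [Module.Flat (MvPolynomial (Fin d) k) C] :
    vandermondeDet (fun i : Fin d => algebraMap (MvPolynomial (Fin d) k) C (X i)) ∈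
      nonZeroDivisors C := by
  rw [← map_vandermondeDet]
  have : vandermondeDet (X : Fin d → MvPolynomial (Fin d) k) ∈ nonZeroDivisors _ := by
    rw [mem_nonZeroDivisors_iff_ne_zero, vandermondeDet_eq_prod, Finset.prod_ne_zero_iff]
    intro p hp
    exact (prime_X_sub_X k (Finset.mem_filter.mp hp).2.ne).ne_zero
  refine mem_nonZeroDivisors_iff_right.mpr fun c hc =>
    Module.Flat.isSMulRegular_of_nonZeroDivisors (M := C) this ?_
  simp only [Algebra.smul_def]
  rw [mul_comm, hc, mul_zero]

/-- The differences of the variables are pairwise coprime primes, so that over a ring flat over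
the polynomial ring an element divisible by each of them is divisible by their product. -/
lemma vandermondeDet_dvd_of_flat {C : Type*} [CommRing C]
    [Algebra (MvPolynomial (Fin d) k) C] [Module.Flat (MvPolynomial (Fin d) k) C] {c : C}
    (h : ∀ i j : Fin d, i ≠ j → algebraMap (MvPolynomial (Fin d) k) C (X j - X i) ∣ c) :
    vandermondeDet (fun i : Fin d => algebraMap (MvPolynomial (Fin d) k) C (X i)) ∣ c := by
  rw [← map_vandermondeDet, vandermondeDet_eq_prod]
  refine prod_dvd_of_flat _ _ (fun p hp => prime_X_sub_X k (Finset.mem_filter.mp hp).2.ne)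
    (fun p hp q hq hpq => ?_) fun p hp => h _ _ (Finset.mem_filter.mp hp).2.ne
  exact Prod.ext_iff.mpr
    (eq_of_X_sub_X_dvd k (Finset.mem_filter.mp hp).2 (Finset.mem_filter.mp hq).2 hpq)

lemma hasDividedDifferences_X :
    HasDividedDifferences (X : Fin d → MvPolynomial (Fin d) k) := by
  refine ⟨fun σ i => rename_X σ i, vandermondeDet_mem_nonZeroDivisors k _, fun c =>
    vandermondeDet_dvd_of_flat k fun i j hij => ?_⟩
  · refine Ideal.mem_span_singleton.mp (alternation_mem_of_swap hij.symm (fun c => ?_) c)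
    rw [Algebra.algebraMap_self_apply, Ideal.mem_span_singleton, X_sub_X_dvd_iff, map_sub,
      perm_smul_def, rename_rename, sub_eq_zero]
    congr 2
    ext l
    simp only [Function.comp, Function.update_apply, id, Equiv.swap_apply_def]
    split_ifs <;> simp_all

end Polynomial

/-- If `C` is étale over the polynomial ring in `d` variables, equivariantly for `S_d`, and has
divided differences, then the invariants of `C` are étale over the symmetric polynomials, hence
smooth. Being étale descends along the faithfully flat inclusion of the symmetric polynomials into
all polynomials, over which the invariants become `C`. -/
theorem smooth_invariants_of_etale {k : Type*} [Field k] {d : ℕ} {C R : Type*} [CommRing C]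
    [CommRing R] [MulSemiringAction (Equiv.Perm (Fin d)) C] [Algebra k R] [Algebra k C]
    [Algebra R C] [IsScalarTower k R C] [SMulCommClass (Equiv.Perm (Fin d)) R C]
    [Algebra.IsInvariant R C (Equiv.Perm (Fin d))] (hR : Function.Injective (algebraMap R C))
    [Algebra (MvPolynomial (Fin d) k) C] [IsScalarTower k (MvPolynomial (Fin d) k) C]
    [Algebra.Etale (MvPolynomial (Fin d) k) C]
    (h : HasDividedDifferences fun i => algebraMap (MvPolynomial (Fin d) k) C (X i)) :
    Algebra.Smooth k R := by
  have heq : ∀ (σ : Equiv.Perm (Fin d)) (p : MvPolynomial (Fin d) k),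
      algebraMap (MvPolynomial (Fin d) k) C (σ • p) = σ • algebraMap _ C p := by
    intro σ p
    have hsm : ∀ a : k, σ • algebraMap k C a = algebraMap k C a := fun a => by
      rw [IsScalarTower.algebraMap_apply k R C, smul_algebraMap]
    induction p using MvPolynomial.induction_on with
    | C a =>
      rw [← algebraMap_eq, ← IsScalarTower.algebraMap_apply, hsm]
      rw [perm_smul_def, algebraMap_eq, rename_C, ← algebraMap_eq,
        ← IsScalarTower.algebraMap_apply]
    | add p q hp hq => rw [smul_add, map_add, hp, hq, map_add, smul_add]
    | mul_X p i hp =>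
      rw [MulSemiringAction.smul_mul, map_mul, hp, map_mul, MulSemiringAction.smul_mul, h.smul_eq,
        perm_smul_def, rename_X]
  let Λ := symmetricSubalgebra (Fin d) k
  let e : R ≃+* (algebraMap R C).range := RingEquiv.ofBijective (algebraMap R C).rangeRestrict
    ⟨fun a b hab => hR (congrArg Subtype.val hab), (algebraMap R C).rangeRestrict_surjective⟩
  let g : Λ →+* R := e.symm.toRingHom.comp (RingHom.codRestrict
    ((algebraMap (MvPolynomial (Fin d) k) C).comp Λ.val.toRingHom) (algebraMap R C).range
      fun a => Algebra.IsInvariant.isInvariant (G := Equiv.Perm (Fin d)) _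
        fun σ => (heq σ a).symm.trans (congrArg _ (a.2 σ)))
  have hg : ∀ a : Λ, algebraMap R C (g a) = algebraMap (MvPolynomial (Fin d) k) C a :=
    fun a => congrArg Subtype.val (e.apply_symm_apply _)
  let : Algebra Λ R := g.toAlgebra
  have : IsScalarTower Λ R C := .of_algebraMap_eq fun a => (hg a).symm
  have : IsScalarTower k Λ R := .of_algebraMap_eq fun a => hR (by
    rw [RingHom.algebraMap_toAlgebra, hg, ← IsScalarTower.algebraMap_apply k R C,
      IsScalarTower.algebraMap_apply k (MvPolynomial (Fin d) k) C]
    rfl)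
  have hΛ : Function.Injective (algebraMap Λ (MvPolynomial (Fin d) k)) := Subtype.val_injective
  have := (HasDividedDifferences.isPushout hΛ hR heq (hasDividedDifferences_X k) h).symm
  have := (hasDividedDifferences_X k (d := d)).faithfullyFlat hΛ
  have : Algebra.Etale (MvPolynomial (Fin d) k) (TensorProduct Λ (MvPolynomial (Fin d) k) R) :=
    Algebra.Etale.of_equiv (Algebra.IsPushout.equiv Λ (MvPolynomial (Fin d) k) R C).symm
  have : Algebra.Etale Λ R :=
    Algebra.Etale.of_etale_tensorProduct_of_faithfullyFlat (MvPolynomial (Fin d) k)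
  have : Algebra.Smooth k (MvPolynomial (Fin d) k) := ⟨inferInstance, inferInstance⟩
  have : Algebra.Smooth k Λ := .of_equiv (esymmAlgEquiv (Fin d) k (Fintype.card_fin d))
  have : Algebra.Smooth Λ R := inferInstance
  exact .comp k Λ R

end SymPow

/-! ### Invariants and tensor powers under base change -/

namespace SymPow

open scoped TensorProduct

section FlatBaseChange

/-- Invariants under a finite group commute with flat base change: they are the kernel of
`B → ∏ g, B`, `b ↦ (g b - b)`. -/
theorem isInvariant_of_flat (G : Type*) {R B R' B' : Type*} [Group G] [Finite G] [CommRing R]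
    [CommRing B] [CommRing R'] [CommRing B'] [Algebra R B] [MulSemiringAction G B]
    [SMulCommClass G R B] [Algebra.IsInvariant R B G] [Algebra R R'] [Module.Flat R R']
    [Algebra B B'] [Algebra R' B'] [Algebra R B'] [IsScalarTower R B B'] [IsScalarTower R R' B']
    [Algebra.IsPushout R R' B B'] [MulSemiringAction G B'] [SMulCommClass G R' B']
    (h : ∀ (g : G) (b : B), algebraMap B B' (g • b) = g • algebraMap B B' b) :
    Algebra.IsInvariant R' B' G := by
  classical
  have := Fintype.ofFinite G
  let e := Algebra.IsPushout.equiv R R' B B'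
  have he : ∀ r b, e (r ⊗ₜ b) = algebraMap R' B' r * algebraMap B B' b :=
    fun r b => Algebra.IsPushout.equiv_tmul R R' B B' r b
  let act : G → B →ₗ[R] B := fun g => (MulSemiringAction.toAlgHom R B g).toLinearMap
  have hact : ∀ g x, e ((act g).lTensor R' x) = g • e x := by
    intro g x
    induction x with
    | zero => simp
    | add x y hx hy => rw [map_add, map_add, hx, hy, map_add, smul_add]
    | tmul r b =>
      rw [LinearMap.lTensor_tmul, he, he, MulSemiringAction.smul_mul, smul_algebraMap, ← h]
      rfl
  let δ : B →ₗ[R] (G → B) := LinearMap.pi fun g => act g - LinearMap.id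
  have hex : Function.Exact (Algebra.linearMap R B) δ := by
    intro b
    constructor
    · intro hb
      refine Algebra.IsInvariant.isInvariant (G := G) b fun g => ?_
      exact sub_eq_zero.mp (congrFun hb g)
    · rintro ⟨r, rfl⟩
      ext g
      exact sub_eq_zero.mpr (smul_algebraMap g r)
  have hex' := Module.Flat.lTensor_exact R' hex
  refine ⟨fun b' hb' => ?_⟩
  obtain ⟨x, rfl⟩ := e.surjective b'
  have hx : δ.lTensor R' x = 0 := by
    refine (TensorProduct.piRight R R R' (fun _ : G => B)).injective ?_
    rw [map_zero]
    ext g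
    have h1 : ∀ x, TensorProduct.piRight R R R' (fun _ : G => B) (δ.lTensor R' x) g =
        (act g).lTensor R' x - x := by
      intro x
      induction x with
      | zero => simp
      | add x y hx hy => rw [map_add, map_add, Pi.add_apply, hx, hy, map_add]; abel
      | tmul r b => simp [δ, TensorProduct.tmul_sub]
    rw [h1, Pi.zero_apply, sub_eq_zero]
    apply e.injective
    rw [hact, hb']
  obtain ⟨y, rfl⟩ := (hex' x).mp hx
  refine ⟨TensorProduct.rid R R' y, ?_⟩
  clear hx hb'
  induction y with
  | zero => simp
  | add x y hx hy => rw [map_add, map_add, hx, hy, map_add, map_add]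
  | tmul r s =>
    rw [LinearMap.lTensor_tmul, he, TensorProduct.rid_tmul, Algebra.smul_def, map_mul, mul_comm,
      Algebra.linearMap_apply, ← IsScalarTower.algebraMap_apply, ← IsScalarTower.algebraMap_apply]

lemma algebraMap_injective_of_isPushout {R B R' B' : Type*} [CommRing R]
    [CommRing B] [CommRing R'] [CommRing B'] [Algebra R B] [Algebra R R'] [Module.Flat R R']
    [Algebra B B'] [Algebra R' B'] [Algebra R B'] [IsScalarTower R B B'] [IsScalarTower R R' B']
    [Algebra.IsPushout R R' B B'] (h : Function.Injective (algebraMap R B)) :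
    Function.Injective (algebraMap R' B') := by
  have h1 := Module.Flat.lTensor_preserves_injective_linearMap (M := R') (Algebra.linearMap R B) h
  have h2 : ∀ r, algebraMap R' B' r = Algebra.IsPushout.equiv R R' B B'
      ((Algebra.linearMap R B).lTensor R' ((TensorProduct.rid R R').symm r)) := fun r => by
    simp [Algebra.IsPushout.equiv_tmul]
  intro r s hrs
  rw [h2, h2] at hrs
  exact (TensorProduct.rid R R').symm.injective
    (h1 ((Algebra.IsPushout.equiv R R' B B').injective hrs))

/-- The action of a group on the second factor of a tensor product of algebras. -/
@[reducible] noncomputable def tensorAction (G R' : Type*) {R B : Type*} [Group G] [CommRing R]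
    [CommRing B] [CommRing R'] [Algebra R B] [Algebra R R'] [MulSemiringAction G B]
    [SMulCommClass G R B] : MulSemiringAction G (R' ⊗[R] B) where
  smul g x := Algebra.TensorProduct.map (AlgHom.id R R') (MulSemiringAction.toAlgHom R B g) x
  one_smul x := by
    change Algebra.TensorProduct.map (AlgHom.id R R') (MulSemiringAction.toAlgHom R B 1) x = x
    have : MulSemiringAction.toAlgHom R B (1 : G) = AlgHom.id R B := by ext; simp
    rw [this, Algebra.TensorProduct.map_id, AlgHom.id_apply]
  mul_smul g h x := by
    change Algebra.TensorProduct.map (AlgHom.id R R') (MulSemiringAction.toAlgHom R B (g * h)) x =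
      Algebra.TensorProduct.map (AlgHom.id R R') (MulSemiringAction.toAlgHom R B g)
        (Algebra.TensorProduct.map (AlgHom.id R R') (MulSemiringAction.toAlgHom R B h) x)
    have : MulSemiringAction.toAlgHom R B (g * h) =
        (MulSemiringAction.toAlgHom R B g).comp (MulSemiringAction.toAlgHom R B h) := by
      ext; simp [mul_smul]
    rw [this, ← AlgHom.comp_apply, ← Algebra.TensorProduct.map_comp, AlgHom.id_comp]
  smul_zero _ := map_zero _
  smul_add _ := map_add _
  smul_one _ := map_one _
  smul_mul _ := map_mul _

end FlatBaseChange

/-- The `k`-algebra `B`, with its algebra maps `ι i : A → B`, is the tensor product over `k` of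
copies of `A` indexed by `Fin d`, that is, their coproduct among commutative `k`-algebras. -/
structure IsTensorPower (k : Type u) {A B : Type u} [CommRing k] [CommRing A] [CommRing B]
    [Algebra k A] [Algebra k B] {d : ℕ} (ι : Fin d → A →ₐ[k] B) : Prop where
  hom_ext : ∀ {C : Type u} [CommRing C] [Algebra k C] (f g : B →ₐ[k] C),
    (∀ i, f.comp (ι i) = g.comp (ι i)) → f = g
  exists_lift : ∀ {C : Type u} [CommRing C] [Algebra k C] (φ : Fin d → A →ₐ[k] C),
    ∃ f : B →ₐ[k] C, ∀ i, f.comp (ι i) = φ i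

lemma isTensorPower_piTensorProduct (k A : Type u) [CommRing k] [CommRing A] [Algebra k A]
    (d : ℕ) : IsTensorPower k fun i : Fin d =>
      PiTensorProduct.singleAlgHom (R := k) (A := fun _ : Fin d => A) i where
  hom_ext f g h := PiTensorProduct.algHom_ext h
  exists_lift {C} _ _ φ := by
    let m : MultilinearMap k (fun _ : Fin d => A) C :=
      (MultilinearMap.mkPiAlgebra k (Fin d) C).compLinearMap fun i => (φ i).toLinearMap
    have hm : ∀ x, m x = ∏ i, φ i (x i) := fun x => by simp [m]
    refine ⟨PiTensorProduct.liftAlgHom m (by simp [hm]) fun x y => by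
      simp [hm, Finset.prod_mul_distrib], fun i => ?_⟩
    ext a
    simp only [AlgHom.comp_apply, PiTensorProduct.singleAlgHom_apply,
      PiTensorProduct.liftAlgHom_apply, PiTensorProduct.lift.tprod, hm]
    rw [Finset.prod_eq_single i] <;> simp +contextual [Pi.mulSingle_eq_of_ne]

namespace IsTensorPower

variable {k A B : Type u} [CommRing k] [CommRing A] [CommRing B] [Algebra k A] [Algebra k B]
  {d : ℕ} {ι : Fin d → A →ₐ[k] B}

lemma baseChange (h : IsTensorPower k ι) (K : Type u) [CommRing K] [Algebra k K] :
    IsTensorPower K fun i => Algebra.TensorProduct.map (AlgHom.id K K) (ι i) where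
  hom_ext {C} _ _ f g hfg := by
    let : Algebra k C := Algebra.compHom C (algebraMap k K)
    have : IsScalarTower k K C := .of_algebraMap_eq' rfl
    apply Algebra.TensorProduct.ext
    · ext
    · refine h.hom_ext _ _ fun i => ?_
      ext a
      simpa using DFunLike.congr_fun (hfg i) (1 ⊗ₜ a)
  exists_lift {C} _ _ φ := by
    let : Algebra k C := Algebra.compHom C (algebraMap k K)
    have : IsScalarTower k K C := .of_algebraMap_eq' rfl
    obtain ⟨f, hf⟩ := h.exists_lift fun i =>
      ((φ i).restrictScalars k).comp Algebra.TensorProduct.includeRight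
    refine ⟨Algebra.TensorProduct.lift (Algebra.ofId K C) f fun _ _ => .all _ _, fun i => ?_⟩
    apply Algebra.TensorProduct.ext
    · ext
    · ext a
      simpa using DFunLike.congr_fun (hf i) a

/-- The tensor power of a finitely generated algebra is generated by the images of finitely many
generators. -/
lemma finiteType (h : IsTensorPower k ι) [Algebra.FiniteType k A] : Algebra.FiniteType k B := by
  obtain ⟨s, hs⟩ := Algebra.FiniteType.out (R := k) (A := A)
  let T : Set B := ⋃ i, ι i '' s
  have hT : T.Finite := Set.finite_iUnion fun i => s.finite_toSet.image _
  have hι : ∀ i a, ι i a ∈ Algebra.adjoin k T := by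
    intro i a
    have : (⊤ : Subalgebra k A).map (ι i) ≤ Algebra.adjoin k T := by
      rw [← hs, AlgHom.map_adjoin]
      exact Algebra.adjoin_mono (Set.subset_iUnion (fun i => ι i '' s) i)
    exact this ⟨a, trivial, rfl⟩
  obtain ⟨f, hf⟩ := h.exists_lift fun i => (ι i).codRestrict (Algebra.adjoin k T) (hι i)
  have : (Algebra.adjoin k T).val.comp f = AlgHom.id k B := h.hom_ext _ _ fun i => by
    ext a
    have := DFunLike.congr_fun (hf i) a
    simpa using congrArg Subtype.val this
  refine ⟨⟨hT.toFinset, ?_⟩⟩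
  rw [Set.Finite.coe_toFinset, eq_top_iff]
  intro b _
  have hb := DFunLike.congr_fun this b
  simp only [AlgHom.comp_apply, AlgHom.id_apply] at hb
  rw [← hb]
  exact (f b).2

end IsTensorPower

end SymPow

/-! ### Étale coordinates on tensor powers -/

namespace SymPow

open scoped TensorProduct Polynomial

/-- Two homomorphisms from an unramified algebra to a local ring coincide as soon as they agree
modulo the maximal ideal: the image of the separability element annihilates their difference and
is a unit. -/
lemma algHom_ext_of_local {S A D : Type*} [CommRing S] [CommRing A] [CommRing D] [Algebra S A]
    [Algebra S D] [Algebra.FormallyUnramified S A] [Algebra.EssFiniteType S A] [IsLocalRing D]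
    (u v : A →ₐ[S] D) (h : ∀ a, u a - v a ∈ IsLocalRing.maximalIdeal D) : u = v := by
  obtain ⟨τ, hτ, hτ1⟩ := (Algebra.FormallyUnramified.iff_exists_tensorProduct (R := S)
    (S := A)).mp inferInstance
  let w : A ⊗[S] A →ₐ[S] D := Algebra.TensorProduct.lift u v fun _ _ => .all _ _
  have hw : ∀ x : A ⊗[S] A, w x - u (Algebra.TensorProduct.lmul' S x) ∈
      IsLocalRing.maximalIdeal D := by
    intro x
    induction x with
    | zero => simp
    | add x y hx hy =>
      rw [map_add, map_add, map_add, add_sub_add_comm]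
      exact add_mem hx hy
    | tmul a b =>
      have : w (a ⊗ₜ b) - u (Algebra.TensorProduct.lmul' S (a ⊗ₜ[S] b)) = -(u a * (u b - v b)) := by
        simp only [w, Algebra.TensorProduct.lift_tmul, Algebra.TensorProduct.lmul'_apply_tmul,
          map_mul]
        ring
      rw [this]
      exact neg_mem (Ideal.mul_mem_left _ _ (h b))
  have hunit : IsUnit (w τ) := by
    by_contra hn
    have h1 := (IsLocalRing.mem_maximalIdeal _).mpr hn
    have h2 := sub_mem h1 (hw τ)
    rw [sub_sub_cancel, hτ1, map_one] at h2
    exact (IsLocalRing.maximalIdeal.isMaximal D).ne_top ((Ideal.eq_top_iff_one _).mpr h2)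
  ext a
  have := congrArg w (hτ a)
  rw [map_mul, map_zero, hunit.mul_left_eq_zero, map_sub, sub_eq_zero] at this
  simpa [w] using this.symm

section Etale

variable {k A : Type u} [CommRing k] [CommRing A] [Algebra k A] (t h : A)

/-- The element `t` of the `k`-algebra `A` is an étale coordinate where `h` is invertible:
the localisation `A_h` is étale over the polynomial ring `k[t]`. -/
def IsEtaleCoordinate (k : Type u) {A : Type u} [CommRing k] [CommRing A] [Algebra k A]
    (t h : A) : Prop :=
  letI : Algebra k[X] A := (Polynomial.aeval (R := k) t).toRingHom.toAlgebra
  Algebra.Etale k[X] (Localization.Away h)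

variable {t h}

/-- Infinitesimal lifting for an étale coordinate: a homomorphism lifts uniquely along a
square-zero extension once a lift of the coordinate is chosen. -/
lemma IsEtaleCoordinate.existsUnique_lift (ht : IsEtaleCoordinate k t h) {C : Type u} [CommRing C]
    [Algebra k C] {I : Ideal C} (hI : I ^ 2 = ⊥) (c : C) (g : A →ₐ[k] C ⧸ I)
    (hg : g t = Ideal.Quotient.mk I c) (hh : IsUnit (g h)) :
    ∃! v : A →ₐ[k] C, v t = c ∧ (Ideal.Quotient.mkₐ k I).comp v = g := by
  let : Algebra k[X] A := (Polynomial.aeval (R := k) t).toRingHom.toAlgebra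
  have : Algebra.Etale k[X] (Localization.Away h) := ht
  let : Algebra k[X] C := (Polynomial.aeval (R := k) c).toRingHom.toAlgebra
  have hA : ∀ p : k[X], algebraMap k[X] A p = Polynomial.aeval t p := fun p => rfl
  have hC : ∀ p : k[X], algebraMap k[X] C p = Polynomial.aeval c p := fun p => rfl
  have hCI : ∀ p : k[X], algebraMap k[X] (C ⧸ I) p =
      Polynomial.aeval (Ideal.Quotient.mk I c) p := fun p =>
    (Polynomial.aeval_algHom_apply (Ideal.Quotient.mkₐ k I) c p).symm
  have : IsScalarTower k k[X] A := .of_algebraMap_eq fun a => by simp [hA]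
  have : IsScalarTower k k[X] C := .of_algebraMap_eq fun a => by simp [hC]
  have bij := Algebra.FormallyEtale.comp_bijective k[X] (Localization.Away h) I hI
  have units : ∀ v : A →ₐ[k] C, (Ideal.Quotient.mkₐ k I).comp v = g → IsUnit (v h) := by
    intro v hv
    rw [← hv] at hh
    exact (IsNilpotent.isUnit_quotient_mk_iff ⟨2, hI⟩).mp hh
  have pow_units : ∀ {D : Type u} [CommRing D] (f : A →+* D), IsUnit (f h) →
      ∀ y : Submonoid.powers h, IsUnit (f y) := by
    rintro D _ f hf ⟨_, n, rfl⟩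
    rw [map_pow]
    exact hf.pow n
  -- Homomorphisms `A → C` with `t ↦ c` are `k[X]`-algebra homomorphisms.
  let lin : ∀ v : A →ₐ[k] C, v t = c → A →ₐ[k[X]] C := fun v hv =>
    { v.toRingHom with
      commutes' := fun p => by
        change v (algebraMap k[X] A p) = _
        rw [hA, hC, ← Polynomial.aeval_algHom_apply, hv] }
  let g' : A →ₐ[k[X]] C ⧸ I :=
    { g.toRingHom with
      commutes' := fun p => by
        change g (algebraMap k[X] A p) = _
        rw [hA, hCI, ← Polynomial.aeval_algHom_apply, hg] }
  obtain ⟨w, hw⟩ := bij.2 (IsLocalization.liftAlgHom (M := .powers h)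
    (S := Localization.Away h) (f := g') (pow_units g.toRingHom hh))
  have hwg : ∀ a, Ideal.Quotient.mk I (w (algebraMap A _ a)) = g a := fun a =>
    (DFunLike.congr_fun hw (algebraMap A _ a)).trans (by
      simp only [IsLocalization.liftAlgHom_apply]
      exact IsLocalization.lift_eq _ a)
  refine ⟨(w.restrictScalars k).comp (IsScalarTower.toAlgHom k A _), ⟨?_, ?_⟩, ?_⟩
  · change w (algebraMap A _ t) = c
    have h1 : t = algebraMap k[X] A Polynomial.X := by simp [hA]
    rw [h1, ← IsScalarTower.algebraMap_apply, w.commutes, hC, Polynomial.aeval_X]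
  · ext a
    exact hwg a
  · rintro v ⟨hv, hvg⟩
    have : IsLocalization.liftAlgHom (M := .powers h) (S := Localization.Away h)
        (f := lin v hv) (pow_units v.toRingHom (units v hvg)) = w := by
      apply bij.1
      change (Ideal.Quotient.mkₐ k[X] I).comp _ = (Ideal.Quotient.mkₐ k[X] I).comp w
      rw [hw]
      apply IsLocalization.algHom_ext (Submonoid.powers h)
      refine AlgHom.ext fun a => ?_
      simp only [AlgHom.comp_apply, IsLocalization.liftAlgHom_apply]
      have h1 := IsLocalization.lift_eq (S := Localization.Away h)
        (pow_units v.toRingHom (units v hvg)) a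
      have h2 := IsLocalization.lift_eq (S := Localization.Away h) (pow_units g.toRingHom hh) a
      exact (congrArg (Ideal.Quotient.mk I) h1).trans ((DFunLike.congr_fun hvg a).trans h2.symm)
    ext a
    change v a = w (algebraMap A _ a)
    rw [← this, IsLocalization.liftAlgHom_apply, IsLocalization.lift_eq]
    rfl

variable {B B' : Type u} [CommRing B] [Algebra k B] [CommRing B'] [Algebra k B'] [Algebra B B']
  [IsScalarTower k B B'] {d : ℕ} {ι : Fin d → A →ₐ[k] B}

open MvPolynomial in
/-- Étale coordinates on the factors are étale coordinates on a tensor power, on the locus where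
each of them is étale. -/
lemma IsTensorPower.formallyEtale (hι : IsTensorPower k ι) (ht : IsEtaleCoordinate k t h)
    (M : Submonoid B) [IsLocalization M B'] (hM : ∀ i, IsUnit (algebraMap B B' (ι i h)))
    [Algebra (MvPolynomial (Fin d) k) B'] [IsScalarTower k (MvPolynomial (Fin d) k) B']
    (hX : ∀ i, algebraMap (MvPolynomial (Fin d) k) B' (X i) = algebraMap B B' (ι i t)) :
    Algebra.FormallyEtale (MvPolynomial (Fin d) k) B' := by
  rw [Algebra.FormallyEtale.iff_comp_bijective]
  intro C _ _ I hI
  let : Algebra k C := Algebra.compHom C (algebraMap k (MvPolynomial (Fin d) k))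
  have : IsScalarTower k (MvPolynomial (Fin d) k) C := .of_algebraMap_eq' rfl
  -- Homomorphisms out of `B'` are determined by the family of their restrictions to the factors.
  have ext' : ∀ {D : Type u} [CommRing D] [Algebra k D] (f g : B' →ₐ[k] D),
      (∀ i a, f (algebraMap B B' (ι i a)) = g (algebraMap B B' (ι i a))) → f = g := by
    intro D _ _ f g hfg
    refine AlgHom.ext fun x => ?_
    refine RingHom.congr_fun (f := f.toRingHom) (g := g.toRingHom) ?_ x
    refine IsLocalization.ringHom_ext M ?_
    have := hι.hom_ext (f.comp (IsScalarTower.toAlgHom k B B'))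
      (g.comp (IsScalarTower.toAlgHom k B B')) fun i => AlgHom.ext fun a => hfg i a
    exact congrArg AlgHom.toRingHom this
  have key : ∀ (f : B' →ₐ[MvPolynomial (Fin d) k] C ⧸ I) (i : Fin d),
      ∃! v : A →ₐ[k] C, v t = algebraMap (MvPolynomial (Fin d) k) C (X i) ∧
        (Ideal.Quotient.mkₐ k I).comp v =
          (f.restrictScalars k).comp ((IsScalarTower.toAlgHom k B B').comp (ι i)) := by
    intro f i
    refine ht.existsUnique_lift hI _ _ ?_ ((hM i).map f)
    change f (algebraMap B B' (ι i t)) = _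
    rw [← hX, f.commutes]
    rfl
  constructor
  · intro f g hfg
    have hfg' : ∀ x, Ideal.Quotient.mk I (f x) = Ideal.Quotient.mk I (g x) :=
      fun x => DFunLike.congr_fun hfg x
    have : f.restrictScalars k = g.restrictScalars k := ext' _ _ fun i a => by
      have hu := (key ((Ideal.Quotient.mkₐ _ I).comp f) i).unique
        (y₁ := (f.restrictScalars k).comp ((IsScalarTower.toAlgHom k B B').comp (ι i)))
        (y₂ := (g.restrictScalars k).comp ((IsScalarTower.toAlgHom k B B').comp (ι i)))
        ⟨by change f (algebraMap B B' (ι i t)) = _; rw [← hX, f.commutes], rfl⟩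
        ⟨by change g (algebraMap B B' (ι i t)) = _; rw [← hX, g.commutes],
          AlgHom.ext fun a => (hfg' _).symm⟩
      exact DFunLike.congr_fun hu a
    exact AlgHom.ext fun x => DFunLike.congr_fun this x
  · intro f
    choose v hv using fun i => (key f i).exists
    obtain ⟨w, hw⟩ := hι.exists_lift v
    have hwf : ∀ b, Ideal.Quotient.mk I (w b) = f (algebraMap B B' b) := by
      have : (Ideal.Quotient.mkₐ k I).comp w =
          (f.restrictScalars k).comp (IsScalarTower.toAlgHom k B B') :=
        hι.hom_ext _ _ fun i => by rw [AlgHom.comp_assoc, hw, (hv i).2, AlgHom.comp_assoc]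
      exact DFunLike.congr_fun this
    have hwM : ∀ y : M, IsUnit (w y) := fun y => by
      rw [← IsNilpotent.isUnit_quotient_mk_iff (I := I) ⟨2, hI⟩, hwf]
      exact (IsLocalization.map_units B' y).map f
    let w' : B' →ₐ[k] C := IsLocalization.liftAlgHom (M := M) (f := w) hwM
    have hw' : ∀ b, w' (algebraMap B B' b) = w b := fun b => by
      rw [IsLocalization.liftAlgHom_apply, IsLocalization.lift_eq]; rfl
    have hP : w'.comp (IsScalarTower.toAlgHom k (MvPolynomial (Fin d) k) B') =
        IsScalarTower.toAlgHom k (MvPolynomial (Fin d) k) C := by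
      ext i
      simp only [AlgHom.comp_apply, IsScalarTower.coe_toAlgHom', hX, hw', ← (hv i).1, ← hw i]
    refine ⟨{ w'.toRingHom with commutes' := fun p => DFunLike.congr_fun hP p }, ?_⟩
    refine AlgHom.ext fun x => ?_
    have : (Ideal.Quotient.mkₐ k I).comp w' = f.restrictScalars k := ext' _ _ fun i a => by
      change Ideal.Quotient.mk I (w' _) = f _
      rw [hw', hwf]
    exact DFunLike.congr_fun this x

end Etale

end SymPow

/-! ### Transpositions near a point with separated components -/

namespace SymPow

open scoped TensorProduct Polynomial Pointwise

/-- Homomorphisms to a local ring which agree at an étale coordinate and modulo the maximal ideal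
are equal. -/
lemma IsEtaleCoordinate.eq_of_local {k A : Type u} [CommRing k] [CommRing A] [Algebra k A]
    {t h : A} (ht : IsEtaleCoordinate k t h) {D : Type u} [CommRing D] [Algebra k D]
    [IsLocalRing D] (u v : A →ₐ[k] D) (huv : u t = v t) (hu : IsUnit (u h))
    (hm : ∀ a, u a - v a ∈ IsLocalRing.maximalIdeal D) : u = v := by
  let : Algebra k[X] A := (Polynomial.aeval (R := k) t).toRingHom.toAlgebra
  have : Algebra.Etale k[X] (Localization.Away h) := ht
  let : Algebra k[X] D := (Polynomial.aeval (R := k) (u t)).toRingHom.toAlgebra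
  have hA : ∀ p : k[X], algebraMap k[X] A p = Polynomial.aeval t p := fun p => rfl
  have hD : ∀ p : k[X], algebraMap k[X] D p = Polynomial.aeval (u t) p := fun p => rfl
  let u' : A →ₐ[k[X]] D :=
    { u.toRingHom with
      commutes' := fun p => by
        change u (algebraMap k[X] A p) = _
        rw [hA, hD, ← Polynomial.aeval_algHom_apply] }
  let v' : A →ₐ[k[X]] D :=
    { v.toRingHom with
      commutes' := fun p => by
        change v (algebraMap k[X] A p) = _
        rw [hA, hD, huv, ← Polynomial.aeval_algHom_apply] }
  have hv : IsUnit (v h) := by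
    by_contra hn
    have h1 := (IsLocalRing.mem_maximalIdeal _).mpr hn
    have h2 := add_mem (hm h) h1
    rw [sub_add_cancel] at h2
    exact (IsLocalRing.mem_maximalIdeal _).mp h2 hu
  have pow_units : ∀ (f : A →+* D), IsUnit (f h) → ∀ y : Submonoid.powers h, IsUnit (f y) := by
    rintro f hf ⟨_, n, rfl⟩
    rw [map_pow]
    exact hf.pow n
  let U : Localization.Away h →ₐ[k[X]] D :=
    IsLocalization.liftAlgHom (M := .powers h) (f := u') (pow_units u.toRingHom hu)
  let V : Localization.Away h →ₐ[k[X]] D :=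
    IsLocalization.liftAlgHom (M := .powers h) (f := v') (pow_units v.toRingHom hv)
  have hU : ∀ a, U (algebraMap A _ a) = u a := fun a =>
    IsLocalization.lift_eq (pow_units u.toRingHom hu) a
  have hV : ∀ a, V (algebraMap A _ a) = v a := fun a =>
    IsLocalization.lift_eq (pow_units v.toRingHom hv) a
  have hUV : U = V := by
    refine algHom_ext_of_local U V fun a => ?_
    rw [← Ideal.Quotient.eq]
    refine RingHom.congr_fun (f := (Ideal.Quotient.mk _).comp U.toRingHom)
      (g := (Ideal.Quotient.mk _).comp V.toRingHom) ?_ a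
    refine IsLocalization.ringHom_ext (Submonoid.powers h) (RingHom.ext fun a => ?_)
    change Ideal.Quotient.mk _ (U (algebraMap A _ a)) = Ideal.Quotient.mk _ (V (algebraMap A _ a))
    rw [hU, hV]
    exact Ideal.Quotient.eq.mpr (hm a)
  ext a
  rw [← hU, hUV, hV]

open MvPolynomial in
lemma IsTensorPower.flat_localization {k A B : Type u} [Field k] [CommRing A] [CommRing B]
    [Algebra k A] [Algebra k B] {d : ℕ} {ι : Fin d → A →ₐ[k] B} {t h : A}
    (hB : IsTensorPower k ι) (ht : IsEtaleCoordinate k t h)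
    [Algebra.FiniteType k A] {Q : Ideal B} [Q.IsPrime] (hQ : ∀ i, ι i h ∉ Q)
    [Algebra (MvPolynomial (Fin d) k) B] [IsScalarTower k (MvPolynomial (Fin d) k) B]
    (hX : ∀ i, algebraMap (MvPolynomial (Fin d) k) B (X i) = ι i t) :
    Module.Flat (MvPolynomial (Fin d) k) (Localization.AtPrime Q) := by
  have := hB.finiteType
  have : Algebra.FiniteType (MvPolynomial (Fin d) k) B := .of_restrictScalars_finiteType k _ _
  have : Algebra.FinitePresentation (MvPolynomial (Fin d) k) B :=
    Algebra.FinitePresentation.of_finiteType.mp inferInstance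
  let H := ∏ i, ι i h
  have hH : H ∉ Q := fun hn => by
    obtain ⟨i, -, hi⟩ := (Ideal.IsPrime.prod_mem_iff (p := Q)).mp hn
    exact hQ i hi
  have : Algebra.FinitePresentation B (Localization.Away H) :=
    IsLocalization.Away.finitePresentation H
  have : Algebra.FinitePresentation (MvPolynomial (Fin d) k) (Localization.Away H) := .trans _ B _
  have : Algebra.FormallyEtale (MvPolynomial (Fin d) k) (Localization.Away H) := by
    refine hB.formallyEtale ht (.powers H) (fun i => ?_) fun i => by
      rw [IsScalarTower.algebraMap_apply _ B, hX]
    refine isUnit_of_dvd_unit ?_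
      (IsLocalization.Away.algebraMap_isUnit (S := Localization.Away H) H)
    exact map_dvd _ (Finset.dvd_prod_of_mem _ (Finset.mem_univ i))
  have : Algebra.Etale (MvPolynomial (Fin d) k) (Localization.Away H) := ⟨‹_›, ‹_›⟩
  have hle : Submonoid.powers H ≤ Q.primeCompl := Submonoid.powers_le.mpr hH
  let : Algebra (Localization.Away H) (Localization.AtPrime Q) :=
    IsLocalization.localizationAlgebraOfSubmonoidLe _ _ (Submonoid.powers H) Q.primeCompl hle
  have := IsLocalization.localization_isScalarTower_of_submonoid_le (Localization.Away H)
    (Localization.AtPrime Q) (Submonoid.powers H) Q.primeCompl hle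
  have := IsLocalization.isLocalization_of_submonoid_le (Localization.Away H)
    (Localization.AtPrime Q) (Submonoid.powers H) Q.primeCompl hle
  have : Module.Flat (Localization.Away H) (Localization.AtPrime Q) :=
    IsLocalization.flat _ (Q.primeCompl.map (algebraMap B (Localization.Away H)))
  have : IsScalarTower (MvPolynomial (Fin d) k) (Localization.Away H) (Localization.AtPrime Q) :=
    .of_algebraMap_eq fun p => by
      rw [IsScalarTower.algebraMap_apply _ B (Localization.AtPrime Q),
        IsScalarTower.algebraMap_apply _ B (Localization.Away H),
        ← IsScalarTower.algebraMap_apply B]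
  have : Module.Flat (MvPolynomial (Fin d) k) (Localization.Away H) := inferInstance
  exact Module.Flat.trans _ (Localization.Away H) _

section LocalStep

variable {k A B R : Type u} [Field k] [CommRing A] [CommRing B] [CommRing R] [Algebra k A]
  [Algebra k B] [Algebra k R] [Algebra R B] [IsScalarTower k R B] {d : ℕ}
  {ι : Fin d → A →ₐ[k] B} [MulSemiringAction (Equiv.Perm (Fin d)) B]
  [SMulCommClass (Equiv.Perm (Fin d)) R B] {t h : A}

/-- The coordinate `t` separates the components of the point `M` of the tensor power `B`, and `h`
does not vanish at any of them. -/
structure Separates (ι : Fin d → A →ₐ[k] B) (t h : A) (M : Ideal B) : Prop where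
  sub_mem_of_sub_mem : ∀ i j, ι i t - ι j t ∈ M → ∀ z, ι i z - ι j z ∈ M
  notMem : ∀ i, ι i h ∉ M

lemma Separates.smul {M : Ideal B} (hM : Separates ι t h M)
    (hι : ∀ (σ : Equiv.Perm (Fin d)) i a, σ • ι i a = ι (σ i) a) (σ : Equiv.Perm (Fin d)) :
    Separates ι t h (σ • M) where
  sub_mem_of_sub_mem i j hij z := by
    rw [Ideal.mem_pointwise_smul_iff_inv_smul_mem, smul_sub, hι, hι] at hij ⊢
    exact hM.sub_mem_of_sub_mem _ _ hij z
  notMem i := by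
    rw [Ideal.mem_pointwise_smul_iff_inv_smul_mem, hι]
    exact hM.notMem _

lemma smul_algebraMap_base (R : Type u) [CommRing R] [Algebra k R] [Algebra R B]
    [IsScalarTower k R B] [SMulCommClass (Equiv.Perm (Fin d)) R B] (σ : Equiv.Perm (Fin d))
    (a : k) : σ • algebraMap k B a = algebraMap k B a := by
  rw [IsScalarTower.algebraMap_apply k R B, smul_algebraMap]

/-- Near a point whose components are separated by an étale coordinate `t`, the transposition of
two factors is trivial modulo the difference of the two copies of `t`. -/
lemma Separates.sub_swap_smul_mem (hB : IsTensorPower k ι) (ht : IsEtaleCoordinate k t h)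
    (hk : ∀ (σ : Equiv.Perm (Fin d)) (a : k), σ • algebraMap k B a = algebraMap k B a)
    (hι : ∀ (σ : Equiv.Perm (Fin d)) i a, σ • ι i a = ι (σ i) a)
    {M : Ideal B} [M.IsPrime] (hM : Separates ι t h M) (i j : Fin d) (c : B) :
    c - Equiv.swap i j • c ∈ (Ideal.span {algebraMap B (Localization.AtPrime M)
      (ι j t - ι i t)}).comap (algebraMap B (Localization.AtPrime M)) := by
  by_cases hmem : ι j t - ι i t ∈ M
  swap
  · have : IsUnit (algebraMap B (Localization.AtPrime M) (ι j t - ι i t)) :=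
      IsLocalization.map_units (M := M.primeCompl) _ ⟨_, hmem⟩
    rw [Ideal.span_singleton_eq_top.mpr this]
    trivial
  let I := Ideal.span {algebraMap B (Localization.AtPrime M) (ι j t - ι i t)}
  have hI : I ≤ IsLocalRing.maximalIdeal _ := by
    rw [Ideal.span_le, Set.singleton_subset_iff]
    exact (IsLocalization.AtPrime.to_map_mem_maximal_iff _ M _).mpr hmem
  have : Nontrivial (Localization.AtPrime M ⧸ I) := Ideal.Quotient.nontrivial_iff.mpr
    fun h => (IsLocalRing.maximalIdeal.isMaximal (Localization.AtPrime M)).ne_top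
      (top_le_iff.mp (h ▸ hI))
  have : IsLocalRing (Localization.AtPrime M ⧸ I) :=
    .of_surjective' (Ideal.Quotient.mk I) Ideal.Quotient.mk_surjective
  let φ : B →ₐ[k] Localization.AtPrime M ⧸ I :=
    (Ideal.Quotient.mkₐ k I).comp (IsScalarTower.toAlgHom k B _)
  have hφM : ∀ b ∈ M, φ b ∈ IsLocalRing.maximalIdeal _ := by
    intro b hb
    have h1 : algebraMap B (Localization.AtPrime M) b ∈ IsLocalRing.maximalIdeal _ :=
      (IsLocalization.AtPrime.to_map_mem_maximal_iff _ M _).mpr hb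
    rw [IsLocalRing.mem_maximalIdeal, mem_nonunits_iff]
    intro hu
    obtain ⟨y, hy⟩ := hu.exists_right_inv
    obtain ⟨y, rfl⟩ := Ideal.Quotient.mk_surjective y
    have h2 : algebraMap B (Localization.AtPrime M) b * y - 1 ∈
        IsLocalRing.maximalIdeal (Localization.AtPrime M) :=
      hI (Ideal.Quotient.eq.mp ((map_mul (Ideal.Quotient.mk I) _ y).trans hy))
    have h3 := sub_mem (Ideal.mul_mem_right y _ h1) h2
    rw [sub_sub_cancel] at h3
    exact (IsLocalRing.maximalIdeal.isMaximal (Localization.AtPrime M)).ne_top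
      ((Ideal.eq_top_iff_one _).mpr h3)
  have hij : φ.comp (ι i) = φ.comp (ι j) := by
    refine ht.eq_of_local _ _ ?_ ?_ fun a => ?_
    · refine (Ideal.Quotient.eq.mpr ?_).symm
      change algebraMap B _ (ι j t) - algebraMap B _ (ι i t) ∈ I
      rw [← map_sub]
      exact Ideal.mem_span_singleton_self _
    · exact (IsLocalization.map_units (M := M.primeCompl) (Localization.AtPrime M)
        ⟨_, hM.notMem i⟩).map (Ideal.Quotient.mk I)
    · change φ _ - φ _ ∈ _
      rw [← map_sub]
      refine hφM _ (hM.sub_mem_of_sub_mem _ _ ?_ a)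
      rw [← neg_sub]
      exact neg_mem hmem
  let τ : B →ₐ[k] B :=
    { MulSemiringAction.toRingHom (Equiv.Perm (Fin d)) B (Equiv.swap i j) with
      commutes' := hk _ }
  have key : φ = φ.comp τ := by
    refine hB.hom_ext _ _ fun l => AlgHom.ext fun a => ?_
    change φ (ι l a) = φ (Equiv.swap i j • ι l a)
    rw [hι]
    rcases eq_or_ne l i with rfl | hli
    · rw [Equiv.swap_apply_left]
      exact DFunLike.congr_fun hij a
    rcases eq_or_ne l j with rfl | hlj
    · rw [Equiv.swap_apply_right]
      exact (DFunLike.congr_fun hij a).symm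
    · rw [Equiv.swap_apply_of_ne_of_ne hli hlj]
  have := DFunLike.congr_fun key c
  rw [Ideal.mem_comap, map_sub (algebraMap B _) c]
  exact Ideal.Quotient.eq.mp this

end LocalStep

end SymPow

/-! ### The quotient near a point with separated components -/

namespace SymPow

open scoped TensorProduct Polynomial Pointwise

section LocalStep

variable {k A B : Type u} (R : Type u) [Field k] [CommRing A] [CommRing B] [CommRing R]
  [Algebra k A] [Algebra k B] [Algebra k R] [Algebra R B] [IsScalarTower k R B] {d : ℕ}
  {ι : Fin d → A →ₐ[k] B} [MulSemiringAction (Equiv.Perm (Fin d)) B]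
  [SMulCommClass (Equiv.Perm (Fin d)) R B] [Algebra.IsInvariant R B (Equiv.Perm (Fin d))]
  {t h : A}

open MvPolynomial in
/-- Near the image in the quotient of a point whose components are separated by an étale coordinate
`t`, antisymmetrisations are divisible by the Vandermonde product of the copies of `t`. -/
lemma Separates.exists_dvd_mul_alternation [Algebra.FiniteType k A] (hB : IsTensorPower k ι)
    (ht : IsEtaleCoordinate k t h)
    (hι : ∀ (σ : Equiv.Perm (Fin d)) i a, σ • ι i a = ι (σ i) a)
    {M : Ideal B} [M.IsPrime] (hM : Separates ι t h M) (c : B) :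
    ∃ f : R, f ∉ M.under R ∧
      vandermondeDet (fun i => ι i t) ∣ algebraMap R B f * alternation d c := by
  have hk := smul_algebraMap_base (k := k) (B := B) (d := d) R
  let P := MvPolynomial (Fin d) k
  let : Algebra P B := (aeval (R := k) fun i => ι i t).toRingHom.toAlgebra
  have hPB : ∀ p : P, algebraMap P B p = aeval (fun i => ι i t) p := fun p => rfl
  have : IsScalarTower k P B := .of_algebraMap_eq fun a => by simp [hPB, P]
  have hX : ∀ i, algebraMap P B (X i) = ι i t := fun i => by simp [hPB]
  -- `a` is the ideal of denominators. If no invariant outside of `M` lay in it, it would be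
  -- contained in a prime over `M ∩ R`, that is, in a translate `σ • M`; but at the translates,
  -- divisibility holds because their components are separated by `t` as well.
  let a : Ideal B :=
    { carrier := {b | vandermondeDet (fun i => ι i t) ∣ b * alternation d c}
      add_mem' := fun {x y} hx hy => by
        rw [Set.mem_ofPred_eq, add_mul]; exact dvd_add hx hy
      zero_mem' := by simp
      smul_mem' := fun r x hx => by
        rw [Set.mem_ofPred_eq, smul_eq_mul, mul_assoc]; exact dvd_mul_of_dvd_right hx r }
  suffices ¬ a.comap (algebraMap R B) ≤ M.under R by
    obtain ⟨f, hf, hfM⟩ := Set.not_subset.mp this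
    exact ⟨f, hfM, hf⟩
  intro hle
  have := Algebra.IsInvariant.isIntegral R B (Equiv.Perm (Fin d))
  obtain ⟨Q, haQ, hQ, hQM⟩ := Ideal.exists_ideal_over_prime_of_isIntegral (M.under R) a hle
  obtain ⟨σ, rfl⟩ := Algebra.IsInvariant.exists_smul_of_under_eq R B (Equiv.Perm (Fin d)) M Q
    hQM.symm
  have hQs := hM.smul hι σ
  have := hB.flat_localization ht hQs.notMem hX
  have hdvd : vandermondeDet (fun i => algebraMap P (Localization.AtPrime (σ • M)) (X i)) ∣
      algebraMap B _ (alternation d c) := by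
    refine vandermondeDet_dvd_of_flat k fun i j hij => ?_
    rw [IsScalarTower.algebraMap_apply P B, map_sub, hX, hX, ← Ideal.mem_span_singleton]
    exact alternation_mem_of_swap hij (fun c => hQs.sub_swap_smul_mem hB ht hk hι i j c) c
  have h1 : algebraMap B (Localization.AtPrime (σ • M)) (alternation d c) ∈
      (Ideal.span {vandermondeDet (fun i => ι i t)}).map
        (algebraMap B (Localization.AtPrime (σ • M))) := by
    rw [Ideal.map_span, Set.image_singleton, map_vandermondeDet, Ideal.mem_span_singleton]
    have : (fun i => algebraMap P (Localization.AtPrime (σ • M)) (X i)) =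
        fun i => algebraMap B _ (ι i t) :=
      funext fun i => by rw [IsScalarTower.algebraMap_apply P B, hX]
    rwa [this] at hdvd
  rw [IsLocalization.algebraMap_mem_map_algebraMap_iff (σ • M).primeCompl] at h1
  obtain ⟨s, hs, hs'⟩ := h1
  exact hs (haQ (Ideal.mem_span_singleton.mp hs'))

open MvPolynomial in
/-- The quotient of a tensor power by the symmetric group is smooth at the image of a point whose
components are separated by an étale coordinate. -/
lemma Separates.exists_smooth_away [Algebra.FiniteType k A] (hB : IsTensorPower k ι)
    (ht : IsEtaleCoordinate k t h) (hR : Function.Injective (algebraMap R B))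
    (hι : ∀ (σ : Equiv.Perm (Fin d)) i a, σ • ι i a = ι (σ i) a)
    {M : Ideal B} [M.IsPrime] (hM : Separates ι t h M) :
    ∃ f : R, f ∉ M.under R ∧ Algebra.Smooth k (Localization.Away f) := by
  have := hB.finiteType
  have : Algebra.FiniteType R B := .of_restrictScalars_finiteType k R B
  have := Algebra.IsInvariant.isIntegral R B (Equiv.Perm (Fin d))
  have : Module.Finite R B := Algebra.IsIntegral.finite
  obtain ⟨s, hs⟩ := Module.Finite.fg_top (R := R) (M := B)
  choose f hfM hf using fun c : B => hM.exists_dvd_mul_alternation R hB ht hι c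
  -- `f₁` is a denominator for all generators of `B` over `R`, and `f₂` is the norm of `h`.
  let f₁ : R := ∏ c ∈ s, f c
  obtain ⟨f₂, hf₂⟩ := Algebra.IsInvariant.isInvariant (A := R) (G := Equiv.Perm (Fin d))
    (∏ i, ι i h) fun σ => by
      rw [Finset.smul_prod']
      simp only [hι]
      exact Equiv.prod_comp σ fun i => ι i h
  have hprime : (M.under R).IsPrime := inferInstance
  have hf₁M : f₁ ∉ M.under R := fun hn => by
    obtain ⟨c, -, hc⟩ := hprime.prod_mem_iff.mp hn
    exact hfM c hc
  have hf₂M : f₂ ∉ M.under R := fun hn => by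
    rw [Ideal.under, Ideal.mem_comap, hf₂] at hn
    obtain ⟨i, -, hi⟩ := (Ideal.IsPrime.prod_mem_iff (p := M)).mp hn
    exact hM.notMem i hi
  have hdvd : ∀ c : B, vandermondeDet (fun i => ι i t) ∣ algebraMap R B f₁ * alternation d c := by
    intro c
    have hc : c ∈ Submodule.span R (s : Set B) := hs ▸ Submodule.mem_top
    induction hc using Submodule.span_induction with
    | mem c hc =>
      refine (hf c).trans (mul_dvd_mul_right ?_ _)
      exact map_dvd _ (Finset.dvd_prod_of_mem _ hc)
    | zero => simp [alternation]
    | add x y _ _ hx hy => rw [alternation_add, mul_add]; exact dvd_add hx hy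
    | smul r x _ hx =>
      rw [Algebra.smul_def, alternation_mul_of_invariant fun σ => smul_algebraMap σ r,
        mul_left_comm]
      exact dvd_mul_of_dvd_right hx _
  refine ⟨f₁ * f₂, fun hn => (hprime.mem_or_mem hn).elim hf₁M hf₂M, ?_⟩
  let P := MvPolynomial (Fin d) k
  let R' := Localization.Away (f₁ * f₂)
  let C := R' ⊗[R] B
  have hunit : IsUnit (algebraMap R R' (f₁ * f₂)) := IsLocalization.Away.algebraMap_isUnit _
  let : MulSemiringAction (Equiv.Perm (Fin d)) C := tensorAction (Equiv.Perm (Fin d)) R'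
  let : Algebra B C := Algebra.TensorProduct.rightAlgebra
  have hsmul : ∀ (σ : Equiv.Perm (Fin d)) (r : R') (b : B), σ • (r ⊗ₜ[R] b : C) = r ⊗ₜ (σ • b) :=
    fun σ r b => Algebra.TensorProduct.map_tmul _ _ _ _
  have hBC : ∀ b : B, algebraMap B C b = 1 ⊗ₜ b := fun b => rfl
  have hR'C : ∀ r : R', algebraMap R' C r = r ⊗ₜ 1 := fun r => rfl
  have heq : ∀ (σ : Equiv.Perm (Fin d)) (b : B), algebraMap B C (σ • b) = σ • algebraMap B C b :=
    fun σ b => by rw [hBC, hBC, hsmul]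
  have hinv : ∀ (σ : Equiv.Perm (Fin d)) (r : R'), σ • algebraMap R' C r = algebraMap R' C r :=
    fun σ r => by rw [hR'C, hsmul, smul_one]
  have : SMulCommClass (Equiv.Perm (Fin d)) R' C := ⟨fun σ r c => by
    have h1 : ∀ x : C, r • x = algebraMap R' C r * x :=
      Algebra.smul_def (A := R' ⊗[R] B) r
    rw [h1, h1, MulSemiringAction.smul_mul, hinv]⟩
  have : IsScalarTower R B C := .of_algebraMap_eq fun r => by
    rw [hBC, IsScalarTower.algebraMap_apply R R' C, hR'C,
      Algebra.algebraMap_eq_smul_one (A := R'), Algebra.algebraMap_eq_smul_one (A := B),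
      TensorProduct.smul_tmul]
  have : Algebra.IsPushout R R' B C := inferInstance
  have : Module.Flat R R' := IsLocalization.flat R' (.powers (f₁ * f₂))
  have : Algebra.IsInvariant R' C (Equiv.Perm (Fin d)) :=
    isInvariant_of_flat (Equiv.Perm (Fin d)) (R := R) (B := B) heq
  have hR' : Function.Injective (algebraMap R' C) :=
    algebraMap_injective_of_isPushout (R := R) (B := B) hR
  have : IsScalarTower k B C := .of_algebraMap_eq fun a => by
    rw [IsScalarTower.algebraMap_apply k R B, ← IsScalarTower.algebraMap_apply R B C,
      IsScalarTower.algebraMap_apply k R' C, IsScalarTower.algebraMap_apply k R R',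
      ← IsScalarTower.algebraMap_apply R R' C]
  have hloc : IsLocalization (Algebra.algebraMapSubmonoid B (.powers (f₁ * f₂))) C :=
    inferInstance
  have hloc' : IsLocalization.Away (algebraMap R B (f₁ * f₂)) C := by
    rwa [Algebra.algebraMapSubmonoid_powers] at hloc
  have hfC : ∀ r : R, r ∣ f₁ * f₂ → IsUnit (algebraMap B C (algebraMap R B r)) := fun r hr => by
    rw [← IsScalarTower.algebraMap_apply, IsScalarTower.algebraMap_apply R R' C]
    exact isUnit_of_dvd_unit (map_dvd _ (map_dvd _ hr)) (hunit.map _)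
  let : Algebra P C := (aeval (R := k) fun i => algebraMap B C (ι i t)).toRingHom.toAlgebra
  have hPC : ∀ p : P, algebraMap P C p = aeval (fun i => algebraMap B C (ι i t)) p := fun p => rfl
  have : IsScalarTower k P C := .of_algebraMap_eq fun a => by simp [hPC, P]
  have hX : ∀ i, algebraMap P C (X i) = algebraMap B C (ι i t) := fun i => by simp [hPC]
  have : Algebra.FormallyEtale P C := by
    refine hB.formallyEtale ht (Algebra.algebraMapSubmonoid B (.powers (f₁ * f₂))) (fun i => ?_) hX
    refine isUnit_of_dvd_unit ?_ (hfC f₂ (dvd_mul_left _ _))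
    rw [hf₂]
    exact map_dvd _ (Finset.dvd_prod_of_mem (fun i => ι i h) (Finset.mem_univ i))
  have : Algebra.FinitePresentation B C :=
    IsLocalization.Away.finitePresentation (algebraMap R B (f₁ * f₂))
  have : Algebra.FiniteType k C := .trans (S := B) inferInstance inferInstance
  have : Algebra.FiniteType P C := .of_restrictScalars_finiteType k P C
  have : Algebra.FinitePresentation P C := Algebra.FinitePresentation.of_finiteType.mp inferInstance
  have : Algebra.Etale P C := ⟨‹_›, ‹_›⟩
  refine smooth_invariants_of_etale (C := C) (d := d) hR' ⟨fun σ i => ?_,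
    vandermondeDet_mem_nonZeroDivisors k C, fun c => ?_⟩
  · rw [hX, hX, ← heq, hι]
  · rw [show (fun i => algebraMap (MvPolynomial (Fin d) k) C (X i)) =
      fun i => algebraMap B C (ι i t) from funext hX, ← map_vandermondeDet]
    have hadd : ∀ x y : C, alternation d (x + y) = alternation d x + alternation d y :=
      alternation_add
    induction c using TensorProduct.induction_on with
    | zero => simp [alternation]
    | add x y hx hy => rw [hadd]; exact dvd_add hx hy
    | tmul r b =>
      have : (r ⊗ₜ b : C) = algebraMap R' C r * algebraMap B C b := by
        rw [hBC, hR'C, Algebra.TensorProduct.tmul_mul_tmul, one_mul, mul_one]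
      rw [this, alternation_mul_of_invariant fun σ => hinv σ r, ← map_alternation _ heq]
      refine dvd_mul_of_dvd_right ?_ _
      refine (IsUnit.dvd_mul_left (hfC f₁ (dvd_mul_right _ _))).mp ?_
      rw [← map_mul]
      exact map_dvd _ (hdvd b)

end LocalStep

end SymPow

/-! ### Smooth affine curves -/

namespace SymPow

open scoped TensorProduct Polynomial Pointwise

/-- A smooth algebra of relative dimension one is étale over the affine line by way of a function
as soon as the differential of that function generates the module of differentials. -/
lemma formallyEtale_polynomial_of_isUnit {k T : Type u} [CommRing k] [CommRing T] [Algebra k T]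
    [Algebra k[X] T] [IsScalarTower k k[X] T] [Algebra.FormallySmooth k T]
    (φ : Ω[T⁄k] ≃ₗ[T] T)
    (h : IsUnit (φ (KaehlerDifferential.D k T (algebraMap k[X] T Polynomial.X)))) :
    Algebra.FormallyEtale k[X] T := by
  let e : T ⊗[k[X]] Ω[k[X]⁄k] ≃ₗ[T] T :=
    (KaehlerDifferential.polynomialEquiv k).baseChange k[X] T _ _ ≪≫ₗ
      (TensorProduct.AlgebraTensorModule.rid k[X] T T)
  obtain ⟨u, hu⟩ := h
  have key : ∀ z, φ (KaehlerDifferential.mapBaseChange k k[X] T z) = u * e z := by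
    let ψ : T ⊗[k[X]] Ω[k[X]⁄k] →ₗ[T] T :=
      φ.toLinearMap ∘ₗ KaehlerDifferential.mapBaseChange k k[X] T
    have hψ : ∀ y, ψ (e.symm y) = y * ψ (e.symm 1) := fun y => by
      rw [← smul_eq_mul, ← map_smul, ← map_smul, smul_eq_mul, mul_one]
    have he : e.symm 1 = 1 ⊗ₜ KaehlerDifferential.D k k[X] Polynomial.X := by
      rw [LinearEquiv.symm_apply_eq]
      simp [e, KaehlerDifferential.polynomialEquiv_D]
    intro z
    change ψ z = _
    have h1 := hψ (e z)
    rw [LinearEquiv.symm_apply_apply, he] at h1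
    rw [h1, mul_comm]
    congr 1
    simp [ψ, hu]
  have hinj : Function.Injective (KaehlerDifferential.mapBaseChange k k[X] T) := fun x y hxy => by
    have := congrArg φ hxy
    rw [key, key] at this
    exact e.injective (u.isUnit.mul_left_cancel this)
  have hsurj : Function.Surjective (KaehlerDifferential.mapBaseChange k k[X] T) := fun y => by
    refine ⟨e.symm (↑u⁻¹ * φ y), φ.injective ?_⟩
    rw [key, LinearEquiv.apply_symm_apply, Units.mul_inv_cancel_left]
  rw [Algebra.formallyEtale_iff]
  constructor
  · refine subsingleton_of_forall_eq 0 fun x => ?_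
    obtain ⟨y, rfl⟩ := KaehlerDifferential.map_surjective k k[X] T x
    exact (KaehlerDifferential.exact_mapBaseChange_map k k[X] T y).mpr (hsurj y)
  · refine subsingleton_of_forall_eq 0 fun x => ?_
    have h0 : Algebra.H1Cotangent.δ k k[X] T x = 0 := hinj <| by
      rw [map_zero]
      exact (Algebra.H1Cotangent.exact_δ_mapBaseChange k k[X] T _).mpr ⟨x, rfl⟩
    obtain ⟨y, rfl⟩ := (Algebra.H1Cotangent.exact_map_δ k k[X] T x).mp h0
    have := ((Algebra.formallySmooth_iff k T).mp inferInstance).2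
    rw [Subsingleton.elim y 0, map_zero]

/-- `A` is locally standard smooth of relative dimension one over `k`. -/
def IsSmoothCurve (k A : Type u) [CommRing k] [CommRing A] [Algebra k A] : Prop :=
  ∃ s : Set A, Ideal.span s = ⊤ ∧
    ∀ g ∈ s, Algebra.IsStandardSmoothOfRelativeDimension 1 k (Localization.Away g)

lemma isSmoothCurve_iff_locally {k A : Type u} [CommRing k] [CommRing A] [Algebra k A] :
    IsSmoothCurve k A ↔ RingHom.Locally
      (fun {R S} [CommRing R] [CommRing S] => RingHom.IsStandardSmoothOfRelativeDimension 1)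
      (algebraMap k A) := by
  have (g : A) : Algebra.IsStandardSmoothOfRelativeDimension 1 k (Localization.Away g) ↔
      RingHom.IsStandardSmoothOfRelativeDimension 1
        ((algebraMap A (Localization.Away g)).comp (algebraMap k A)) := by
    rw [← IsScalarTower.algebraMap_eq, RingHom.isStandardSmoothOfRelativeDimension_algebraMap]
  simp only [IsSmoothCurve, RingHom.Locally, this]
  exact ⟨fun ⟨s, h1, h2⟩ => ⟨s, h1, h2⟩, fun ⟨s, h1, h2⟩ => ⟨s, h1, h2⟩⟩

namespace IsSmoothCurve

variable {k A : Type u} [CommRing k] [CommRing A] [Algebra k A]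

lemma baseChange (h : IsSmoothCurve k A) (K : Type u) [CommRing K] [Algebra k K] :
    IsSmoothCurve K (K ⊗[k] A) := by
  rw [isSmoothCurve_iff_locally] at h ⊢
  have hP := RingHom.locally_isStableUnderBaseChange
    RingHom.isStandardSmoothOfRelativeDimension_respectsIso
    (RingHom.isStandardSmoothOfRelativeDimension_isStableUnderBaseChange 1)
  let : Algebra A (K ⊗[k] A) := Algebra.TensorProduct.rightAlgebra
  exact hP k A K (K ⊗[k] A) h

lemma smooth (h : IsSmoothCurve k A) : Algebra.Smooth k A := by
  rw [isSmoothCurve_iff_locally] at h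
  rw [← RingHom.smooth_algebraMap, RingHom.smooth_iff_locally_isStandardSmooth]
  exact RingHom.locally_of_locally (fun hf => hf.isStandardSmooth 1) h

/-- Kähler differentials of a smooth curve are locally free of rank one. -/
lemma exists_linearEquiv (h : IsSmoothCurve k A) (m : Ideal A) [m.IsPrime] :
    Nonempty (Ω[Localization.AtPrime m⁄k] ≃ₗ[Localization.AtPrime m] Localization.AtPrime m) := by
  obtain ⟨s, hs, hs'⟩ := h
  obtain ⟨g, hgs, hg⟩ : ∃ g ∈ s, g ∉ m := by
    by_contra! H
    exact ‹m.IsPrime›.ne_top (top_le_iff.mp (hs ▸ Ideal.span_le.mpr H))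
  have := hs' g hgs
  let S := Localization.AtPrime m
  let T := Localization.Away g
  have hT : IsUnit (algebraMap A S g) := IsLocalization.map_units S (⟨g, hg⟩ : m.primeCompl)
  let : Algebra T S := (IsLocalization.Away.lift g hT).toAlgebra
  have : IsScalarTower A T S :=
    .of_algebraMap_eq fun a => (IsLocalization.Away.lift_eq g hT a).symm
  have : IsScalarTower k T S := .of_algebraMap_eq fun a => by
    rw [IsScalarTower.algebraMap_apply k A S, IsScalarTower.algebraMap_apply A T S,
      ← IsScalarTower.algebraMap_apply k A T]
  have : Algebra.FormallyEtale A T := .of_isLocalization (.powers g)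
  have : Algebra.FormallyEtale A S := .of_isLocalization m.primeCompl
  have : Algebra.FormallyEtale T S := .of_restrictScalars (R := A)
  have : Algebra.IsStandardSmooth k T :=
    Algebra.IsStandardSmoothOfRelativeDimension.isStandardSmooth 1
  have : Nontrivial T := (algebraMap T S).domain_nontrivial
  have hr :=
    Algebra.IsStandardSmoothOfRelativeDimension.rank_kaehlerDifferential (R := k) (S := T) 1
  have : Module.Free T Ω[T⁄k] := Algebra.IsStandardSmooth.free_kaehlerDifferential
  obtain ⟨b⟩ := (Module.nonempty_linearEquiv_iff_rank_eq_one (R := T) (M := Ω[T⁄k])).mpr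
    (by simpa using hr)
  exact ⟨(KaehlerDifferential.tensorKaehlerEquivOfFormallyEtale k T S).symm ≪≫ₗ
    b.symm.baseChange T S _ _ ≪≫ₗ TensorProduct.AlgebraTensorModule.rid T S S⟩

/-- The differential of some function generates the Kähler differentials at a given point. -/
lemma exists_isUnit_D (m : Ideal A) [m.IsPrime]
    (φ : Ω[Localization.AtPrime m⁄k] ≃ₗ[Localization.AtPrime m] Localization.AtPrime m) :
    ∃ s : A, IsUnit (φ (KaehlerDifferential.D k (Localization.AtPrime m) (algebraMap A _ s))) := by
  let S := Localization.AtPrime m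
  let N : Submodule S Ω[S⁄k] := Submodule.comap φ.toLinearMap (IsLocalRing.maximalIdeal S)
  by_contra! H
  have h1 := KaehlerDifferential.span_range_map_derivation_of_isLocalization k A S m.primeCompl
  have : Submodule.span S
      (Set.range (KaehlerDifferential.map k k A S ∘ KaehlerDifferential.D k A)) ≤ N := by
    rw [Submodule.span_le]
    rintro _ ⟨s, rfl⟩
    have := H s
    rw [← mem_nonunits_iff, ← IsLocalRing.mem_maximalIdeal] at this
    change φ (KaehlerDifferential.map k k A S (KaehlerDifferential.D k A s)) ∈
      IsLocalRing.maximalIdeal S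
    rwa [KaehlerDifferential.map_D]
  rw [h1, top_le_iff] at this
  have h2 : φ.symm 1 ∈ N := this ▸ Submodule.mem_top
  simp only [N, Submodule.mem_comap, LinearEquiv.coe_coe, LinearEquiv.apply_symm_apply] at h2
  exact (Ideal.ne_top_iff_one _).mp (IsLocalRing.maximalIdeal.isMaximal S).ne_top h2

end IsSmoothCurve

end SymPow

/-! ### Smoothness of rings of symmetric tensors -/

namespace SymPow

open scoped TensorProduct Polynomial Pointwise

/-- Finitely many rational points of a smooth affine curve over an infinite field are separated by
a function which is an étale coordinate at each of them. The Chinese remainder theorem provides a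
function with prescribed values and differentials at these points. -/
lemma IsSmoothCurve.exists_isEtaleCoordinate {k A : Type u} [Field k] [Infinite k] [CommRing A]
    [Algebra k A] (hA : IsSmoothCurve k A) {I : Type*} [Finite I] (x : I → A →ₐ[k] k) :
    ∃ t h : A, IsEtaleCoordinate k t h ∧ (∀ i j, x i t = x j t → x i = x j) ∧ ∀ i, x i h ≠ 0 := by
  have := hA.smooth
  have : Algebra.FinitePresentation k A := Algebra.Smooth.finitePresentation
  -- It suffices to treat a set of distinct points.
  let J := Set.range x
  let m : J → Ideal A := fun p => RingHom.ker p.1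
  have hmax : ∀ p, (m p).IsMaximal := fun p =>
    RingHom.ker_isMaximal_of_surjective _ fun c => ⟨algebraMap k A c, p.1.commutes c⟩
  have hext : ∀ {p q : J}, m p ≤ m q → p = q := fun {p q} hpq =>
      Subtype.ext <| AlgHom.ext fun a => by
    have h1 : a - algebraMap k A (p.1 a) ∈ m p := by simp [m, RingHom.mem_ker]
    have h2 := hpq h1
    simp only [m, RingHom.mem_ker, map_sub, AlgHom.commutes, Algebra.algebraMap_self,
      RingHom.id_apply] at h2
    exact (sub_eq_zero.mp h2).symm
  have hprime : ∀ p, (m p).IsPrime := fun p => (hmax p).isPrime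
  let φ := fun p => (hA.exists_linearEquiv (m p)).some
  choose s hs using fun p => IsSmoothCurve.exists_isUnit_D (m p) (φ p)
  -- Second order conditions at the points: distinct values and nonzero differentials.
  let c : J → k := fun p => Infinite.natEmbedding k (Finite.equivFin J p)
  have hc : Function.Injective c := (Infinite.natEmbedding k).injective.comp <|
    Fin.val_injective.comp (Finite.equivFin J).injective
  obtain ⟨t, ht⟩ := Ideal.exists_forall_sub_mem_ideal (I := fun p => m p ^ 2)
    (fun p q hpq => (Ideal.isCoprime_iff_sup_eq.mpr
      (Ideal.IsMaximal.coprime_of_ne (hmax p) (hmax q) fun h => hpq (hext h.le))).pow)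
    (fun p => s p - algebraMap k A (p.1 (s p)) + algebraMap k A (c p))
  have hval : ∀ p : J, p.1 t = c p := fun p => by
    have : t - _ ∈ m p := Ideal.pow_le_self two_ne_zero (ht p)
    simpa [m, RingHom.mem_ker, sub_eq_zero] using this
  have hsq : ∀ p, ∀ z ∈ m p ^ 2,
      φ p (KaehlerDifferential.D k (Localization.AtPrime (m p)) (algebraMap A _ z)) ∈
        IsLocalRing.maximalIdeal (Localization.AtPrime (m p)) := fun p z hz => by
    have hle : ∀ a ∈ m p, algebraMap A (Localization.AtPrime (m p)) a ∈
        IsLocalRing.maximalIdeal (Localization.AtPrime (m p)) := fun a ha =>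
      (IsLocalization.AtPrime.to_map_mem_maximal_iff _ (m p) a).mpr ha
    rw [pow_two] at hz
    induction hz using Submodule.mul_induction_on' with
    | mem_mul_mem a ha b hb =>
      rw [map_mul, Derivation.leibniz, map_add, map_smul, map_smul]
      exact add_mem (Ideal.mul_mem_right _ _ (hle a ha)) (Ideal.mul_mem_right _ _ (hle b hb))
    | add a _ b _ ha hb => rw [map_add, map_add, map_add]; exact add_mem ha hb
  have hDt : ∀ p, IsUnit (φ p (KaehlerDifferential.D k (Localization.AtPrime (m p))
      (algebraMap A _ t))) := fun p => by
    by_contra hn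
    rw [← mem_nonunits_iff, ← IsLocalRing.mem_maximalIdeal] at hn
    have := sub_mem hn (hsq p _ (ht p))
    rw [← map_sub, ← map_sub, ← map_sub, sub_sub_cancel, map_add, map_sub,
      ← IsScalarTower.algebraMap_apply, ← IsScalarTower.algebraMap_apply, map_add, map_sub,
      Derivation.map_algebraMap, Derivation.map_algebraMap, sub_zero, add_zero] at this
    exact (IsLocalRing.mem_maximalIdeal _).mp this (hs p)
  let : Algebra k[X] A := (Polynomial.aeval (R := k) t).toRingHom.toAlgebra
  have hX : algebraMap k[X] A Polynomial.X = t := Polynomial.aeval_X (R := k) t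
  have : IsScalarTower k k[X] A := .of_algebraMap_eq fun a =>
    (Polynomial.aeval_C (R := k) t a).symm
  have : Algebra.FinitePresentation k[X] A :=
    Algebra.FinitePresentation.of_restrict_scalars_finitePresentation k k[X] A
  have het : ∀ p, (⟨m p, hprime p⟩ : PrimeSpectrum A) ∈ Algebra.etaleLocus k[X] A := fun p => by
    have : Algebra.FormallySmooth A (Localization.AtPrime (m p)) :=
      .of_isLocalization (m p).primeCompl
    have : Algebra.FormallySmooth k (Localization.AtPrime (m p)) := .comp k A _
    refine formallyEtale_polynomial_of_isUnit (φ p) ?_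
    rw [IsScalarTower.algebraMap_apply k[X] A, hX]
    exact hDt p
  obtain ⟨a, ha⟩ := (PrimeSpectrum.isClosed_iff_zeroLocus_ideal _).mp
    (Algebra.isOpen_etaleLocus (R := k[X]) (A := A)).isClosed_compl
  have hnot : ∀ p, ¬ a ≤ m p := fun p hle => by
    have : (⟨m p, hprime p⟩ : PrimeSpectrum A) ∈ (Algebra.etaleLocus k[X] A)ᶜ := ha ▸ hle
    exact this (het p)
  obtain ⟨h, hha, hhm⟩ : ∃ h ∈ a, ∀ p, h ∉ m p := by
    obtain _ | ⟨⟨q⟩⟩ := isEmpty_or_nonempty J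
    · -- Without points there is no condition on `h`; prime avoidance needs at least one prime.
      exact ⟨0, zero_mem _, fun p => isEmptyElim p⟩
    · have := Fintype.ofFinite J
      by_contra! H
      have : (a : Set A) ⊆ ⋃ p ∈ ((Finset.univ : Finset J) : Set J), m p := fun h hh => by
        simpa using H h hh
      rw [Ideal.subset_union_prime q q fun p _ _ _ => hprime p] at this
      obtain ⟨p, -, hp⟩ := this
      exact hnot p hp
  refine ⟨t, h, ?_, fun i j hij => ?_, fun i => hhm ⟨x i, i, rfl⟩⟩
  · refine Algebra.basicOpen_subset_etaleLocus_iff_etale.mp fun q hq => ?_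
    by_contra hn
    have : q ∈ PrimeSpectrum.zeroLocus (a : Set A) := ha ▸ hn
    exact hq (this hha)
  · exact congrArg Subtype.val (hc (a₁ := ⟨x i, i, rfl⟩) (a₂ := ⟨x j, j, rfl⟩)
      ((hval ⟨x i, i, rfl⟩).symm.trans (hij.trans (hval ⟨x j, j, rfl⟩))))

section Quotient

variable {k A B : Type u} (R : Type u) [Field k] [CommRing A] [CommRing B] [CommRing R]
  [Algebra k A] [Algebra k B] [Algebra k R] [Algebra R B] [IsScalarTower k R B] {d : ℕ}
  {ι : Fin d → A →ₐ[k] B} [MulSemiringAction (Equiv.Perm (Fin d)) B]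
  [SMulCommClass (Equiv.Perm (Fin d)) R B] [Algebra.IsInvariant R B (Equiv.Perm (Fin d))]

lemma finiteType_invariants (d : ℕ) [MulSemiringAction (Equiv.Perm (Fin d)) B]
    [SMulCommClass (Equiv.Perm (Fin d)) R B] [Algebra.IsInvariant R B (Equiv.Perm (Fin d))]
    [Algebra.FiniteType k B] (hR : Function.Injective (algebraMap R B)) :
    Algebra.FiniteType k R := by
  have : Algebra.FiniteType R B := .of_restrictScalars_finiteType k R B
  have := Algebra.IsInvariant.isIntegral R B (Equiv.Perm (Fin d))
  have : Module.Finite R B := Algebra.IsIntegral.finite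
  exact ⟨fg_of_fg_of_fg k R B Algebra.FiniteType.out Module.Finite.fg_top hR⟩

/-- The symmetric power of a smooth affine curve over an algebraically closed field is smooth: a
closed point of the tensor power is a tuple of rational points of the curve, and these are separated
by an étale coordinate. -/
lemma smooth_invariants_of_isAlgClosed [IsAlgClosed k] (hA : IsSmoothCurve k A)
    (hB : IsTensorPower k ι) (hR : Function.Injective (algebraMap R B))
    (hι : ∀ (σ : Equiv.Perm (Fin d)) i a, σ • ι i a = ι (σ i) a) : Algebra.Smooth k R := by
  have := hA.smooth
  have : Algebra.FiniteType k A := inferInstance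
  have := hB.finiteType
  have := finiteType_invariants (k := k) R d hR
  have : Algebra.FinitePresentation k R := Algebra.FinitePresentation.of_finiteType.mp this
  have := Algebra.IsInvariant.isIntegral R B (Equiv.Perm (Fin d))
  refine ⟨?_, inferInstance⟩
  rw [← Algebra.smoothLocus_eq_univ_iff]
  by_contra hne
  obtain ⟨a, ha⟩ := (PrimeSpectrum.isClosed_iff_zeroLocus_ideal _).mp
    (Algebra.isOpen_smoothLocus (R := k) (A := R)).isClosed_compl
  have hatop : a ≠ ⊤ := fun h => by
    rw [h, Submodule.top_coe, PrimeSpectrum.zeroLocus_univ] at ha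
    exact hne (Set.compl_empty_iff.mp ha)
  obtain ⟨q, hq, haq⟩ := Ideal.exists_le_maximal a hatop
  obtain ⟨M, hM, hMq⟩ := Ideal.exists_ideal_over_maximal_of_isIntegral (S := B) q
    (by rw [(RingHom.injective_iff_ker_eq_bot _).mp hR]; exact bot_le)
  let : Field (B ⧸ M) := Ideal.Quotient.field M
  have : Module.Finite k (B ⧸ M) := finite_of_finite_type_of_isJacobsonRing k (B ⧸ M)
  let e : k ≃ₐ[k] B ⧸ M := AlgEquiv.ofBijective (Algebra.ofId k (B ⧸ M))
    IsAlgClosed.algebraMap_bijective_of_isIntegral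
  let x : Fin d → A →ₐ[k] k := fun i =>
    (e.symm.toAlgHom.comp (Ideal.Quotient.mkₐ k M)).comp (ι i)
  have hx : ∀ i a, x i a = e.symm (Ideal.Quotient.mk M (ι i a)) := fun i a => rfl
  have hx' : ∀ i j a, ι i a - ι j a ∈ M ↔ x i a = x j a := fun i j a => by
    rw [hx, hx, EmbeddingLike.apply_eq_iff_eq, Ideal.Quotient.eq]
  obtain ⟨t, h, ht, htx, hhx⟩ := hA.exists_isEtaleCoordinate x
  have hsep : Separates ι t h M :=
    ⟨fun i j hij z => (hx' i j z).mpr (by rw [htx i j ((hx' i j t).mp hij)]), fun i hi =>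
      hhx i (by rw [hx, Ideal.Quotient.eq_zero_iff_mem.mpr hi, map_zero])⟩
  obtain ⟨f, hf, hfs⟩ := hsep.exists_smooth_away R hB ht hR hι
  have hqf : (⟨q, hq.isPrime⟩ : PrimeSpectrum R) ∈ PrimeSpectrum.basicOpen f := by
    subst hMq; exact hf
  have h1 := Algebra.basicOpen_subset_smoothLocus_iff_smooth.mpr hfs hqf
  have h2 : (⟨q, hq.isPrime⟩ : PrimeSpectrum R) ∈ (Algebra.smoothLocus k R)ᶜ := ha ▸ haq
  exact h2 h1

/-- The symmetric power of a smooth affine curve over a field is smooth: smoothness descends from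
the algebraic closure, and the formation of invariants commutes with extension of the base field. -/
theorem smooth_invariants (hA : IsSmoothCurve k A)
    (hB : IsTensorPower k ι) (hR : Function.Injective (algebraMap R B))
    (hι : ∀ (σ : Equiv.Perm (Fin d)) i a, σ • ι i a = ι (σ i) a) : Algebra.Smooth k R := by
  let K := AlgebraicClosure k
  let R' := K ⊗[k] R
  let B' := K ⊗[k] B
  let G := Equiv.Perm (Fin d)
  have hk : ∀ (σ : G) (a : k), σ • algebraMap k B a = algebraMap k B a := fun σ a =>
    smul_algebraMap_base R σ a
  have : SMulCommClass G k B := ⟨fun σ a b => by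
    rw [Algebra.smul_def, Algebra.smul_def, MulSemiringAction.smul_mul, hk]⟩
  let : MulSemiringAction G B' := tensorAction G K
  let : Algebra R R' := Algebra.TensorProduct.rightAlgebra
  let : Algebra B B' := Algebra.TensorProduct.rightAlgebra
  let j : R' →ₐ[K] B' := Algebra.TensorProduct.map (AlgHom.id K K) (IsScalarTower.toAlgHom k R B)
  let : Algebra R' B' := j.toRingHom.toAlgebra
  let : Algebra R B' := ((algebraMap B B').comp (algebraMap R B)).toAlgebra
  have hj : ∀ (a : K) (r : R), algebraMap R' B' (a ⊗ₜ r) = a ⊗ₜ algebraMap R B r := fun a r =>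
    Algebra.TensorProduct.map_tmul _ _ _ _
  have hBB' : ∀ b : B, algebraMap B B' b = 1 ⊗ₜ b := fun b => rfl
  have hRR' : ∀ r : R, algebraMap R R' r = 1 ⊗ₜ r := fun r => rfl
  have hsmul : ∀ (σ : G) (a : K) (b : B), σ • (a ⊗ₜ[k] b : B') = a ⊗ₜ (σ • b) :=
    fun σ a b => Algebra.TensorProduct.map_tmul _ _ _ _
  have : IsScalarTower R B B' := .of_algebraMap_eq fun r => rfl
  have : IsScalarTower R R' B' := .of_algebraMap_eq fun r => by
    rw [hRR', hj, IsScalarTower.algebraMap_apply R B B', hBB']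
  have : IsScalarTower K R' B' := .of_algebraMap_eq fun a => (j.commutes a).symm
  have : IsScalarTower k R B' := .of_algebraMap_eq fun a => by
    rw [IsScalarTower.algebraMap_apply R B B', ← IsScalarTower.algebraMap_apply k R B,
      ← IsScalarTower.algebraMap_apply k B B']
  have : IsScalarTower k R' B' := .of_algebraMap_eq fun a => by
    rw [IsScalarTower.algebraMap_apply k K B', IsScalarTower.algebraMap_apply K R' B',
      ← IsScalarTower.algebraMap_apply k K R']
  have hpush : Algebra.IsPushout R R' B B' :=
    ((Algebra.IsPushout.comp_iff (R := k) (S := R) (R' := K) (S' := R') (T := B) (T' := B')).mp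
      inferInstance).symm
  have hinv : ∀ (σ : G) (r : R'), σ • algebraMap R' B' r = algebraMap R' B' r := fun σ r => by
    induction r using TensorProduct.induction_on with
    | zero => rw [map_zero, smul_zero]
    | tmul a r => rw [hj, hsmul, smul_algebraMap]
    | add x y hx hy => rw [map_add, smul_add, hx, hy]
  have : SMulCommClass G R' B' := ⟨fun σ r b => by
    rw [Algebra.smul_def, Algebra.smul_def, MulSemiringAction.smul_mul, hinv]⟩
  have : Module.Flat R R' :=
    Module.Flat.isBaseChange k R K R' (inferInstance : Algebra.IsPushout k R K R').out
  have : Algebra.IsInvariant R' B' G :=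
    isInvariant_of_flat G (R := R) (B := B) fun σ b => by rw [hBB', hBB', hsmul]
  have hR' : Function.Injective (algebraMap R' B') :=
    algebraMap_injective_of_isPushout (R := R) (B := B) hR
  have : Algebra.Smooth K (K ⊗[k] R) :=
    smooth_invariants_of_isAlgClosed R' (hA.baseChange K) (hB.baseChange K) hR' fun σ i a => by
      induction a using TensorProduct.induction_on with
      | zero => simp
      | tmul a b =>
        rw [Algebra.TensorProduct.map_tmul, Algebra.TensorProduct.map_tmul, hsmul, hι]
      | add x y hx hy => rw [map_add, map_add, smul_add, hx, hy]
  exact .of_smooth_tensorProduct_of_faithfullyFlat K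

end Quotient

end SymPow

/-! ### Regularity of smooth algebras over a field -/

namespace SymPow

/-- An étale algebra over a regular ring is regular: a regular system of parameters of the base
still generates the maximal ideal, and by flatness the dimension does not drop. -/
lemma isRegularRing_of_etale (P S : Type*) [CommRing P] [CommRing S] [Algebra P S]
    [Algebra.Etale P S] [IsRegularRing P] : IsRegularRing S := by
  have : IsNoetherianRing S := Algebra.FiniteType.isNoetherianRing P S
  rw [isRegularRing_iff]
  intro q hq
  let p := q.under P
  let := Localization.AtPrime.algebraOfLiesOver p q
  have : IsNoetherianRing (Localization.AtPrime q) :=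
    IsLocalization.isNoetherianRing q.primeCompl _ inferInstance
  have : Algebra.FormallyUnramified S (Localization.AtPrime q) :=
    .of_isLocalization q.primeCompl
  have : Algebra.IsUnramifiedAt P q := Algebra.FormallyUnramified.comp P S _
  have hmap := ((Algebra.isUnramifiedAt_iff_map_eq P p q).mp inferInstance).2
  have hmap' : (IsLocalRing.maximalIdeal (Localization.AtPrime p)).map
      (algebraMap (Localization.AtPrime p) (Localization.AtPrime q)) =
        IsLocalRing.maximalIdeal (Localization.AtPrime q) := by
    rw [← hmap, ← Localization.AtPrime.map_eq_maximalIdeal, Ideal.map_map,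
      ← IsScalarTower.algebraMap_eq]
  refine IsRegularLocalRing.of_spanFinrank_maximalIdeal_le _ ?_
  have h1 : (IsLocalRing.maximalIdeal (Localization.AtPrime q)).spanFinrank ≤
      (IsLocalRing.maximalIdeal (Localization.AtPrime p)).spanFinrank := by
    rw [← hmap']
    exact Ideal.spanFinrank_map_le_of_fg _ (IsNoetherian.noetherian _)
  have h2 : (IsLocalRing.maximalIdeal (Localization.AtPrime p)).spanFinrank =
      ringKrullDim (Localization.AtPrime p) := IsRegularLocalRing.spanFinrank_maximalIdeal
  calc _ ≤ ((IsLocalRing.maximalIdeal (Localization.AtPrime p)).spanFinrank : WithBot ℕ∞) := by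
        exact_mod_cast h1
    _ = p.height := by rw [h2, IsLocalization.AtPrime.ringKrullDim_eq_height p]
    _ ≤ q.height := by
        rw [Ideal.height_eq_height_add_of_liesOver_of_hasGoingDown p q]
        exact_mod_cast le_self_add
    _ = _ := (IsLocalization.AtPrime.ringKrullDim_eq_height q _).symm

/-- Smooth algebras over a field are regular, since they are locally étale over polynomial rings. -/
theorem isRegularRing_of_smooth (k R : Type u) [Field k] [CommRing R] [Algebra k R]
    [Algebra.Smooth k R] : IsRegularRing R := by
  have : IsNoetherianRing R := Algebra.FiniteType.isNoetherianRing k R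
  rw [isRegularRing_iff]
  intro q hq
  have : Algebra.FormallySmooth R (Localization.AtPrime q) := .of_isLocalization q.primeCompl
  have : Algebra.IsSmoothAt k q := Algebra.FormallySmooth.comp k R _
  obtain ⟨f, hf, n, _, _, _⟩ :=
    Algebra.IsSmoothAt.exists_isStandardEtale_mvPolynomial (R := k) (p := q)
  have := isRegularRing_of_etale (MvPolynomial (Fin n) k) (Localization.Away f)
  let q' := q.map (algebraMap R (Localization.Away f))
  have hdisj := (Ideal.disjoint_powers_iff_notMem_of_isPrime (I := q) f).mpr hf
  have : q'.IsPrime := IsLocalization.isPrime_of_isPrime_disjoint (.powers f) _ _ ‹_› hdisj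
  have hq' : q'.under R = q := IsLocalization.under_map_of_isPrime_disjoint (.powers f) _ ‹_› hdisj
  have h := IsLocalization.isLocalization_isLocalization_atPrime_isLocalization (.powers f)
    (Localization.AtPrime q') q'
  have h' : IsLocalization.AtPrime (Localization.AtPrime q') q := by
    have h1 : ∀ (a b : Ideal R) [a.IsPrime] [b.IsPrime], a = b →
        IsLocalization.AtPrime (Localization.AtPrime q') a →
        IsLocalization.AtPrime (Localization.AtPrime q') b := by rintro a b _ _ rfl h; exact h
    exact h1 _ _ hq' h
  exact .of_ringEquiv (IsLocalization.algEquiv q.primeCompl (Localization.AtPrime q')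
    (Localization.AtPrime q)).toRingEquiv

end SymPow

/-! ### Orbit spaces of schemes -/

namespace SymPow

open Opposite TopologicalSpace

/-- The functions on `Q` are the functions on `P` which are invariant under the
transformations `α σ`. -/
def HasInvariantSections {G : Type} {P Q : PresheafedSpace.{_, _, u} CommRingCat.{u}}
    (α : G → (P ⟶ P)) (p : P ⟶ Q) : Prop :=
  ∀ V : Opens Q.carrier, Function.Injective (p.c.app (op V)) ∧
    ∀ s : P.presheaf.obj (op ((Opens.map p.base).obj V)),
      (∀ (σ : G) (h : (Opens.map p.base).obj V ≤
          (Opens.map (α σ).base).obj ((Opens.map p.base).obj V)),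
        P.presheaf.map (homOfLE h).op ((α σ).c.app (op ((Opens.map p.base).obj V)) s) = s) →
      ∃ t, p.c.app (op V) t = s

lemma HasInvariantSections.comp_iso {G : Type} {P Q Q' : PresheafedSpace.{_, _, u} CommRingCat.{u}}
    {α : G → (P ⟶ P)} {p : P ⟶ Q} (hp : HasInvariantSections α p) (e : Q ≅ Q') :
    HasInvariantSections α (p ≫ e.hom) := fun V => by
  have hc : (p ≫ e.hom).c.app (op V) =
      e.hom.c.app (op V) ≫ p.c.app (op ((Opens.map e.hom.base).obj V)) :=
    PresheafedSpace.comp_c_app _ _ _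
  obtain ⟨h1, h2⟩ := hp ((Opens.map e.hom.base).obj V)
  have := PresheafedSpace.c_isIso_of_iso e.hom
  have hb := ConcreteCategory.bijective_of_isIso (e.hom.c.app (op V))
  rw [hc]
  refine ⟨fun x y hxy => hb.1 (h1 hxy), fun s hs => ?_⟩
  obtain ⟨t, ht⟩ := h2 s hs
  obtain ⟨t', rfl⟩ := hb.2 t
  exact ⟨t', ht⟩

/-- Sections of the quotient of a presheafed space by a group are the invariant sections. -/
lemma hasInvariantSections_colimit {G : Type} [Group G]
    (F : SingleObj G ⥤ PresheafedSpace.{_, _, u} CommRingCat.{u}) :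
    HasInvariantSections
      (fun σ : G => F.map (X := SingleObj.star G) (Y := SingleObj.star G) σ)
      (colimit.ι F (SingleObj.star G)) := fun V => by
  let p := colimit.ι F (SingleObj.star G)
  let U := (Opens.map p.base).obj V
  let D := PresheafedSpace.componentwiseDiagram F V
  let e := PresheafedSpace.colimitPresheafObjIsoComponentwiseLimit F V
  have hp : p.c.app (op V) = e.hom ≫ limit.π D (op (SingleObj.star G)) :=
    (PresheafedSpace.colimitPresheafObjIsoComponentwiseLimit_hom_π F V _).symm
  have hL := isLimitOfPreserves (CategoryTheory.forget CommRingCat.{u}) (limit.isLimit D)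
  constructor
  · intro x y hxy
    rw [hp] at hxy
    refine (ConcreteCategory.bijective_of_isIso e.hom).1 ?_
    exact Concrete.limit_ext D _ _ fun j => hxy
  · intro s hs
    let t : (D ⋙ CategoryTheory.forget CommRingCat.{u}).sections :=
      ⟨fun j => s, fun {i j} f => by
        have h : U = (Opens.map (F.map f.unop).base).obj U := by
          change U = (Opens.map ((F.map f.unop).base ≫ p.base)).obj V
          rw [← PresheafedSpace.comp_base]
          exact congrArg (fun q : F.obj (SingleObj.star G) ⟶ colimit F =>
            (Opens.map q.base).obj V) (colimit.w F f.unop).symm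
        exact hs f.unop h.le⟩
    let x : ↑(limit D) := (Types.isLimitEquivSections hL).symm t
    have hx : e.hom (e.inv x) = x := by
      rw [← ConcreteCategory.comp_apply, e.inv_hom_id]; rfl
    refine ⟨e.inv x, ?_⟩
    rw [hp]
    exact (congrArg (limit.π D (op (SingleObj.star G))) hx).trans
      (Types.isLimitEquivSections_symm_apply hL t (op (SingleObj.star G)))

/-- `π : P ⟶ Q` is the quotient of the scheme `P` by the transformations `α σ` as a ringed space:
`Q` is the space of orbits with the quotient topology, and its functions are the invariant
functions of `P`. -/
structure IsOrbitSpace {G : Type} {P : Scheme.{u}} {Q : LocallyRingedSpace.{u}} (α : G → (P ⟶ P))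
    (π : P.toLocallyRingedSpace ⟶ Q) : Prop where
  comp_eq : ∀ σ, (α σ).toLRSHom ≫ π = π
  surjective : Function.Surjective π.base
  isOpen_of_preimage : ∀ V : Set Q, IsOpen (π.base ⁻¹' V) → IsOpen V
  exists_eq : ∀ x y : P, π.base x = π.base y → ∃ σ, α σ x = y
  app_injective : ∀ V : Opens Q, Function.Injective (π.c.app (op V))
  exists_app_eq : ∀ (V : Opens Q) (s : Γ(P, (Opens.map π.base).obj V)),
    (∀ (σ : G) (h : (Opens.map π.base).obj V ≤ α σ ⁻¹ᵁ (Opens.map π.base).obj V),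
      (α σ).appLE _ _ h s = s) → ∃ t, π.c.app (op V) t = s

/-- The quotient of a scheme by a group, formed in locally ringed spaces, is its orbit space with
the invariant functions: the forgetful functor to ringed spaces preserves colimits, and there the
functions on a colimit form a limit of rings. -/
theorem isOrbitSpace_colimit {G : Type} [Group G] (Φ : SingleObj G ⥤ Scheme.{u}) :
    IsOrbitSpace (fun σ : G => Φ.map (X := SingleObj.star G) (Y := SingleObj.star G) σ)
      (colimit.ι (Φ ⋙ Scheme.forgetToLocallyRingedSpace) (SingleObj.star G)) := by
  let F := Φ ⋙ Scheme.forgetToLocallyRingedSpace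
  let E := LocallyRingedSpace.forgetToSheafedSpace.{u} ⋙ SheafedSpace.forgetToPresheafedSpace
  have : PreservesColimitsOfSize.{0, 0} LocallyRingedSpace.forgetToSheafedSpace.{u} :=
    preservesSmallestColimits_of_preservesColimits _
  have : PreservesColimitsOfSize.{0, 0} (PresheafedSpace.forget.{_, _, u} CommRingCat.{u}) :=
    preservesSmallestColimits_of_preservesColimits _
  let e : E.obj (colimit F) ≅ colimit (F ⋙ E) := preservesColimitIso E F
  have he : E.map (colimit.ι F (SingleObj.star G)) =
      colimit.ι (F ⋙ E) (SingleObj.star G) ≫ e.inv := by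
    rw [Iso.eq_comp_inv]
    exact ι_preservesColimitIso_hom E F _
  let T := E ⋙ PresheafedSpace.forget CommRingCat
  have hT := isColimitOfPreserves T (colimit.isColimit F)
  have hS := isColimitOfPreserves (forget TopCat) hT
  let P := Φ.obj (SingleObj.star G)
  have hE := (hasInvariantSections_colimit (F ⋙ E)).comp_iso e.symm
  rw [Iso.symm_hom, ← he] at hE
  refine ⟨fun σ => colimit.w F _, ?_, ?_, ?_, ?_, ?_⟩
  · intro y
    obtain ⟨j, x, hx⟩ := Types.jointly_surjective _ hS y
    exact ⟨x, hx⟩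
  · intro V hV
    exact (TopCat.isOpen_iff_of_isColimit _ hT V).mpr fun j => hV
  · intro x y hxy
    -- The set of translates of `x` is invariant, so it is the preimage of a subset of `Q`.
    let act (σ : G) : P ⟶ P := Φ.map (X := SingleObj.star G) (Y := SingleObj.star G) σ
    have hmul (σ τ : G) (z : P) : act (σ * τ) z = act σ (act τ z) := by
      have : act (σ * τ) = act τ ≫ act σ :=
        Φ.map_comp (X := SingleObj.star G) (Y := SingleObj.star G) (Z := SingleObj.star G) τ σ
      rw [this, Scheme.Hom.comp_apply]
    have hone (z : P) : act 1 z = z := by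
      have : act 1 = 𝟙 P := Φ.map_id (SingleObj.star G)
      rw [this]; rfl
    let χ (z : P) : ULift.{u} Prop := ⟨∃ σ, act σ x = z⟩
    have hχ (σ : G) (z : P) : χ (act σ z) = χ z := by
      refine congrArg ULift.up (propext ⟨?_, ?_⟩)
      · rintro ⟨τ, hτ⟩
        refine ⟨σ⁻¹ * τ, ?_⟩
        rw [hmul, hτ, ← hmul, inv_mul_cancel, hone]
      · rintro ⟨τ, rfl⟩
        exact ⟨σ * τ, hmul σ τ x⟩
    let c : Cocone ((F ⋙ T) ⋙ forget TopCat) :=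
      { pt := ULift.{u} Prop
        ι :=
          { app := fun j => ↾χ
            naturality := fun i j σ => ConcreteCategory.hom_ext _ _ fun z => hχ σ z } }
    have hfac (z : P) : hS.desc c ((colimit.ι F (SingleObj.star G)).base z) = χ z :=
        ConcreteCategory.congr_hom (hS.fac c (SingleObj.star G)) z
    have := (hfac x).symm.trans ((congrArg (hS.desc c) hxy).trans (hfac y))
    exact (congrArg ULift.down this).mp ⟨1, hone x⟩
  · exact fun V => (hE V).1
  · exact fun V => (hE V).2

end SymPow

/-! ### A criterion for affineness -/

namespace SymPow

open Opposite TopologicalSpace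

/-- A homomorphism from a localization `S` of `R` is bijective if its restriction to `R` satisfies
the conditions which characterize that localization. -/
lemma bijective_of_isLocalizationAway {R S T : Type*} [CommRing R] [CommRing S] [CommRing T]
    [Algebra R S] {r : R} [IsLocalization.Away r S] (f : S →+* T) (g : R →+* T)
    (hfg : ∀ a, f (algebraMap R S a) = g a) (hinj : ∀ a, g a = 0 → ∃ n : ℕ, r ^ n * a = 0)
    (hsurj : ∀ s, ∃ (n : ℕ) (a : R), g a = s * g r ^ n) : Function.Bijective f := by
  have hu := IsLocalization.Away.algebraMap_isUnit (S := S) r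
  constructor
  · refine (injective_iff_map_eq_zero f).mpr fun z hz => ?_
    obtain ⟨n, a, ha⟩ := IsLocalization.Away.surj r z
    obtain ⟨m, hm⟩ := hinj a (by rw [← hfg, ← ha, map_mul, hz, zero_mul])
    have hm' : algebraMap R S (r ^ m) * algebraMap R S a = 0 := by rw [← map_mul, hm, map_zero]
    rw [← ha, map_pow, mul_comm z, ← mul_assoc, ← pow_add] at hm'
    exact (hu.pow _).mul_right_eq_zero.mp hm'
  · intro s
    obtain ⟨n, a, ha⟩ := hsurj s
    obtain ⟨z, hz⟩ := hu.pow n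
    refine ⟨algebraMap R S a * ↑z⁻¹, ((hu.map f).pow n).mul_right_cancel ?_⟩
    rw [hfg r, ← ha, ← hfg, ← hfg, ← map_pow, ← map_mul, ← hz, mul_assoc, Units.inv_mul, mul_one]

/-- A criterion for a locally ringed space `L` to be an affine scheme: the canonical map to the
spectrum of the global functions is bijective and closed, and over the basic open sets the functions
on `L` are the localizations of the global functions. -/
lemma isIso_toΓSpec (L : LocallyRingedSpace.{u}) (hbase : Function.Bijective L.toΓSpecFun)
    (hclosed : IsClosedMap L.toΓSpecFun)
    (hinj : ∀ r a : L.presheaf.obj (op ⊤), L.toToΓSpecMapBasicOpen r a = 0 →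
      ∃ n : ℕ, r ^ n * a = 0)
    (hsurj : ∀ (r : L.presheaf.obj (op ⊤)) (s : L.presheaf.obj (op (L.toΓSpecMapBasicOpen r))),
      ∃ (n : ℕ) (a : L.presheaf.obj (op ⊤)),
        L.toToΓSpecMapBasicOpen r a = s * L.toToΓSpecMapBasicOpen r r ^ n) :
    IsIso L.toΓSpec := by
  let R : Type u := LocallyRingedSpace.Γ.obj (op L)
  have happ (r : R) : IsIso (L.toΓSpecCApp r) := by
    rw [ConcreteCategory.isIso_iff_bijective]
    exact @bijective_of_isLocalizationAway R _ _ _ _ _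
      (StructureSheaf.openAlgebra R (op (PrimeSpectrum.basicOpen r))) r
      (StructureSheaf.IsLocalization.to_basicOpen R r) (L.toΓSpecCApp r).hom
      (L.toToΓSpecMapBasicOpen r).hom
      (fun a => ConcreteCategory.congr_hom (L.toΓSpecCApp_spec r) a) (hinj r) (hsurj r)
  have hb : IsIso L.toΓSpec.base := by
    let e := (Equiv.ofBijective _ hbase).toHomeomorphOfContinuousClosed L.toΓSpec_continuous hclosed
    exact (TopCat.isoOfHomeo (X := L.toTopCat) (Y := Spec.topObj (LocallyRingedSpace.Γ.obj (op L)))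
      e).isIso_hom
  have hc : IsIso L.toΓSpec.c := by
    let φ : (Spec.structureSheaf R) ⟶ (TopCat.Sheaf.pushforward _ L.toΓSpecBase).obj L.𝒪 :=
      ⟨L.toΓSpecSheafedSpace.hom.c⟩
    have : IsIso φ := TopCat.Sheaf.isIso_iff_isIso_basis PrimeSpectrum.isBasis_basic_opens
        fun r => by
      have := happ r
      rwa [← L.toΓSpecSheafedSpace_app_eq] at this
    exact Functor.map_isIso (TopCat.Sheaf.forget _ _) φ
  have : IsIso L.toΓSpec.toHom := PresheafedSpace.isIso_of_components _
  have : IsIso ((LocallyRingedSpace.forgetToSheafedSpace ⋙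
      SheafedSpace.forgetToPresheafedSpace).map L.toΓSpec) := this
  exact isIso_of_reflects_iso L.toΓSpec
    (LocallyRingedSpace.forgetToSheafedSpace ⋙ SheafedSpace.forgetToPresheafedSpace)

end SymPow

/-! ### Quotients of affine schemes by finite groups -/

namespace SymPow

open Opposite TopologicalSpace
open scoped Pointwise

/-- The transformations `α σ` of a scheme form an action of a group. -/
structure IsGroupAction {G : Type} [Group G] {T : Scheme.{u}} (α : G → (T ⟶ T)) : Prop where
  one_eq : α 1 = 𝟙 T
  mul_eq : ∀ σ τ, α (σ * τ) = α τ ≫ α σ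

/-- The action of a group on the global functions of a scheme, `σ • b = b ∘ σ⁻¹`. -/
@[reducible] noncomputable def IsGroupAction.sectionsAction {G : Type} [Group G] {T : Scheme.{u}}
    {α : G → (T ⟶ T)} (hα : IsGroupAction α) : MulSemiringAction G Γ(T, ⊤) where
  smul σ b := (α σ⁻¹).appTop.hom b
  one_smul b := by
    change (α 1⁻¹).appTop.hom b = b
    rw [inv_one, hα.one_eq]; rfl
  mul_smul σ τ b := by
    change (α (σ * τ)⁻¹).appTop.hom b = (α σ⁻¹).appTop.hom ((α τ⁻¹).appTop.hom b)
    rw [mul_inv_rev, hα.mul_eq, Scheme.Hom.comp_appTop]; rfl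
  smul_zero _ := map_zero _
  smul_add _ := map_add _
  smul_one _ := map_one _
  smul_mul _ := map_mul _

namespace IsOrbitSpace

section

variable {G : Type} {P : Scheme.{u}} {Q : LocallyRingedSpace.{u}} {α : G → (P ⟶ P)}
  {π : P.toLocallyRingedSpace ⟶ Q}

/-- The functions pulled back from the quotient are invariant. -/
lemma appLE_app (h : IsOrbitSpace α π) (V : Opens Q) (t : Q.presheaf.obj (op V)) (σ : G)
    (hσ : (Opens.map π.base).obj V ≤ α σ ⁻¹ᵁ (Opens.map π.base).obj V) :
    (α σ).appLE _ _ hσ (π.c.app (op V) t) = π.c.app (op V) t := by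
  have h1 : π.c.app (op V) ≫ (α σ).app ((Opens.map π.base).obj V) = π.c.app (op V) ≫ _ :=
    PresheafedSpace.congr_app (congrArg LocallyRingedSpace.Hom.toHom (h.comp_eq σ)) (op V)
  have h2 : π.c.app (op V) ≫ (α σ).appLE _ _ hσ = π.c.app (op V) := by
    have hid : ∀ f : op ((Opens.map π.base).obj V) ⟶ op ((Opens.map π.base).obj V),
        P.presheaf.map f = 𝟙 _ := fun f => by
      rw [Subsingleton.elim f (𝟙 _), P.presheaf.map_id]
    exact ((Category.assoc _ _ _).symm.trans
      (congrArg (· ≫ P.presheaf.map (homOfLE hσ).op) h1)).trans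
      ((Category.assoc _ _ _).trans ((congrArg (π.c.app (op V) ≫ ·)
        ((P.presheaf.map_comp _ _).symm.trans (hid _))).trans (Category.comp_id _)))
  exact ConcreteCategory.congr_hom h2 t

end

section Affine

variable {G : Type} [Group G] {T : Scheme.{u}} {L : LocallyRingedSpace.{u}}
  {α : G → (T ⟶ T)} {p : T.toLocallyRingedSpace ⟶ L}

lemma toΓSpecFun_apply (t : T) : L.toΓSpecFun (p.base t) =
    PrimeSpectrum.comap (p.c.app (op ⊤)).hom (T.toLocallyRingedSpace.toΓSpecFun t) :=
  congrArg (fun f => f.base t) (identityToΓSpec.naturality p)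

/-- The global functions of the quotient are the invariants of those of the scheme. -/
lemma isInvariant (hα : IsGroupAction α) (hp : IsOrbitSpace α p) :
    let := hα.sectionsAction
    let : Algebra (L.presheaf.obj (op ⊤)) Γ(T, ⊤) := (p.c.app (op ⊤)).hom.toAlgebra
    SMulCommClass G (L.presheaf.obj (op ⊤)) Γ(T, ⊤) ∧
      Algebra.IsInvariant (L.presheaf.obj (op ⊤)) Γ(T, ⊤) G := by
  let := hα.sectionsAction
  let : Algebra (L.presheaf.obj (op ⊤)) Γ(T, ⊤) := (p.c.app (op ⊤)).hom.toAlgebra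
  have happ (σ : G) (b : Γ(T, ⊤)) : (α σ).appLE ⊤ ⊤ le_top b = σ⁻¹ • b := by
    change _ = (α σ⁻¹⁻¹).appTop b
    rw [inv_inv]
    exact ConcreteCategory.congr_hom (Scheme.Hom.appLE_eq_app (α σ)) b
  have hinv (σ : G) (r : L.presheaf.obj (op ⊤)) :
      σ • algebraMap (L.presheaf.obj (op ⊤)) Γ(T, ⊤) r = algebraMap _ Γ(T, ⊤) r := by
    have := hp.appLE_app ⊤ r σ⁻¹ le_top
    exact ((happ σ⁻¹ _).trans (by rw [inv_inv]; rfl)).symm.trans this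
  refine ⟨⟨fun σ r b => ?_⟩, ⟨fun b hb => ?_⟩⟩
  · rw [Algebra.smul_def, Algebra.smul_def, MulSemiringAction.smul_mul, hinv]
  · exact hp.exists_app_eq ⊤ b fun σ _ => (happ σ b).trans (hb σ⁻¹)

/-- The quotient of an affine scheme by a finite group is an affine scheme: the group acts
transitively on the primes over a given prime of the ring of invariants, that ring extension is
integral, and the formation of invariants commutes with localization. -/
theorem isIso_toΓSpec [Finite G] [IsAffine T] (hα : IsGroupAction α) (hp : IsOrbitSpace α p) :
    IsIso L.toΓSpec := by
  let R : Type u := L.presheaf.obj (op ⊤)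
  let B : Type u := Γ(T, ⊤)
  let ρ : R →+* B := (p.c.app (op ⊤)).hom
  let : Algebra R B := ρ.toAlgebra
  let : MulSemiringAction G B := hα.sectionsAction
  have : SMulCommClass G R B := (isInvariant hα hp).1
  have : Algebra.IsInvariant R B G := (isInvariant hα hp).2
  have hint := Algebra.IsInvariant.isIntegral R B G
  have hρ : Function.Injective ρ := hp.app_injective ⊤
  let θ : T → PrimeSpectrum B := T.toLocallyRingedSpace.toΓSpecFun
  have hθ : IsHomeomorph θ := (Scheme.homeoOfIso (asIso T.toSpecΓ)).isHomeomorph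
  have hcomp (t : T) : L.toΓSpecFun (p.base t) = PrimeSpectrum.comap ρ (θ t) :=
    toΓSpecFun_apply t
  have hθα (σ : G) (t : T) : (θ (α σ t)).asIdeal = σ • (θ t).asIdeal := by
    have : θ (α σ t) = PrimeSpectrum.comap (α σ).appTop.hom (θ t) :=
      toΓSpecFun_apply (p := (α σ).toLRSHom) t
    rw [this]
    ext b
    rw [Ideal.mem_pointwise_smul_iff_inv_smul_mem]
    change _ ↔ (α σ⁻¹⁻¹).appTop.hom b ∈ _
    rw [inv_inv]
    rfl
  -- Over a basic open set, both rings of functions are localizations.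
  let D (r : R) : T.Opens := (Opens.map p.base).obj (L.toΓSpecMapBasicOpen r)
  let res (r : R) : B →+* Γ(T, D r) := (T.presheaf.map (D r).leTop.op).hom
  have hD (r : R) : D r = T.basicOpen (ρ r) := by
    have h1 := T.toLocallyRingedSpace.toΓSpec_preimage_basicOpen_eq (ρ r)
    refine Opens.ext (Eq.trans ?_ h1)
    ext t
    change L.toΓSpecFun (p.base t) ∈ PrimeSpectrum.basicOpen r ↔ _
    rw [hcomp]
    rfl
  have hloc (r : R) : @IsLocalization.Away _ _ (ρ r) Γ(T, D r) _ (res r).toAlgebra :=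
    (isAffineOpen_top T).isLocalization_of_eq_basicOpen (ρ r) (D r).leTop (hD r)
  have hres (r a : R) : p.c.app (op (L.toΓSpecMapBasicOpen r)) (L.toToΓSpecMapBasicOpen r a) =
      res r (ρ a) :=
    ConcreteCategory.congr_hom (p.c.naturality (L.toΓSpecMapBasicOpen r).leTop.op) a
  have hzero (r : R) (b : B) (hb : res r b = 0) : ∃ n : ℕ, ρ r ^ n * b = 0 := by
    let := (res r).toAlgebra
    have := hloc r
    obtain ⟨⟨_, n, rfl⟩, hn⟩ := (IsLocalization.map_eq_zero_iff (.powers (ρ r)) Γ(T, D r) b).mp hb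
    exact ⟨n, hn⟩
  refine SymPow.isIso_toΓSpec L ⟨?_, ?_⟩ ?_ ?_ ?_
  · intro x y hxy
    obtain ⟨t, rfl⟩ := hp.surjective x
    obtain ⟨t', rfl⟩ := hp.surjective y
    rw [hcomp, hcomp] at hxy
    obtain ⟨σ, hσ⟩ := Algebra.IsInvariant.exists_smul_of_under_eq R B G (θ t).asIdeal (θ t').asIdeal
      (congrArg PrimeSpectrum.asIdeal hxy)
    have : t' = α σ t := hθ.injective (PrimeSpectrum.ext (hσ.trans (hθα σ t).symm))
    rw [this]
    exact (congrArg (fun f => f.base t) (hp.comp_eq σ)).symm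
  · intro q
    let q' : PrimeSpectrum R := q
    obtain ⟨M, -, hM, hMq⟩ := Ideal.exists_ideal_over_prime_of_isIntegral (R := R) (S := B)
      q'.asIdeal ⊥ ((Ideal.comap_bot_of_injective ρ hρ).le.trans bot_le)
    obtain ⟨t, ht⟩ := hθ.surjective ⟨M, hM⟩
    exact ⟨p.base t, (hcomp t).trans (PrimeSpectrum.ext (by rw [ht]; exact hMq))⟩
  · intro C hC
    have : L.toΓSpecFun '' C = PrimeSpectrum.comap ρ '' (θ '' (p.base ⁻¹' C)) := by
      ext q
      constructor
      · rintro ⟨x, hx, rfl⟩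
        obtain ⟨t, rfl⟩ := hp.surjective x
        exact ⟨_, ⟨t, hx, rfl⟩, (hcomp t).symm⟩
      · rintro ⟨_, ⟨t, hx, rfl⟩, rfl⟩
        exact ⟨_, hx, hcomp t⟩
    rw [this]
    exact PrimeSpectrum.isClosedMap_comap_of_isIntegral ρ (algebraMap_isIntegral_iff.mpr hint) _
      (hθ.isClosedMap _ (hC.preimage p.base.hom.continuous))
  · intro r a ha
    obtain ⟨n, hn⟩ := hzero r (ρ a) (by rw [← hres, ha, map_zero])
    exact ⟨n, hρ (by rw [map_mul, map_pow, hn, map_zero])⟩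
  · intro r s
    -- A section of the quotient is a fraction `b / r ^ n`; the numerator becomes invariant after
    -- multiplication by a power of `r`.
    let s' : Γ(T, D r) := p.c.app (op (L.toΓSpecMapBasicOpen r)) s
    obtain ⟨n, b, hb⟩ : ∃ (n : ℕ) (b : B), s' * res r (ρ r) ^ n = res r b := by
      let := (res r).toAlgebra
      have := hloc r
      exact IsLocalization.Away.surj (ρ r) s'
    have hDσ (σ : G) : D r ≤ α σ ⁻¹ᵁ D r := fun t ht => by
      change (p.base (α σ t)) ∈ L.toΓSpecMapBasicOpen r
      have : p.base (α σ t) = p.base t := congrArg (fun f => f.base t) (hp.comp_eq σ)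
      rwa [this]
    have hcomm (σ : G) (x : B) : (α σ).appLE (D r) (D r) (hDσ σ) (res r x) =
        res r ((α σ).appTop x) := by
      have : T.presheaf.map (D r).leTop.op ≫ (α σ).appLE (D r) (D r) (hDσ σ) =
          (α σ).appTop ≫ T.presheaf.map (D r).leTop.op := by
        rw [Scheme.Hom.map_appLE]
        rfl
      exact ConcreteCategory.congr_hom this x
    have hρσ (σ : G) : σ • ρ r = ρ r := smul_algebraMap σ r
    have hinv (σ : G) : ∃ m : ℕ, ρ r ^ m * (σ • b - b) = 0 := by
      refine hzero r _ ?_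
      have h1 : (α σ⁻¹).appLE (D r) (D r) (hDσ σ⁻¹) s' = s' := hp.appLE_app _ s σ⁻¹ (hDσ σ⁻¹)
      have h2 : (α σ⁻¹).appLE (D r) (D r) (hDσ σ⁻¹) (res r (ρ r)) = res r (ρ r) :=
        (hcomm σ⁻¹ (ρ r)).trans (congrArg (res r) (hρσ σ))
      have h3 : res r (σ • b) = res r b := by
        refine (hcomm σ⁻¹ b).symm.trans ?_
        rw [← hb, map_mul, map_pow, h1, h2]
      rw [map_sub, h3, sub_self]
    choose m hm using hinv
    have := Fintype.ofFinite G
    classical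
    obtain ⟨a, ha⟩ := Algebra.IsInvariant.isInvariant (A := R) (G := G) (ρ r ^ (∑ σ, m σ) * b)
      fun σ => by
        have h1 : ρ r ^ (∑ σ, m σ) * (σ • b - b) = 0 := by
          rw [← Finset.add_sum_erase _ _ (Finset.mem_univ σ), add_comm, pow_add, mul_assoc, hm,
            mul_zero]
        rw [MulSemiringAction.smul_mul, smul_pow', hρσ]
        rwa [mul_sub, sub_eq_zero] at h1
    have ha' : res r (ρ a) = s' * res r (ρ r) ^ (∑ σ, m σ + n) := by
      rw [show ρ a = _ from ha, map_mul, map_pow, ← hb]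
      ring
    refine ⟨(∑ σ, m σ) + n, a, hp.app_injective _ ((hres r a).trans (ha'.trans ?_))⟩
    rw [map_mul, map_pow, hres]

end Affine

end IsOrbitSpace

end SymPow

/-! ### Open subsets of orbit spaces -/

namespace SymPow

open Opposite TopologicalSpace

lemma isIso_app_of_subset_range {L Q : LocallyRingedSpace.{u}} (i : L ⟶ Q)
    [LocallyRingedSpace.IsOpenImmersion i] (V : Opens Q) (hV : (V : Set Q) ⊆ Set.range i.base) :
    IsIso (i.c.app (op V)) := by
  have h := PresheafedSpace.IsOpenImmersion.c_iso (f := i.toHom) ((Opens.map i.base).obj V)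
  have : (PresheafedSpace.IsOpenImmersion.base_open (f := i.toHom)).functor.obj
      ((Opens.map i.base).obj V) = V := by
    refine Opens.ext ?_
    exact Set.image_preimage_eq_of_subset hV
  rwa [this] at h

namespace IsOrbitSpace

variable {G : Type} {P T : Scheme.{u}} {Q L : LocallyRingedSpace.{u}} {α : G → (P ⟶ P)}
  {π : P.toLocallyRingedSpace ⟶ Q}

/-- The image of a stable open set is open in the space of orbits, and the stable set is its
preimage. -/
lemma preimage_image (h : IsOrbitSpace α π) (W : Set P) (hW : ∀ σ, ∀ x ∈ W, α σ x ∈ W) :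
    π.base ⁻¹' (π.base '' W) = W := by
  refine Set.Subset.antisymm ?_ (Set.subset_preimage_image _ _)
  rintro x ⟨w, hw, hwx⟩
  obtain ⟨σ, rfl⟩ := h.exists_eq _ _ hwx
  exact hW σ w hw

/-- The formation of the quotient is local on the quotient. -/
theorem of_isOpenImmersion (h : IsOrbitSpace α π) (i : L ⟶ Q)
    [LocallyRingedSpace.IsOpenImmersion i] (j : T ⟶ P) [IsOpenImmersion j]
    (hr : Set.range j = π.base ⁻¹' Set.range i.base) {p : T.toLocallyRingedSpace ⟶ L}
    (hp : p ≫ i = j.toLRSHom ≫ π) {α' : G → (T ⟶ T)} (hα : ∀ σ, α' σ ≫ j = j ≫ α σ) :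
    IsOrbitSpace α' p := by
  have hiinj : Function.Injective i.base :=
    (PresheafedSpace.IsOpenImmersion.base_open (f := i.toHom)).injective
  have hjinj : Function.Injective j := j.injective
  have hpt (t : T) : i.base (p.base t) = π.base (j t) := congrArg (fun f => f.base t) hp
  have hαt (σ : G) (t : T) : α σ (j t) = j (α' σ t) :=
    (congrArg (fun f : T ⟶ P => f t) (hα σ)).symm
  have key (V : Opens Q) (hV : (V : Set Q) ⊆ Set.range i.base) :
      Function.Injective (p.c.app (op ((Opens.map i.base).obj V))) ∧
      ∀ s : Γ(T, (Opens.map p.base).obj ((Opens.map i.base).obj V)),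
        (∀ (σ : G) (h : (Opens.map p.base).obj ((Opens.map i.base).obj V) ≤
          α' σ ⁻¹ᵁ (Opens.map p.base).obj ((Opens.map i.base).obj V)),
          (α' σ).appLE _ _ h s = s) → ∃ t, p.c.app (op ((Opens.map i.base).obj V)) t = s := by
    have hi := isIso_app_of_subset_range i V hV
    let W : P.Opens := (Opens.map π.base).obj V
    let W' : T.Opens := (Opens.map p.base).obj ((Opens.map i.base).obj V)
    have hW : W' = j ⁻¹ᵁ W := by
      refine Opens.ext (Set.ext fun t => ?_)
      change i.base (p.base t) ∈ V ↔ π.base (j t) ∈ V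
      rw [hpt]
    have hWj : W ≤ j.opensRange := fun x hx => by
      change x ∈ Set.range j
      rw [hr]
      exact hV hx
    let J : Γ(P, W) ⟶ Γ(T, W') := j.appLE W W' hW.le
    have hJ : IsIso J := by
      have := j.isIso_app W hWj
      have : IsIso (T.presheaf.map (homOfLE hW.le).op) := by
        have : IsIso (homOfLE hW.le) :=
          ⟨homOfLE hW.ge, Subsingleton.elim _ _, Subsingleton.elim _ _⟩
        infer_instance
      exact IsIso.comp_isIso
    have hfac (t : Q.presheaf.obj (op V)) :
        p.c.app (op ((Opens.map i.base).obj V)) (i.c.app (op V) t) = J (π.c.app (op V) t) := by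
      have h1 := PresheafedSpace.congr_app (congrArg LocallyRingedSpace.Hom.toHom hp) (op V)
      exact ConcreteCategory.congr_hom h1 t
    have hb := ConcreteCategory.bijective_of_isIso (i.c.app (op V))
    have hJb := ConcreteCategory.bijective_of_isIso J
    refine ⟨fun x y hxy => ?_, fun s hs => ?_⟩
    · obtain ⟨x, rfl⟩ := hb.2 x
      obtain ⟨y, rfl⟩ := hb.2 y
      rw [hfac, hfac] at hxy
      rw [h.app_injective V (hJb.1 hxy)]
    · obtain ⟨w, rfl⟩ := hJb.2 s
      obtain ⟨t, rfl⟩ := h.exists_app_eq V w fun σ hσ => by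
        have hσ' : W' ≤ α' σ ⁻¹ᵁ W' := fun t ht => by
          change i.base (p.base (α' σ t)) ∈ V
          rw [hpt, ← hαt]
          exact hσ (hW.le ht)
        refine hJb.1 (Eq.trans ?_ (hs σ hσ'))
        have : (α σ).appLE W W hσ ≫ J = J ≫ (α' σ).appLE W' W' hσ' := by
          rw [Scheme.Hom.appLE_comp_appLE, Scheme.Hom.appLE_comp_appLE]
          congr 1
          exact (hα σ).symm
        exact ConcreteCategory.congr_hom this w
      exact ⟨_, hfac t⟩
  refine ⟨fun σ => ?_, fun y => ?_, fun V hV => ?_, fun x y hxy => ?_, fun V => ?_, fun V => ?_⟩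
  · rw [← cancel_mono i, Category.assoc, hp]
    exact (congrArg (fun f : T ⟶ P => f.toLRSHom ≫ π) (hα σ)).trans
      (congrArg (j.toLRSHom ≫ ·) (h.comp_eq σ))
  · obtain ⟨x, hx⟩ := h.surjective (i.base y)
    obtain ⟨t, rfl⟩ : x ∈ Set.range j := hr ▸ ⟨y, hx.symm⟩
    exact ⟨t, hiinj ((hpt t).trans hx)⟩
  · have h1 : IsOpen (i.base '' V) := by
      refine h.isOpen_of_preimage _ ?_
      have : π.base ⁻¹' (i.base '' V) = j '' (p.base ⁻¹' V) := by
        ext x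
        constructor
        · rintro ⟨y, hy, hyx⟩
          obtain ⟨t, rfl⟩ : x ∈ Set.range j := hr ▸ ⟨y, hyx⟩
          refine ⟨t, ?_, rfl⟩
          have : p.base t = y := hiinj ((hpt t).trans hyx.symm)
          rwa [Set.mem_preimage, this]
        · rintro ⟨t, ht, rfl⟩
          exact ⟨_, ht, hpt t⟩
      rw [this]
      exact j.isOpenEmbedding.isOpenMap _ hV
    have := h1.preimage i.base.hom.continuous
    rwa [Set.preimage_image_eq _ hiinj] at this
  · obtain ⟨σ, hσ⟩ := h.exists_eq (j x) (j y) (by rw [← hpt, ← hpt, hxy])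
    exact ⟨σ, hjinj ((hαt σ x).symm.trans hσ)⟩
  all_goals
    have : V = (Opens.map i.base).obj
        ((PresheafedSpace.IsOpenImmersion.base_open (f := i.toHom)).functor.obj V) :=
      Opens.ext (Set.preimage_image_eq _ hiinj).symm
    rw [this]
  · exact (key _ (Set.image_subset_range _ _)).1
  · exact (key _ (Set.image_subset_range _ _)).2

end IsOrbitSpace

end SymPow

/-! ### Finite sets of points of quasi-projective schemes -/

namespace SymPow

open Opposite TopologicalSpace

section Proj

variable {σ : Type*} {A : Type u} [CommRing A] [SetLike σ A] [AddSubgroupClass σ A]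
  (𝒜 : ℕ → σ) [GradedRing 𝒜]

/-- The standard open sets of homogeneous elements of positive degree form a basis of `Proj`. -/
lemma exists_basicOpen_le (O : (Proj 𝒜).Opens) (z : Proj 𝒜) (hz : z ∈ O) :
    ∃ n > 0, ∃ g ∈ 𝒜 n, Proj.basicOpen 𝒜 g ≤ O ∧ z ∈ Proj.basicOpen 𝒜 g := by
  obtain ⟨_, ⟨g, rfl⟩, hzg, hg⟩ :=
    Opens.isBasis_iff_nbhd.mp (Proj.isBasis_basicOpen 𝒜) hz
  rw [Proj.basicOpen_eq_iSup_proj] at hzg hg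
  obtain ⟨a, ha⟩ := Opens.mem_iSup.mp hzg
  have hb : ∃ b > 0, ∃ h ∈ 𝒜 b, z ∈ Proj.basicOpen 𝒜 h := by
    by_contra! H
    refine z.not_irrelevant_le fun x hx => ?_
    refine z.asHomogeneousIdeal.isHomogeneous.mem_iff.mpr fun b => ?_
    by_cases hb : b = 0
    · subst hb
      have := (HomogeneousIdeal.mem_irrelevant_iff 𝒜 x).mp hx
      rw [GradedRing.proj_apply] at this
      rw [this]
      exact zero_mem _
    · by_contra h
      exact H b (Nat.pos_of_ne_zero hb) _ (SetLike.coe_mem _) h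
  obtain ⟨b, hb, h, hh, hzh⟩ := hb
  refine ⟨a + b, by lia, GradedRing.proj 𝒜 a g * h,
    SetLike.mul_mem_graded (SetLike.coe_mem _) hh, ?_, ?_⟩
  · rw [Proj.basicOpen_mul]
    exact inf_le_left.trans
      ((le_iSup (fun i => Proj.basicOpen 𝒜 (GradedRing.proj 𝒜 i g)) a).trans hg)
  · rw [Proj.basicOpen_mul]
    exact ⟨ha, hzh⟩

/-- Homogeneous prime avoidance: a finite set of points in an open subset of `Proj` lies in a
standard affine open set contained in that subset. -/
theorem exists_basicOpen_le_of_finset (O : (Proj 𝒜).Opens) (s : Finset (Proj 𝒜))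
    (hs : ∀ x ∈ s, x ∈ O) :
    ∃ n > 0, ∃ g ∈ 𝒜 n, Proj.basicOpen 𝒜 g ≤ O ∧ ∀ x ∈ s, x ∈ Proj.basicOpen 𝒜 g := by
  classical
  induction s using Finset.induction_on with
  | empty => exact ⟨1, one_pos, 0, zero_mem _, by simp, by simp⟩
  | insert z s hzs ih =>
    obtain ⟨a, ha, f, hf, hfO, hfs⟩ := ih fun x hx => hs x (Finset.mem_insert_of_mem hx)
    by_cases hzf : z ∈ Proj.basicOpen 𝒜 f
    · exact ⟨a, ha, f, hf, hfO, fun x hx =>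
        (Finset.mem_insert.mp hx).elim (fun h => h ▸ hzf) (hfs x)⟩
    have hzf : f ∈ z.asHomogeneousIdeal := by simpa using hzf
    obtain ⟨b, hb, g, hg, hgO, hzg⟩ := exists_basicOpen_le 𝒜 O z (hs z (Finset.mem_insert_self _ _))
    -- `h x` vanishes at `x` but not at `z`, unless `z` is a specialization of `x`.
    have hh (x : Proj 𝒜) : ∃ (n : ℕ) (h : A), h ∈ 𝒜 n ∧ h ∉ z.asHomogeneousIdeal ∧
        (x.asHomogeneousIdeal ≤ z.asHomogeneousIdeal ∨ h ∈ x.asHomogeneousIdeal) := by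
      by_cases hxz : x.asHomogeneousIdeal ≤ z.asHomogeneousIdeal
      · exact ⟨0, 1, SetLike.one_mem_graded _,
          fun h => z.isPrime.ne_top ((Ideal.eq_top_iff_one _).mpr h), .inl hxz⟩
      · obtain ⟨y, hyx, hyz⟩ := Set.not_subset.mp hxz
        have : ∃ n, (DirectSum.decompose 𝒜 y n : A) ∉ z.asHomogeneousIdeal := by
          by_contra! H
          exact hyz (z.asHomogeneousIdeal.isHomogeneous.mem_iff.mpr H)
        obtain ⟨n, hn⟩ := this
        exact ⟨n, _, SetLike.coe_mem _, hn,
          .inr (x.asHomogeneousIdeal.isHomogeneous.mem_iff.mp hyx n)⟩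
    choose e h he hz hx using hh
    let g' := g * ∏ x ∈ s, h x
    let c := b + ∑ x ∈ s, e x
    have hg' : g' ∈ 𝒜 c :=
      SetLike.mul_mem_graded hg (SetLike.prod_mem_graded _ _ _ fun x _ => he x)
    have hzg' : g' ∉ z.asHomogeneousIdeal := by
      refine fun H => (z.isPrime.mem_or_mem H).elim hzg fun H => ?_
      obtain ⟨x, -, hx⟩ := (z.isPrime.prod_mem_iff).mp H
      exact hz x hx
    have hc : 0 < c := by lia
    have hz' : f ^ c + g' ^ a ∉ z.asHomogeneousIdeal := fun H =>
      hzg' (z.isPrime.mem_of_pow_mem a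
        ((Ideal.add_mem_iff_right _ (Ideal.pow_mem_of_mem _ hzf c hc)).mp H))
    -- At each of the points exactly one of `f` and `g'` vanishes, or the point specializes to `z`,
    -- where the sum does not vanish; the powers give both terms the same degree.
    refine ⟨c * a, Nat.mul_pos hc ha, f ^ c + g' ^ a, add_mem ?_ ?_, ?_, fun x hxs => ?_⟩
    · have := SetLike.pow_mem_graded c hf
      rwa [smul_eq_mul] at this
    · have := SetLike.pow_mem_graded a hg'
      rwa [smul_eq_mul, mul_comm] at this
    · intro x hx
      by_cases hxf : x ∈ Proj.basicOpen 𝒜 f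
      · exact hfO hxf
      · refine hgO fun hxg => hx ?_
        have hxf : f ∈ x.asHomogeneousIdeal := by simpa using hxf
        exact Ideal.add_mem _ (Ideal.pow_mem_of_mem _ hxf c hc)
          (Ideal.pow_mem_of_mem _ (Ideal.mul_mem_right _ _ hxg) a ha)
    · rcases Finset.mem_insert.mp hxs with rfl | hxs
      · exact hz'
      rcases hx x with hxz | hxh
      · exact fun H => hz' (hxz H)
      · intro H
        have hg'x : g' ∈ x.asHomogeneousIdeal.toIdeal := Ideal.mul_mem_left _ _
          (Ideal.mem_of_dvd _ (Finset.dvd_prod_of_mem _ hxs) hxh)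
        exact hfs x hxs (x.isPrime.mem_of_pow_mem c
          ((Ideal.add_mem_iff_left _ (Ideal.pow_mem_of_mem _ hg'x a ha)).mp H))

/-- A finite set of points of a scheme immersed in `Proj` lies in an affine open set. -/
theorem exists_isAffineOpen_of_isImmersion {X : Scheme.{u}} (i : X ⟶ Proj 𝒜) [IsImmersion i]
    (s : Finset X) : ∃ U : X.Opens, IsAffineOpen U ∧ ∀ x ∈ s, x ∈ U := by
  classical
  obtain ⟨n, hn, g, hg, hgO, hs⟩ := exists_basicOpen_le_of_finset 𝒜 i.coborderRange
    (s.image i) fun y hy => by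
      obtain ⟨x, -, rfl⟩ := Finset.mem_image.mp hy
      exact subset_coborder ⟨x, rfl⟩
  refine ⟨i ⁻¹ᵁ Proj.basicOpen 𝒜 g, ?_, fun x hx => hs _ (Finset.mem_image_of_mem _ hx)⟩
  have h1 : IsAffineOpen (i.coborderRange.ι ⁻¹ᵁ Proj.basicOpen 𝒜 g) :=
    (Proj.isAffineOpen_basicOpen 𝒜 g hg hn).preimage_of_isOpenImmersion _ (by simpa using hgO)
  have h2 := h1.preimage i.liftCoborder
  rwa [← Scheme.Hom.comp_preimage, i.liftCoborder_ι] at h2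

end Proj

end SymPow

/-! ### Affine open subsets of fibre powers -/

namespace SymPow

open Opposite TopologicalSpace

section SpecMaps

variable {Z : Scheme.{u}} {A B : Type u} [CommRing A] [CommRing B]

/-- The ring homomorphism `A → Γ(Z, ⊤)` given by a morphism from `Z` to `Spec A`. -/
noncomputable def toSections (a : Z ⟶ Spec (.of A)) : A →+* Γ(Z, ⊤) :=
  ((Scheme.ΓSpecIso (.of A)).inv ≫ a.appTop).hom

lemma toSpecΓ_map_toSections (a : Z ⟶ Spec (.of A)) :
    Z.toSpecΓ ≫ Spec.map (CommRingCat.ofHom (toSections a)) = a := by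
  change Z.toSpecΓ ≫ Spec.map ((Scheme.ΓSpecIso (.of A)).inv ≫ a.appTop) = a
  simp [← Scheme.toSpecΓ_naturality_assoc]

lemma toSections_injective : Function.Injective (toSections : (Z ⟶ Spec (.of A)) → _) :=
  fun a b h => by rw [← toSpecΓ_map_toSections a, h, toSpecΓ_map_toSections]

lemma toSections_comp (a : Z ⟶ Spec (.of B)) (φ : A →+* B) :
    toSections (a ≫ Spec.map (CommRingCat.ofHom φ)) = (toSections a).comp φ := by
  have : (Scheme.ΓSpecIso (.of A)).inv ≫ (a ≫ Spec.map (CommRingCat.ofHom φ)).appTop =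
      CommRingCat.ofHom φ ≫ (Scheme.ΓSpecIso (.of B)).inv ≫ a.appTop := by
    rw [Scheme.Hom.comp_appTop, Scheme.ΓSpecIso_inv_naturality_assoc]
  exact congrArg CommRingCat.Hom.hom this

lemma toSections_comp_left {Z' : Scheme.{u}} (g : Z' ⟶ Z) (a : Z ⟶ Spec (.of A)) :
    toSections (g ≫ a) = g.appTop.hom.comp (toSections a) := rfl

end SpecMaps

section Chart

variable {k : Type u} [Field k] {X : Scheme.{u}} (f : X ⟶ Spec (.of k)) {A B : Type u} [CommRing A]
  [CommRing B] [Algebra k A] [Algebra k B] {d : ℕ} {ι : Fin d → A →ₐ[k] B}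
  (u : Spec (.of A) ⟶ X)
  (hu : u ≫ f = Spec.map (CommRingCat.ofHom (algebraMap k A)))

lemma specMap_comp_eq (φ : A →ₐ[k] B) :
    Spec.map (CommRingCat.ofHom φ.toRingHom) ≫ Spec.map (CommRingCat.ofHom (algebraMap k A)) =
      Spec.map (CommRingCat.ofHom (algebraMap k B)) := by
  rw [← Spec.map_comp, ← CommRingCat.ofHom_comp]
  congr 2
  exact φ.comp_algebraMap

variable (ι) in
/-- The morphism from the spectrum of a tensor power of `A` to the fibre power of `X` which is
given by a morphism `Spec A ⟶ X` over `k`. -/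
noncomputable def specToPower : Spec (.of B) ⟶ (power f d).left :=
  (Pi.lift fun i => Over.homMk (Spec.map (CommRingCat.ofHom (ι i).toRingHom) ≫ u)
    ((Category.assoc _ _ _).trans ((congrArg (_ ≫ ·) hu).trans (specMap_comp_eq (ι i)))) :
    Over.mk (Spec.map (CommRingCat.ofHom (algebraMap k B))) ⟶ power f d).left

lemma specToPower_hom : specToPower f ι u hu ≫ (power f d).hom =
    Spec.map (CommRingCat.ofHom (algebraMap k B)) := Over.w _

lemma specToPower_proj (i : Fin d) : specToPower f ι u hu ≫ (proj f d i).left =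
    Spec.map (CommRingCat.ofHom (ι i).toRingHom) ≫ u :=
  congrArg CommaMorphism.left (Pi.lift_π (fun _ : Fin d => (Over.homMk _ _ :
    Over.mk (Spec.map (CommRingCat.ofHom (algebraMap k B))) ⟶ Over.mk f)) i)

lemma power_left_hom_ext {Z : Scheme.{u}} {a b : Z ⟶ (power f d).left}
    (h : a ≫ (power f d).hom = b ≫ (power f d).hom)
    (hi : ∀ i, a ≫ (proj f d i).left = b ≫ (proj f d i).left) : a = b := by
  let a' : Over.mk (a ≫ (power f d).hom) ⟶ power f d := Over.homMk a
  let b' : Over.mk (a ≫ (power f d).hom) ⟶ power f d := Over.homMk b h.symm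
  have : a' = b' := power_hom_ext f d _ _ fun i => Over.OverMorphism.ext (hi i)
  exact congrArg CommaMorphism.left this

/-- The spectrum of a tensor power of `A` has the universal property of a fibre power of `Spec A`:
uniqueness. -/
lemma specTensorPower_hom_ext (hι : IsTensorPower k ι) {Z : Scheme.{u}}
    {a b : Z ⟶ Spec (.of B)}
    (h : a ≫ Spec.map (CommRingCat.ofHom (algebraMap k B)) =
      b ≫ Spec.map (CommRingCat.ofHom (algebraMap k B)))
    (hi : ∀ i, a ≫ Spec.map (CommRingCat.ofHom (ι i).toRingHom) =
      b ≫ Spec.map (CommRingCat.ofHom (ι i).toRingHom)) : a = b := by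
  let C : Type u := Γ(Z, ⊤)
  let : Algebra k C := ((toSections a).comp (algebraMap k B)).toAlgebra
  let a' : B →ₐ[k] C := ⟨toSections a, fun _ => rfl⟩
  let b' : B →ₐ[k] C := ⟨toSections b, fun c => by
    have := congrArg toSections h
    rw [toSections_comp, toSections_comp] at this
    exact (DFunLike.congr_fun this c).symm⟩
  have : a' = b' := hι.hom_ext _ _ fun i => by
    have := congrArg toSections (hi i)
    rw [toSections_comp, toSections_comp] at this
    exact AlgHom.ext fun c => DFunLike.congr_fun this c
  exact toSections_injective (congrArg AlgHom.toRingHom this)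

/-- The spectrum of a tensor power of `A` has the universal property of a fibre power of `Spec A`:
existence. -/
lemma exists_specTensorPower_lift (hι : IsTensorPower k ι) {Z : Scheme.{u}} (s : Z ⟶ Spec (.of k))
    (l : Fin d → (Z ⟶ Spec (.of A)))
    (hl : ∀ i, l i ≫ Spec.map (CommRingCat.ofHom (algebraMap k A)) = s) :
    ∃ r : Z ⟶ Spec (.of B), r ≫ Spec.map (CommRingCat.ofHom (algebraMap k B)) = s ∧
      ∀ i, r ≫ Spec.map (CommRingCat.ofHom (ι i).toRingHom) = l i := by
  let C : Type u := Γ(Z, ⊤)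
  let : Algebra k C := (toSections s).toAlgebra
  let φ (i : Fin d) : A →ₐ[k] C := ⟨toSections (l i), fun c => by
    have := congrArg toSections (hl i)
    rw [toSections_comp] at this
    exact DFunLike.congr_fun this c⟩
  obtain ⟨g, hg⟩ := hι.exists_lift φ
  refine ⟨Z.toSpecΓ ≫ Spec.map (CommRingCat.ofHom g.toRingHom), ?_, fun i => ?_⟩
  · rw [Category.assoc, ← Spec.map_comp, ← CommRingCat.ofHom_comp]
    have : g.toRingHom.comp (algebraMap k B) = toSections s := g.comp_algebraMap
    rw [this, toSpecΓ_map_toSections]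
  · rw [Category.assoc, ← Spec.map_comp, ← CommRingCat.ofHom_comp]
    have : g.toRingHom.comp (ι i).toRingHom = toSections (l i) :=
      congrArg AlgHom.toRingHom (hg i)
    rw [this, toSpecΓ_map_toSections]

/-- The spectrum of the tensor power of `A` is the open subset of the fibre power of `X` formed by
the points all of whose projections lie in `Spec A`. -/
theorem specToPower_isOpenImmersion [IsOpenImmersion u] (hι : IsTensorPower k ι) :
    IsOpenImmersion (specToPower f ι u hu) ∧
      Set.range (specToPower f ι u hu) = {x | ∀ i, (proj f d i).left x ∈ Set.range u} := by
  let W : (power f d).left.Opens := ⨅ i, (proj f d i).left ⁻¹ᵁ u.opensRange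
  have hW (x : (power f d).left) : x ∈ W ↔ ∀ i, (proj f d i).left x ∈ Set.range u := by
    rw [← SetLike.mem_coe, Opens.coe_iInf, Set.mem_iInter]
    rfl
  have hj : Set.range (specToPower f ι u hu) ⊆ Set.range W.ι := by
    rw [Scheme.Opens.range_ι]
    rintro _ ⟨x, rfl⟩
    refine (hW _).mpr fun i => ?_
    rw [← Scheme.Hom.comp_apply, specToPower_proj]
    exact ⟨_, (Scheme.Hom.comp_apply _ _ _).symm⟩
  let l (i : Fin d) : W.toScheme ⟶ Spec (.of A) :=
    IsOpenImmersion.lift u (W.ι ≫ (proj f d i).left) (by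
      rintro _ ⟨x, rfl⟩
      rw [Scheme.Hom.comp_apply]
      exact (hW _).mp x.2 i)
  have hl (i : Fin d) : l i ≫ u = W.ι ≫ (proj f d i).left := IsOpenImmersion.lift_fac _ _ _
  have hlk (i : Fin d) : l i ≫ Spec.map (CommRingCat.ofHom (algebraMap k A)) =
      W.ι ≫ (power f d).hom := by
    rw [← hu, ← Category.assoc, hl, Category.assoc]
    congr 1
    exact Over.w (proj f d i)
  obtain ⟨r, hr, hri⟩ := exists_specTensorPower_lift hι (W.ι ≫ (power f d).hom) l hlk
  let j := IsOpenImmersion.lift W.ι (specToPower f ι u hu) hj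
  have hjW : j ≫ W.ι = specToPower f ι u hu := IsOpenImmersion.lift_fac _ _ _
  have hrj : r ≫ specToPower f ι u hu = W.ι := power_left_hom_ext f
    (by rw [Category.assoc, specToPower_hom, hr])
    fun i => by rw [Category.assoc, specToPower_proj, ← Category.assoc, hri, hl]
  -- Both `W` and `Spec B` have the universal property of the fibre power of `Spec A`.
  have hiso : IsIso j := by
    refine ⟨r, specTensorPower_hom_ext hι ?_ fun i => ?_, ?_⟩
    · rw [Category.assoc, hr, ← Category.assoc, hjW, specToPower_hom, Category.id_comp]
    · rw [← cancel_mono u, Category.assoc j, hri, Category.assoc, hl, ← Category.assoc, hjW,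
        specToPower_proj, Category.id_comp]
    · rw [← cancel_mono W.ι, Category.assoc, hjW, hrj, Category.id_comp]
  refine ⟨hjW ▸ inferInstance, ?_⟩
  rw [← hjW, Scheme.Hom.comp_base, TopCat.coe_comp, Set.range_comp,
    Set.range_eq_univ.mpr j.surjective, Set.image_univ, Scheme.Opens.range_ι]
  exact Set.ext hW

end Chart

end SymPow

/-! ### Charts of the symmetric power -/

namespace SymPow

open Opposite TopologicalSpace

section LocallyRingedSpace

variable {L : LocallyRingedSpace.{u}} {A : Type u} [CommRing A]

/-- The ring homomorphism from `A` to the global functions of a locally ringed space `L` given by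
a morphism from `L` to `Spec A`. -/
noncomputable def toGlobalSections (s : L ⟶ (Spec (.of A)).toLocallyRingedSpace) :
    A →+* L.presheaf.obj (op ⊤) :=
  ((Scheme.ΓSpecIso (.of A)).inv ≫ LocallyRingedSpace.Γ.map s.op).hom

lemma toGlobalSections_comp_left {L' : LocallyRingedSpace.{u}} (p : L' ⟶ L)
    (s : L ⟶ (Spec (.of A)).toLocallyRingedSpace) :
    toGlobalSections (p ≫ s) = (p.c.app (op ⊤)).hom.comp (toGlobalSections s) := rfl

/-- A morphism to an affine scheme factors canonically through the spectrum of the global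
functions. -/
lemma toΓSpec_map_toGlobalSections (s : L ⟶ (Spec (.of A)).toLocallyRingedSpace) :
    L.toΓSpec ≫ (Spec.map (CommRingCat.ofHom (toGlobalSections s))).toLRSHom = s := by
  have h1 : s ≫ (Spec (.of A)).toLocallyRingedSpace.toΓSpec =
      L.toΓSpec ≫ (Spec.map (LocallyRingedSpace.Γ.map s.op)).toLRSHom :=
    identityToΓSpec.naturality s
  have h2 : Spec.map (CommRingCat.ofHom (toGlobalSections s)) =
      Spec.map (LocallyRingedSpace.Γ.map s.op) ≫ Spec.map (Scheme.ΓSpecIso (.of A)).inv :=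
    Spec.map_comp _ _
  have h3 : (Spec (.of A)).toSpecΓ ≫ Spec.map (Scheme.ΓSpecIso (.of A)).inv = 𝟙 _ := by
    simp
  rw [h2]
  have h4 := congrArg (· ≫ (Spec.map (Scheme.ΓSpecIso (.of A)).inv).toLRSHom) h1
  refine Eq.trans (Eq.trans ?_ h4.symm) ?_
  · exact (Category.assoc _ _ _).symm
  · exact (Category.assoc _ _ _).trans ((congrArg (s ≫ ·) (congrArg Scheme.Hom.toLRSHom h3)).trans
      (Category.comp_id _))

end LocallyRingedSpace

lemma IsTensorPower.comp_algEquiv {k A B B' : Type u} [CommRing k] [CommRing A] [CommRing B]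
    [CommRing B'] [Algebra k A] [Algebra k B] [Algebra k B'] {d : ℕ} {ι : Fin d → A →ₐ[k] B}
    (hι : IsTensorPower k ι) (e : B ≃ₐ[k] B') :
    IsTensorPower k fun i => e.toAlgHom.comp (ι i) where
  hom_ext f g h := by
    have := hι.hom_ext (f.comp e.toAlgHom) (g.comp e.toAlgHom) h
    refine AlgHom.ext fun b => ?_
    simpa using DFunLike.congr_fun this (e.symm b)
  exists_lift φ := by
    obtain ⟨f, hf⟩ := hι.exists_lift φ
    refine ⟨f.comp e.symm.toAlgHom, fun i => ?_⟩
    rw [← hf i]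
    ext a
    simp

lemma IsGroupAction.of_mono {G : Type} [Group G] {P T : Scheme.{u}} {α : G → (P ⟶ P)}
    (hα : IsGroupAction α) (j : T ⟶ P) [Mono j] {α' : G → (T ⟶ T)}
    (h : ∀ σ, α' σ ≫ j = j ≫ α σ) : IsGroupAction α' where
  one_eq := by rw [← cancel_mono j, h, hα.one_eq, Category.comp_id, Category.id_comp]
  mul_eq σ τ := by
    rw [← cancel_mono j, h, hα.mul_eq, Category.assoc, h, ← Category.assoc, ← h τ, Category.assoc]

section

variable {S X : Scheme.{u}} (f : X ⟶ S) (d : ℕ)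

/-- The quotient morphism from the fibre power to the symmetric power. -/
noncomputable def symPowerπ : (power f d).left.toLocallyRingedSpace ⟶ symPower f d :=
  colimit.ι (permActionLRS f d) (SingleObj.star _)

lemma isOrbitSpace_symPowerπ :
    IsOrbitSpace (fun σ => (permHom f d σ).left) (symPowerπ f d) :=
  isOrbitSpace_colimit (permAction f d ⋙ Over.forget S)

lemma symPowerπ_symPowerHom : symPowerπ f d ≫ symPowerHom f d = (power f d).hom.toLRSHom :=
  colimit.ι_desc _ _

lemma isGroupAction_permHom : IsGroupAction fun σ => (permHom f d σ).left where
  one_eq := congrArg CommaMorphism.left ((permAction f d).map_id (SingleObj.star _))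
  mul_eq σ τ := congrArg CommaMorphism.left ((permAction f d).map_comp
    (X := SingleObj.star _) (Y := SingleObj.star _) (Z := SingleObj.star _) τ σ)

lemma permHom_left_proj (σ : Equiv.Perm (Fin d)) (i : Fin d) :
    (permHom f d σ).left ≫ (proj f d i).left = (proj f d (σ⁻¹ i)).left :=
  congrArg CommaMorphism.left (permHom_proj f d σ i)

end

section Chart

variable {k : Type u} [Field k] {X : Scheme.{u}} (f : X ⟶ Spec (.of k)) {A B : Type u} [CommRing A]
  [CommRing B] [Algebra k A] [Algebra k B] {d : ℕ} {ι : Fin d → A →ₐ[k] B}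
  (u : Spec (.of A) ⟶ X) [IsOpenImmersion u]
  (hu : u ≫ f = Spec.map (CommRingCat.ofHom (algebraMap k A)))

include hu in
/-- The points of the symmetric power which come from an affine open subset `Spec A` of the curve
form the spectrum of a smooth `k`-algebra, the ring of symmetric tensors over `A`. -/
theorem exists_chart (hι : IsTensorPower k ι) (hA : IsSmoothCurve k A) (x : (power f d).left)
    (hx : ∀ i, (proj f d i).left x ∈ Set.range u) :
    ∃ (R : Type u) (_ : CommRing R) (_ : Algebra k R)
      (g : (Spec (.of R)).toLocallyRingedSpace ⟶ symPower f d),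
      Algebra.Smooth k R ∧ LocallyRingedSpace.IsOpenImmersion g ∧
      (symPowerπ f d).base x ∈ Set.range g.base ∧
      g ≫ symPowerHom f d = (Spec.map (CommRingCat.ofHom (algebraMap k R))).toLRSHom := by
  let G := Equiv.Perm (Fin d)
  let P := (power f d).left
  let Q := symPower f d
  let α (σ : G) : P ⟶ P := (permHom f d σ).left
  let π : P.toLocallyRingedSpace ⟶ Q := symPowerπ f d
  have hπ : IsOrbitSpace α π := isOrbitSpace_symPowerπ f d
  let T := Spec (.of B)
  let j : T ⟶ P := specToPower f ι u hu
  obtain ⟨hj, hjr⟩ := specToPower_isOpenImmersion f u hu hι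
  have hproj (σ : G) (z : P) (i : Fin d) :
      (proj f d i).left (α σ z) = (proj f d (σ⁻¹ i)).left z := by
    rw [← permHom_left_proj f d σ i]
    exact (Scheme.Hom.comp_apply _ _ _).symm
  have hstable (σ : G) (z : P) (hz : z ∈ Set.range j) : α σ z ∈ Set.range j := by
    rw [hjr] at hz ⊢
    exact fun i => hproj σ z i ▸ hz (σ⁻¹ i)
  have hrange (σ : G) : Set.range (j ≫ α σ) ⊆ Set.range j := by
    rintro _ ⟨t, rfl⟩
    rw [Scheme.Hom.comp_apply]
    exact hstable σ _ ⟨t, rfl⟩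
  let α' (σ : G) : T ⟶ T := IsOpenImmersion.lift j (j ≫ α σ) (hrange σ)
  have hα' (σ : G) : α' σ ≫ j = j ≫ α σ := IsOpenImmersion.lift_fac _ _ _
  have hgrp : IsGroupAction α' := IsGroupAction.of_mono (isGroupAction_permHom f d) j hα'
  have hsat := hπ.preimage_image (Set.range j) hstable
  let V : Opens Q := ⟨π.base '' Set.range j, hπ.isOpen_of_preimage _ (by
    rw [hsat]; exact j.isOpenEmbedding.isOpen_range)⟩
  let L := Q.restrict V.isOpenEmbedding
  let i : L ⟶ Q := Q.ofRestrict V.isOpenEmbedding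
  have hir : Set.range i.base = π.base '' Set.range j := Subtype.range_coe
  have hi : LocallyRingedSpace.IsOpenImmersion i := inferInstance
  let p : T.toLocallyRingedSpace ⟶ L := LocallyRingedSpace.IsOpenImmersion.lift i (j.toLRSHom ≫ π)
    (by
      rw [hir]
      rintro _ ⟨t, rfl⟩
      exact ⟨_, ⟨t, rfl⟩, rfl⟩)
  have hp : p ≫ i = j.toLRSHom ≫ π := LocallyRingedSpace.IsOpenImmersion.lift_fac _ _ _
  have hL : IsOrbitSpace α' p := hπ.of_isOpenImmersion i j (by rw [hir]; exact hsat.symm) hp hα'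
  have hiso : IsIso L.toΓSpec := hL.isIso_toΓSpec hgrp
  -- The ring of functions on the quotient is the ring of symmetric tensors.
  let s : L ⟶ (Spec (.of k)).toLocallyRingedSpace := i ≫ symPowerHom f d
  have hs : p ≫ s = (Spec.map (CommRingCat.ofHom (algebraMap k B))).toLRSHom := by
    rw [← Category.assoc, hp, Category.assoc, symPowerπ_symPowerHom]
    exact congrArg Scheme.Hom.toLRSHom (specToPower_hom f u hu)
  let R : Type u := L.presheaf.obj (op ⊤)
  let B' : Type u := Γ(T, ⊤)
  let : Algebra k R := (toGlobalSections s).toAlgebra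
  let : Algebra R B' := (p.c.app (op ⊤)).hom.toAlgebra
  let : Algebra k B' := (toSections (Spec.map (CommRingCat.ofHom (algebraMap k B)))).toAlgebra
  have : IsScalarTower k R B' := .of_algebraMap_eq' (by
    have := congrArg toGlobalSections hs
    rw [toGlobalSections_comp_left] at this
    exact this.symm)
  let : MulSemiringAction G B' := hgrp.sectionsAction
  have : SMulCommClass G R B' := (hL.isInvariant hgrp).1
  have : Algebra.IsInvariant R B' G := (hL.isInvariant hgrp).2
  have hid (C : Type u) [CommRing C] (φ : C →+* B) (c : C) :
      toSections (Spec.map (CommRingCat.ofHom φ)) c = toSections (𝟙 T) (φ c) := by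
    rw [← Category.id_comp (Spec.map (CommRingCat.ofHom φ)), toSections_comp]; rfl
  have : IsIso (𝟙 T : T ⟶ T).appTop := inferInstanceAs (IsIso ((𝟙 T : T ⟶ T).app ⊤))
  let e : B ≃ₐ[k] B' := AlgEquiv.ofBijective
    { toSections (𝟙 T) with commutes' := fun c => (hid k (algebraMap k B) c).symm }
    (ConcreteCategory.bijective_of_isIso
      ((Scheme.ΓSpecIso (.of B)).inv ≫ (𝟙 T : T ⟶ T).appTop))
  have hequiv (σ : G) (i : Fin d) : α' σ⁻¹ ≫ Spec.map (CommRingCat.ofHom (ι i).toRingHom) =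
      Spec.map (CommRingCat.ofHom (ι (σ i)).toRingHom) := by
    rw [← cancel_mono u, Category.assoc, ← specToPower_proj f u hu, ← specToPower_proj f u hu,
      ← Category.assoc]
    have := permHom_left_proj f d σ⁻¹ i
    rw [inv_inv] at this
    rw [← this, ← Category.assoc]
    exact congrArg (· ≫ (proj f d i).left) (hα' σ⁻¹)
  have hsm : Algebra.Smooth k R := by
    refine smooth_invariants (A := A) (B := B') (ι := fun i => e.toAlgHom.comp (ι i)) R hA
      (hι.comp_algEquiv e) (hL.app_injective ⊤) fun σ i a => ?_
    change (α' σ⁻¹).appTop.hom (toSections (𝟙 T) ((ι i).toRingHom a)) =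
      toSections (𝟙 T) ((ι (σ i)).toRingHom a)
    rw [← hid, ← hid, ← hequiv, toSections_comp_left]
    rfl
  let γ : L ⟶ (Spec (.of R)).toLocallyRingedSpace := L.toΓSpec
  have : IsIso γ := hiso
  refine ⟨R, inferInstance, inferInstance, inv γ ≫ i, hsm, inferInstance, ?_, ?_⟩
  · obtain ⟨t, rfl⟩ : x ∈ Set.range j := hjr ▸ hx
    refine ⟨γ.base (p.base t), ?_⟩
    have : p ≫ γ ≫ inv γ ≫ i = j.toLRSHom ≫ π := by rw [IsIso.hom_inv_id_assoc, hp]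
    exact congrArg (fun f => f.base t) this
  · rw [Category.assoc, IsIso.inv_comp_eq]
    exact (toΓSpec_map_toGlobalSections s).symm

end Chart

end SymPow

/-! ### Symmetric powers of quasi-projective curves -/

namespace SymPow

open Opposite TopologicalSpace

variable {k : Type u} [Field k] {X : Scheme.{u}} (f : X ⟶ Spec (.of k))

/-- The symmetric power of a smooth quasi-projective curve is covered by spectra of smooth
`k`-algebras. -/
theorem exists_chart_of_isQuasiProjective (hf : SmoothOfRelativeDimension 1 f)
    (hqp : IsQuasiProjective f) (d : ℕ) (y : symPower f d) :
    ∃ (R : Type u) (_ : CommRing R) (_ : Algebra k R)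
      (g : (Spec (.of R)).toLocallyRingedSpace ⟶ symPower f d),
      Algebra.Smooth k R ∧ LocallyRingedSpace.IsOpenImmersion g ∧ y ∈ Set.range g.base ∧
      g ≫ symPowerHom f d = (Spec.map (CommRingCat.ofHom (algebraMap k R))).toLRSHom := by
  classical
  obtain ⟨x, rfl⟩ := (isOrbitSpace_symPowerπ f d).surjective y
  obtain ⟨n, i, hi, -⟩ := hqp
  let := MvPolynomial.gradedAlgebra (σ := Fin (n + 1)) (R := k)
  obtain ⟨U, hU, hxU⟩ := exists_isAffineOpen_of_isImmersion _ i
    (Finset.univ.image fun i : Fin d => (proj f d i).left x)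
  let A : Type u := Γ(X, U)
  let u : Spec (.of A) ⟶ X := hU.fromSpec
  have hui : IsOpenImmersion u := hU.isOpenImmersion_fromSpec
  let φ : CommRingCat.of k ⟶ CommRingCat.of A := Spec.preimage (u ≫ f)
  have hφ : Spec.map φ = u ≫ f := Spec.map_preimage _
  let : Algebra k A := φ.hom.toAlgebra
  have hA : IsSmoothCurve k A := by
    have h1 : SmoothOfRelativeDimension (0 + 1) (u ≫ f) := inferInstance
    rw [zero_add, ← hφ, HasRingHomProperty.Spec_iff (P := @SmoothOfRelativeDimension 1)] at h1
    exact isSmoothCurve_iff_locally.mpr h1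
  refine exists_chart f u hφ.symm (isTensorPower_piTensorProduct k A d) hA x fun i => ?_
  have : Set.range u = U := hU.range_fromSpec
  rw [this]
  exact hxU _ (Finset.mem_image_of_mem _ (Finset.mem_univ i))

/-- The symmetric power of a smooth quasi-projective curve is a smooth scheme. -/
theorem exists_smooth_scheme_iso (hf : SmoothOfRelativeDimension 1 f) (hqp : IsQuasiProjective f)
    (d : ℕ) : ∃ (Y : Scheme.{u}) (e : Y.toLocallyRingedSpace ≅ symPower f d),
      Smooth (⟨e.hom ≫ symPowerHom f d⟩ : Y ⟶ Spec (.of k)) := by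
  choose R hR hkR g hsm hg hy hgf using exists_chart_of_isQuasiProjective f hf hqp d
  let Y : Scheme.{u} := LocallyRingedSpace.IsOpenImmersion.scheme (symPower f d)
    fun y => ⟨.of (R y), g y, hy y, hg y⟩
  let s : Y ⟶ Spec (.of k) := ⟨symPowerHom f d⟩
  refine ⟨Y, Iso.refl _, (congrArg (@Smooth Y (Spec (.of k)))
    (Scheme.Hom.ext' (Category.id_comp _) : _ = s)).mpr ?_⟩
  let i (y : symPower f d) : Spec (.of (R y)) ⟶ Y := ⟨g y⟩
  have hi (y : symPower f d) : IsOpenImmersion (i y) := hg y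
  let 𝒰 : Y.OpenCover := Scheme.Cover.mkOfCovers (symPower f d) (fun y => Spec (.of (R y))) i
    (fun y => ⟨y, hy y⟩) hi
  -- Instance search does not unify `@Smooth` with a morphism property, so the instance is named.
  have : IsZariskiLocalAtSource (@Smooth.{u}) :=
    HasRingHomProperty.instIsZariskiLocalAtSource (Q := RingHom.Smooth)
  refine (IsZariskiLocalAtSource.iff_of_openCover (P := @Smooth.{u}) 𝒰).mpr
    fun (y : symPower f d) => ?_
  have : i y ≫ s = Spec.map (CommRingCat.ofHom (algebraMap k (R y))) :=
    Scheme.Hom.ext' (hgf y)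
  change Smooth (i y ≫ s)
  rw [this, HasRingHomProperty.Spec_iff (P := @Smooth)]
  exact (RingHom.smooth_algebraMap).mpr (hsm y)

theorem isRegularLocalRing_stalk (hf : SmoothOfRelativeDimension 1 f) (hqp : IsQuasiProjective f)
    (d : ℕ) (y : symPower f d) : IsRegularLocalRing ((symPower f d).presheaf.stalk y) := by
  obtain ⟨R, _, _, g, hsm, hg, ⟨t, rfl⟩, -⟩ :=
    exists_chart_of_isQuasiProjective f hf hqp d y
  have hR : IsRegularRing R := isRegularRing_of_smooth k R
  let t' : PrimeSpectrum R := t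
  let S : Type u := (Spec (.of R)).presheaf.stalk t
  let : Algebra R S := StructureSheaf.stalkAlgebra R t
  have : IsLocalization.AtPrime S t'.asIdeal := StructureSheaf.IsLocalization.to_stalk R t
  let e₁ : Localization.AtPrime t'.asIdeal ≃+* S :=
    (IsLocalization.algEquiv t'.asIdeal.primeCompl _ _).toRingEquiv
  let e₂ : S ≃+* (symPower f d).presheaf.stalk (g.base t) :=
    (asIso (g.stalkMap t)).symm.commRingCatIsoToRingEquiv
  exact .of_ringEquiv (e₁.trans e₂)

end SymPow

theorem propositionE {k : Type u} [Field k] {X : Scheme.{u}} (f : X ⟶ Spec (.of k))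
    (hf : SmoothOfRelativeDimension 1 f) (hqp : SymPow.IsQuasiProjective f)
    (hX : ConnectedSpace X) (d : ℕ) :
    (∃ (Y : Scheme.{u}) (e : Y.toLocallyRingedSpace ≅ SymPow.symPower f d),
      Smooth (⟨e.hom ≫ SymPow.symPowerHom f d⟩ : Y ⟶ Spec (.of k))) ∧
    ∀ y : (SymPow.symPower f d).toTopCat, IsRegularLocalRing ((SymPow.symPower f d).presheaf.stalk y) := by
  exact ⟨SymPow.exists_smooth_scheme_iso f hf hqp d,
    SymPow.isRegularLocalRing_stalk f hf hqp d⟩
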